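/- Let $k$ be a commutative $\mathbb{Q}$-algebra, $q\in k$, and $Y=\{y_s\}_{s\ge 1}$ an alphabet ordered by $y_1>y_2>\cdots$; words are ordered lexicographically, and $(w)=i_1+\dots+i_r$ is the weight of $w=y_{i_1}\cdots y_{i_r}$. The $q$-stuffle product $\star$ on the $k$-module with basis $Y^*$ is the bilinear product with unit the empty word and $y_su\star y_tv=y_s(u\star y_tv)+y_t(y_su\star v)+q\,y_{s+t}(u\star v)$. Let $\Delta$ be the algebra morphism $k\langle Y\rangle\to k\langle Y\rangle\otimes k\langle Y\rangle$ (for concatenation) with $\Delta y_s=y_s\otimes1+1\otimes y_s+q\sum_{s_1+s_2=s}y_{s_1}\otimes y_{s_2}$, and let $\mathcal P=\{P\in k\langle Y\rangle\mid \Delta P=P\otimes 1+1\otimes P\}$ be the Lie algebra of primitive polynomials. Put $\langle u\mid v\rangle=\delta_{u,v}$ for words, $\pi_1(w)=\sum_{n\ge1}\frac{(-1)^{n-1}}{n}\sum_{u_1,\dots,u_n\in Y^+}\langle w\mid u_1\star\cdots\star u_n\rangle\,u_1\cdots u_n$, and define $\Pi_{y_s}=\pi_1(y_s)$; $\Pi_l=[\Pi_s,\Pi_r]$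 for a Lyndon word $l$ of length at least $2$ with standard factorization $l=sr$ ($r$ the longest proper Lyndon right factor); and $\Pi_w=\Pi_{l_1}^{i_1}\cdots\Pi_{l_k}^{i_k}$ for $w=l_1^{i_1}\cdots l_k^{i_k}$ with Lyndon words $l_1>\cdots>l_k$. Then there is a unique family $(\Sigma_w)_{w\in Y^*}$ in the $q$-stuffle algebra with $\langle\Sigma_v\mid\Pi_u\rangle=\delta_{u,v}$ for all words $u,v$, and: 1. For every nonempty word $w$, $\Sigma_w$ is proper (no constant term), homogeneous of weight $(w)$, and its coefficients are values at $q$ of polynomials with nonnegative rational coefficients. 2. In the completed tensor product of the $q$-stuffle algebra (left) and $k\langle Y\rangle$ with concatenation (right), with coefficientwise convergence, the diagonal series $\mathcal D_Y=\sum_{w\in Y^*}w\otimes w$ satisfies $\mathcal D_Y=\sum_{w\in Y^*}\Sigma_w\otimes\Pi_w=\prod_{l\ \mathrm{Lyndon}}^{\searrow}\exp(\Sigma_l\otimes\Pi_l)$, where the product over all Lyndon words is the limit of the decreasing products over finite sets of Lyndon words. 3. The Lyndon words form a transcendence basis of the $q$-stuffle algebra and generate it (so that it is the polynomial algebra on them).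 The elements $\chi_w=\frac{1}{i_1!\cdots i_k!}\,l_1^{\star i_1}\star\cdots\star l_k^{\star i_k}$, for $w=l_1^{i_1}\cdots l_k^{i_k}$ with Lyndon words $l_1>\cdots>l_k$, are proper for $w$ nonempty, have coefficients that are values at $q$ of polynomials with nonnegative rational coefficients, and form a basis of the $k$-module underlying the $q$-stuffle algebra. 4. There is a unique family $(\xi_w)_{w\in Y^*}$ in $k\langle Y\rangle$ with $\langle\chi_v\mid\xi_u\rangle=\delta_{u,v}$ for all words $u,v$; it is a basis of $k\langle Y\rangle$. The family $(\xi_l)_{l\ \mathrm{Lyndon}}$ is a basis of $\mathcal P$, and $\mathcal P$ is the free Lie algebra on the elements $\pi_1(y_s)$, $s\ge1$. -/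

import Mathlib

open scoped TensorProduct Topology Nat

attribute [local instance] LieRing.ofAssociativeRing LieAlgebra.ofAssociativeAlgebra

noncomputable section

namespace QStuffleHopf

universe u

/-! ### The alphabet `Y = {y₁ > y₂ > ⋯}`, words, weight, Lyndon words -/

/-- The letter `y_s` is the positive integer `s`, in the reversed order: `y₁ > y₂ > ⋯`.
The sum of two letters is `y_s + y_t = y_{s+t}`. -/
abbrev Letter : Type := ℕ+ᵒᵈ

/-- The letter `y_s`. -/
def y (s : ℕ+) : Letter := OrderDual.toDual s

/-- Words over `Y`, totally ordered by the lexicographic order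
(a proper prefix of a word is smaller than the word). -/
abbrev Word : Type := List Letter

/-- The weight `i₁ + ⋯ + i_r` of the word `y_{i₁} ⋯ y_{i_r}`. -/
def weight (w : Word) : ℕ := (w.map fun a => ((OrderDual.ofDual a : ℕ+) : ℕ)).sum

/-- A Lyndon word: a nonempty word strictly smaller than all its proper nonempty right factors. -/
def IsLyndon (w : Word) : Prop :=
  w ≠ [] ∧ ∀ u v : Word, u ≠ [] → v ≠ [] → w = u ++ v → w < v

/-- The set `Lyn Y` of Lyndon words. -/
abbrev LyndonWord : Type := {w : Word // IsLyndon w}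

/-- `L` is the nonincreasing factorization `w = l₁ ⋯ l_n`, `l₁ ≥ ⋯ ≥ l_n`, into Lyndon words. -/
def IsLyndonFactorization (w : Word) (L : List Word) : Prop :=
  (∀ l ∈ L, IsLyndon l) ∧ L.Pairwise (fun a b => b ≤ a) ∧ L.flatten = w

/-- The (unique) nonincreasing factorization of a word into Lyndon words. -/
def lyndonFactorization (w : Word) : List Word :=
  Classical.epsilon (IsLyndonFactorization w)

/-- `i₁! ⋯ i_k!`, where `w = l₁^{i₁} ⋯ l_k^{i_k}` with Lyndon words `l₁ > ⋯ > l_k`. -/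
def multFactorial (w : Word) : ℕ :=
  ∏ l ∈ (lyndonFactorization w).toFinset, ((lyndonFactorization w).count l)!

/-- The word `w` can be cut at position `i` into two nonempty factors, the right one Lyndon. -/
def IsLyndonCut (w : Word) (i : ℕ) : Prop :=
  0 < i ∧ i < w.length ∧ IsLyndon (w.drop i)

section Algebra

variable {k : Type u} [CommRing k]

/-! ### The commutative `q`-stuffle algebra -/

/-- The `k`-module with basis the words over `Y`, to be endowed with the `q`-stuffle product. -/
def QStuffle (_q : k) : Type u := Word →₀ k

namespace QStuffle

variable (q : k)

instance : AddCommGroup (QStuffle q) := inferInstanceAs (AddCommGroup (Word →₀ k))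
instance : Module k (QStuffle q) := inferInstanceAs (Module k (Word →₀ k))

/-- A word, as an element of the `q`-stuffle algebra. -/
def word (w : Word) : QStuffle q := (Finsupp.single w 1 : Word →₀ k)

variable {q}

/-- The coefficients `w ↦ ⟨S | w⟩`. -/
def coeff : QStuffle q →ₗ[k] (Word →₀ k) := LinearMap.id

variable (q)

/-- Left concatenation with the letter `a`, extended linearly. -/
def prep (a : Letter) : QStuffle q →ₗ[k] QStuffle q :=
  Finsupp.lmapDomain k k (fun w : Word => a :: w)

/-- The `q`-stuffle of two words. -/
def stuffleWord : Word → Word → QStuffle q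
  | [], v => word q v
  | a :: u, [] => word q (a :: u)
  | a :: u, b :: v =>
      prep q a (stuffleWord u (b :: v)) + prep q b (stuffleWord (a :: u) v)
        + q • prep q (a + b) (stuffleWord u v)
termination_by u v => u.length + v.length

/-- The `q`-stuffle product, as a bilinear map. -/
def mulLin : QStuffle q →ₗ[k] QStuffle q →ₗ[k] QStuffle q :=
  (Finsupp.linearCombination k fun u : Word =>
    (Finsupp.linearCombination k fun v : Word => stuffleWord q u v) ∘ₗ
      (coeff : QStuffle q →ₗ[k] (Word →₀ k))) ∘ₗ (coeff : QStuffle q →ₗ[k] (Word →₀ k))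

theorem coeff_word (w : Word) : coeff (word q w) = Finsupp.single w 1 := rfl

theorem mulLin_word (u v : Word) : mulLin q (word q u) (word q v) = stuffleWord q u v := by
  simp [mulLin, coeff_word]

theorem prep_word (a : Letter) (w : Word) : prep q a (word q w) = word q (a :: w) := by
  unfold prep word
  erw [Finsupp.lmapDomain_apply, Finsupp.mapDomain_single]

theorem lin_ext {M : Type*} [AddCommGroup M] [Module k M] {f g : QStuffle q →ₗ[k] M}
    (h : ∀ w, f (word q w) = g (word q w)) : f = g :=
  Finsupp.lhom_ext' (M := k) (N := M) fun w => LinearMap.ext_ring (h w)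

theorem stuffleWord_nil (u : Word) : stuffleWord q u [] = word q u := by
  cases u <;> rw [stuffleWord]

theorem nil_stuffleWord (u : Word) : stuffleWord q [] u = word q u := by
  rw [stuffleWord]

theorem mulLin_prep (a b : Letter) (P R : QStuffle q) :
    mulLin q (prep q a P) (prep q b R) =
      prep q a (mulLin q P (prep q b R)) + prep q b (mulLin q (prep q a P) R)
        + q • prep q (a + b) (mulLin q P R) := by
  have key : (mulLin q).compl₁₂ (prep q a) (prep q b) =
      ((mulLin q).compl₂ (prep q b)).compr₂ (prep q a)
        + ((mulLin q).comp (prep q a)).compr₂ (prep q b)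
        + q • (mulLin q).compr₂ (prep q (a + b)) := by
    refine lin_ext q fun u => lin_ext q fun v => ?_
    simp only [LinearMap.compl₁₂_apply, LinearMap.add_apply, LinearMap.compr₂_apply,
      LinearMap.compl₂_apply, LinearMap.comp_apply, LinearMap.smul_apply, prep_word, mulLin_word]
    rw [stuffleWord]
  have := congrArg (fun f => f P R) key
  simpa using this

theorem stuffleWord_comm (u v : Word) : stuffleWord q u v = stuffleWord q v u := by
  induction hn : u.length + v.length using Nat.strong_induction_on generalizing u v with
  | _ n ih =>
    subst hn
    cases u with
    | nil => rw [stuffleWord_nil, nil_stuffleWord]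
    | cons a u =>
      cases v with
      | nil => rw [stuffleWord_nil, nil_stuffleWord]
      | cons b v =>
        rw [stuffleWord, stuffleWord, ih _ (by simp) u (b :: v) rfl,
          ih _ (by simp) (a :: u) v rfl, ih _ (by simp; omega) u v rfl,
          add_comm a b]
        abel

theorem mulLin_comm (P R : QStuffle q) : mulLin q P R = mulLin q R P := by
  have key : mulLin q = (mulLin q).flip := by
    refine lin_ext q fun u => lin_ext q fun v => ?_
    rw [LinearMap.flip_apply, mulLin_word, mulLin_word, stuffleWord_comm]
  exact congrArg (fun f => f P R) key

theorem mulLin_one_left (P : QStuffle q) : mulLin q (word q []) P = P := by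
  have key : mulLin q (word q []) = LinearMap.id := by
    refine lin_ext q fun u => ?_
    rw [mulLin_word, nil_stuffleWord, LinearMap.id_apply]
  rw [key, LinearMap.id_apply]

theorem mulLin_assoc_word (u v w : Word) :
    mulLin q (mulLin q (word q u) (word q v)) (word q w) =
      mulLin q (word q u) (mulLin q (word q v) (word q w)) := by
  induction hn : u.length + v.length + w.length using Nat.strong_induction_on
    generalizing u v w with
  | _ n ih =>
    subst hn
    cases u with
    | nil => rw [mulLin_one_left, mulLin_one_left]
    | cons a u =>
      cases v with
      | nil => rw [mulLin_one_left, mulLin_comm q _ (word q []), mulLin_one_left]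
      | cons b v =>
        cases w with
        | nil => rw [mulLin_comm q _ (word q []), mulLin_comm q _ (word q []),
            mulLin_one_left, mulLin_one_left]
        | cons c w =>
          have h1 := ih _ (by simp) u (b :: v) (c :: w) rfl
          have h2 := ih _ (by simp) (a :: u) v (c :: w) rfl
          have h3 := ih _ (by simp) (a :: u) (b :: v) w rfl
          have h4 := ih _ (by simp; omega) u v (c :: w) rfl
          have h5 := ih _ (by simp; omega) u (b :: v) w rfl
          have h6 := ih _ (by simp; omega) (a :: u) v w rfl
          have h7 := ih _ (by simp; omega) u v w rfl
          simp only [← prep_word] at h1 h2 h3 h4 h5 h6 ⊢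
          rw [mulLin_prep q b c] at h1
          rw [mulLin_prep q a b] at h3
          rw [mulLin_prep q a b, mulLin_prep q b c]
          simp only [map_add, map_smul, LinearMap.add_apply, LinearMap.smul_apply] at h1 h3 ⊢
          have e1 := congrArg (prep q a) h1
          have e2 := congrArg (prep q b) h2
          have e3 := congrArg (prep q c) h3
          have e4 := congrArg (prep q (a + b)) h4
          have e5 := congrArg (prep q (a + c)) h5
          have e6 := congrArg (prep q (b + c)) h6
          have e7 := congrArg (prep q (a + b + c)) h7
          rw [mulLin_prep q a c, mulLin_prep q b c, mulLin_prep q (a + b) c,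
            mulLin_prep q a b, mulLin_prep q a c, mulLin_prep q a (b + c), ← add_assoc a b c]
          simp only [map_add, map_smul] at e1 e2 e3 e4 e5 e6 e7 ⊢
          linear_combination (norm := module) e1 + e2 + e3 + q • e4 + q • e5 + q • e6 + (q * q) • e7

theorem mulLin_assoc (P R T : QStuffle q) :
    mulLin q (mulLin q P R) T = mulLin q P (mulLin q R T) := by
  have key : (mulLin q).compr₂ (mulLin q) =
      ((LinearMap.llcomp k (QStuffle q) (QStuffle q) (QStuffle q)).flip.comp (mulLin q)).flip.comp
        (mulLin q) := by
    refine lin_ext q fun u => lin_ext q fun v => lin_ext q fun w => ?_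
    simpa using mulLin_assoc_word q u v w
  have := congrArg (fun f => f P R T) key
  simpa using this

/-- The `q`-stuffle algebra, commutative, associative, with unit the empty word. -/
instance : CommRing (QStuffle q) :=
  { (inferInstance : AddCommGroup (QStuffle q)) with
    mul := fun P R => mulLin q P R
    one := word q []
    left_distrib := fun P R T => map_add (mulLin q P) R T
    right_distrib := fun P R T => by
      change mulLin q (P + R) T = mulLin q P T + mulLin q R T
      rw [map_add, LinearMap.add_apply]
    zero_mul := fun P => by
      change mulLin q 0 P = 0
      rw [map_zero, LinearMap.zero_apply]
    mul_zero := fun P => map_zero (mulLin q P)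
    mul_assoc := mulLin_assoc q
    one_mul := mulLin_one_left q
    mul_one := fun P => (mulLin_comm q P (word q [])).trans (mulLin_one_left q P)
    mul_comm := mulLin_comm q }

theorem mul_def (P R : QStuffle q) : P * R = mulLin q P R := rfl

theorem one_def : (1 : QStuffle q) = word q [] := rfl

instance : Algebra k (QStuffle q) :=
  Algebra.ofModule
    (fun c P R => by rw [mul_def, mul_def, map_smul, LinearMap.smul_apply])
    (fun c P R => by rw [mul_def, mul_def, map_smul])

/-- The product of words is the `q`-stuffle. -/
theorem word_mul_word (u v : Word) : word q u * word q v = stuffleWord q u v :=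
  mulLin_word q u v

end QStuffle

/-! ### Noncommutative polynomials and the `q`-stuffle coproduct -/

/-- The algebra `k⟨Y⟩` of noncommutative polynomials, with the concatenation product. -/
abbrev NCPoly (k : Type u) [CommRing k] : Type u := MonoidAlgebra k (FreeMonoid Letter)

/-- A word, as a noncommutative polynomial. -/
def ncWord (k : Type u) [CommRing k] (w : Word) : NCPoly k :=
  MonoidAlgebra.single (FreeMonoid.ofList w) 1

/-- The coefficient `⟨P | w⟩` of the word `w` in `P`. -/
def ncCoeff (P : NCPoly k) (w : Word) : k := P.coeff (FreeMonoid.ofList w)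

/-- The pairing `⟨S | P⟩ = ∑_w ⟨S | w⟩ ⟨P | w⟩`. -/
def pairing {q : k} (S : QStuffle q) (P : NCPoly k) : k :=
  (QStuffle.coeff S).sum fun w a => a * ncCoeff P w

/-- The coproduct of a letter:
`Δ y_s = y_s ⊗ 1 + 1 ⊗ y_s + q ∑_{s₁ + s₂ = s} y_{s₁} ⊗ y_{s₂}`. -/
def coprodLetter (q : k) (a : Letter) : NCPoly k ⊗[k] NCPoly k :=
  ncWord k [a] ⊗ₜ[k] 1 + 1 ⊗ₜ[k] ncWord k [a]
    + q • ∑ p ∈ (Finset.Icc 1 (OrderDual.ofDual a) ×ˢ Finset.Icc 1 (OrderDual.ofDual a)).filter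
        (fun p : ℕ+ × ℕ+ => p.1 + p.2 = OrderDual.ofDual a),
      ncWord k [y p.1] ⊗ₜ[k] ncWord k [y p.2]

/-- The `q`-stuffle coproduct, the algebra morphism `k⟨Y⟩ → k⟨Y⟩ ⊗ k⟨Y⟩` extending
`coprodLetter`. -/
def coprod (q : k) : NCPoly k →ₐ[k] NCPoly k ⊗[k] NCPoly k :=
  MonoidAlgebra.lift k _ _ (FreeMonoid.lift (coprodLetter q))

/-- The Lie algebra `{P ∈ k⟨Y⟩ | Δ P = P ⊗ 1 + 1 ⊗ P}` of primitive polynomials. -/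
def primitive (q : k) : LieSubalgebra k (NCPoly k) where
  carrier := {P | coprod q P = P ⊗ₜ[k] 1 + 1 ⊗ₜ[k] P}
  zero_mem' := by simp
  add_mem' := by
    intro P R hP hR
    simp only [Set.mem_ofPred_eq] at hP hR ⊢
    rw [map_add, hP, hR, TensorProduct.add_tmul, TensorProduct.tmul_add]
    abel
  smul_mem' := by
    intro c P hP
    simp only [Set.mem_ofPred_eq] at hP ⊢
    rw [map_smul, hP, smul_add, TensorProduct.smul_tmul', TensorProduct.tmul_smul]
  lie_mem' := by
    intro P R hP hR
    simp only [Set.mem_ofPred_eq] at hP hR ⊢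
    change coprod q P = _ at hP
    change coprod q R = _ at hR
    rw [LieRing.of_associative_ring_bracket, map_sub, map_mul, map_mul, hP, hR]
    simp only [mul_add, add_mul, Algebra.TensorProduct.tmul_mul_tmul, mul_one, one_mul,
      TensorProduct.sub_tmul, TensorProduct.tmul_sub]
    abel

/-! ### Double series

The completed tensor product of the `q`-stuffle algebra (left) and of `k⟨Y⟩` (right) is realised
as the algebra of noncommutative power series in the words over `Y`, with the concatenation
product, whose coefficients lie in the `q`-stuffle algebra: `f` stands for `∑_v f(v) ⊗ v`. -/

/-- Noncommutative formal power series `∑_v f(v) v` over `Y` with coefficients in `A`. -/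
def NCSeries (A : Type u) : Type u := Word → A

namespace NCSeries

variable {A : Type u} [CommRing A]

instance : AddCommGroup (NCSeries A) := inferInstanceAs (AddCommGroup (Word → A))
instance [Algebra k A] : Module k (NCSeries A) := inferInstanceAs (Module k (Word → A))

instance : Mul (NCSeries A) :=
  ⟨fun f g v => ∑ i ∈ Finset.range (v.length + 1), f (v.take i) * g (v.drop i)⟩

instance : One (NCSeries A) := ⟨fun v => if v = [] then 1 else 0⟩

/-- The series `∑_v f(a v) v`. -/
def shift (a : Letter) (f : NCSeries A) : NCSeries A := fun u => f (a :: u)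

/-- Left multiplication of all coefficients by `c`. -/
def lsmul (c : A) (f : NCSeries A) : NCSeries A := fun u => c * f u

@[ext] theorem ext {A : Type u} {f g : NCSeries A} (h : ∀ v, f v = g v) : f = g := funext h

theorem add_apply (f g : NCSeries A) (v : Word) : (f + g) v = f v + g v := rfl

theorem zero_apply (v : Word) : (0 : NCSeries A) v = 0 := rfl

theorem one_apply (v : Word) : (1 : NCSeries A) v = if v = [] then 1 else 0 := rfl

theorem mul_apply (f g : NCSeries A) (v : Word) :
    (f * g) v = ∑ i ∈ Finset.range (v.length + 1), f (v.take i) * g (v.drop i) := rfl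

theorem mul_nil (f g : NCSeries A) : (f * g) [] = f [] * g [] := by
  simp [mul_apply]

theorem mul_cons (f g : NCSeries A) (a : Letter) (v : Word) :
    (f * g) (a :: v) = f [] * g (a :: v) + (shift a f * g) v := by
  simp only [mul_apply, List.length_cons]
  rw [Finset.sum_range_succ']
  simp [add_comm, shift]

theorem mul_assoc_apply (v : Word) (f g h : NCSeries A) : (f * g * h) v = (f * (g * h)) v := by
  induction v generalizing f g h with
  | nil => simp only [mul_nil, mul_assoc]
  | cons a v ih =>
    have key : shift a (f * g) =
        lsmul (f []) (shift a g) + shift a f * g :=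
      funext fun u => mul_cons f g a u
    rw [mul_cons, mul_cons f, mul_cons g, key, mul_nil, ← ih]
    have h2 : ∀ F G H : NCSeries A, ((F + G) * H) v = (F * H) v + (G * H) v := by
      intro F G H
      simp only [mul_apply, add_apply, add_mul, Finset.sum_add_distrib]
    have h3 : (lsmul (f []) (shift a g) * h) v =
        f [] * (shift a g * h) v := by
      simp only [mul_apply, Finset.mul_sum, lsmul, mul_assoc]
    rw [h2, h3]
    ring

/-- The ring of noncommutative series, with the concatenation (Cauchy) product. -/
instance : Ring (NCSeries A) :=
  { (inferInstance : AddCommGroup (NCSeries A)) with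
    left_distrib := fun f g h => by
      ext v; simp only [mul_apply, add_apply, mul_add, Finset.sum_add_distrib]
    right_distrib := fun f g h => by
      ext v; simp only [mul_apply, add_apply, add_mul, Finset.sum_add_distrib]
    zero_mul := fun f => by ext v; simp [mul_apply, zero_apply]
    mul_zero := fun f => by ext v; simp [mul_apply, zero_apply]
    mul_assoc := fun f g h => by ext v; exact mul_assoc_apply v f g h
    one_mul := fun f => by
      ext v
      rw [mul_apply, Finset.sum_eq_single 0]
      · simp [one_apply]
      · intro i hi h0
        have : v.take i ≠ [] := by
          intro h
          rcases List.take_eq_nil_iff.mp h with h | h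
          · exact h0 h
          · subst h; simp at hi; exact h0 hi
        simp [one_apply, this]
      · simp
    mul_one := fun f => by
      ext v
      rw [mul_apply, Finset.sum_eq_single v.length]
      · simp [one_apply]
      · intro i hi h0
        have : v.drop i ≠ [] := by
          simp only [Finset.mem_range] at hi
          intro h
          have := List.drop_eq_nil_iff.mp h
          omega
        rw [one_apply, if_neg this, mul_zero]
      · simp }

/-- The topology of coefficientwise stationary convergence: `A` is discrete, and series
carry the product topology. -/
instance : TopologicalSpace (NCSeries A) :=
  @Pi.topologicalSpace Word (fun _ => A) fun _ => ⊥

/-- The exponential `∑_n Sⁿ / n!` of a series. -/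
def exp (k : Type u) [CommRing k] [Algebra ℚ k] [Algebra k A] (S : NCSeries A) : NCSeries A :=
  ∑' n : ℕ, algebraMap ℚ k ((n ! : ℚ)⁻¹) • S ^ n

end NCSeries

/-- The pure tensor `S ⊗ P = ∑_v ⟨P | v⟩ S ⊗ v`, as a double series. -/
def tens {q : k} (S : QStuffle q) (P : NCPoly k) : NCSeries (QStuffle q) :=
  fun v => ncCoeff P v • S

/-- The diagonal series `𝒟_Y = ∑_w w ⊗ w`. -/
def diagonalSeries (q : k) : NCSeries (QStuffle q) := fun w => QStuffle.word q w

/-! ### The families `Π_w`, `χ_w` and duality -/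

variable [Algebra ℚ k]

/-- `π₁(w) = ∑_{n ≥ 1} (-1)^{n-1}/n ∑_{u₁, …, u_n ∈ Y⁺} ⟨w | u₁ ⋆ ⋯ ⋆ u_n⟩ u₁ ⋯ u_n`, where `⋆` is
the `q`-stuffle. The sum is over nonempty lists `(u₁, …, u_n)` of nonempty words; it is finite
because the `q`-stuffle is homogeneous for the weight. -/
def pi1 (q : k) (w : Word) : NCPoly k :=
  ∑ᶠ L : {L : List {u : Word // u ≠ []} // L ≠ []},
    (algebraMap ℚ k ((-1) ^ (L.1.length - 1) / (L.1.length : ℚ)) *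
        QStuffle.coeff (L.1.map fun u => QStuffle.word q u.1).prod w) •
      ncWord k (L.1.map fun u => u.1).flatten

open Classical in
/-- The family `Π_l` for Lyndon words `l`: `Π_{y_s} = π₁(y_s)`, and `Π_l = [Π_s, Π_r]` if `l`
has length at least two and standard factorization `l = s r`, where `r` is the longest proper right
factor of `l` that is a Lyndon word (that is, the cut is made at the least possible position). -/
def lyndonPi (q : k) (l : Word) : NCPoly k :=
  if h : ∃ i, IsLyndonCut l i then
    ⁅lyndonPi q (l.take (Nat.find h)), lyndonPi q (l.drop (Nat.find h))⁆
  else pi1 q l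
termination_by l.length
decreasing_by
  · have := (Nat.find_spec h).2.1
    simp only [List.length_take]
    omega
  · have := (Nat.find_spec h).1
    have := (Nat.find_spec h).2.1
    simp only [List.length_drop]
    omega

/-- `Π_w = Π_{l₁}^{i₁} ⋯ Π_{l_k}^{i_k}` for `w = l₁^{i₁} ⋯ l_k^{i_k}` with Lyndon words
`l₁ > ⋯ > l_k`. -/
def wordPi (q : k) (w : Word) : NCPoly k :=
  ((lyndonFactorization w).map (lyndonPi q)).prod

/-- `χ_w = (l₁^{⋆ i₁} ⋆ ⋯ ⋆ l_k^{⋆ i_k}) / (i₁! ⋯ i_k!)` for `w = l₁^{i₁} ⋯ l_k^{i_k}` with Lyndon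
words `l₁ > ⋯ > l_k`. -/
def chi (q : k) (w : Word) : QStuffle q :=
  algebraMap ℚ k ((multFactorial w : ℚ)⁻¹) •
    ((lyndonFactorization w).map (QStuffle.word q)).prod

/-- The families `S` (in the `q`-stuffle algebra) and `P` (in `k⟨Y⟩`) are dual to each other:
`⟨S_v | P_u⟩ = δ_{u,v}`. -/
def IsDual {q : k} (S : Word → QStuffle q) (P : Word → NCPoly k) : Prop :=
  ∀ u v : Word, pairing (S v) (P u) = if u = v then 1 else 0

/-- The element `c` of `k` is the value at `q` of a polynomial with nonnegative rational
coefficients. -/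
def IsPositiveRational (q c : k) : Prop :=
  ∃ p : Polynomial ℚ, (∀ n, 0 ≤ p.coeff n) ∧ Polynomial.aeval q p = c

/-- The decreasing product `∏_{l ∈ F}^{↘} exp(S_l ⊗ Π_l)` over a finite set `F` of Lyndon
words. -/
def expProd (q : k) (S : Word → QStuffle q) (F : Finset LyndonWord) : NCSeries (QStuffle q) :=
  ((F.sort (fun a b => b ≤ a)).map fun l =>
    NCSeries.exp k (tens (S l.1) (lyndonPi q l.1))).prod

end Algebra

end QStuffleHopf

end

noncomputable section

namespace QStuffleHopf

universe u

/-! ### Lyndon words -/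

/-! The argument rests on one graded duality. The pairing of words makes the `q`-stuffle product
adjoint to the coproduct (`pair_mul`), so a polynomial is primitive exactly when, as a linear form
on the `q`-stuffle algebra, it kills products of proper elements. Weight spaces have finitely many
words, so a homogeneous unitriangular family is a basis (`exists_basis_of_triangular`) and a
homogeneous basis has a dual basis (`exists_dual_basis`).

On the letter `y_s`, `π₁` is the sum of `(-q)^(|w|-1)/|w| • w` over words `w` of weight `s`. The
coefficients depend only on length, and so does the length distribution of a stuffle; primitivity
thus reduces to a recurrence for powers of one letter (`logForm_mul_words`). Brackets then make
every `Π_l` primitive. The least word of `Π_w`, for length and then lexicographic order, is `w`,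
with coefficient `1` (`isLeading_wordPi`), so the `Π_w` form a basis and `Σ` is its dual basis.

Because the `Π_l` are primitive, the coproduct of a decreasing product distributes its factors in
all possible ways (`coprod_multisetPi`). Dually, `Σ_w` is the product of the `Σ_l` over the Lyndon
factors, divided by the factorials of the multiplicities (`isDual_wordPi_multiplicative`), which is
what the expansion of the product of exponentials requires. The same computation shows that the
`χ_w` are unitriangular with respect to the `Σ_w` (`pair_prod_words`). Hence they form a basis,
Lyndon words freely generate, and `ξ` is the dual basis of `χ`.

For positivity of `Σ`, the coefficient of `v` in `Σ_w` is the coordinate of `v` along `Π_w`.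
Inverting the logarithm writes each letter as a positive polynomial in the `π₁(y_s)`
(`ncWord_letter_eq_sum`). Products of these are sorted by `Π_h Π_m = Π_{hm} + Π_m Π_h`, which has no
negative sign (`lyndonPi_mul_prod_mem`).

Finally, a primitive element has coordinates only along Lyndon words, since the dual basis elements
at other nonempty words are products of proper elements. This gives the basis `ξ_l`, and shows that
the `Π_l`, hence the `π₁(y_s)`, generate the primitive elements. Freeness combines two injections:
the free Lie algebra embeds in the polynomials by the Dynkin operator (`freeLieToPoly_injective`),
and substituting `π₁(y_s)` for `y_s` is triangular (`substPi_injective`). -/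

theorem le_append (u v : Word) : u ≤ u ++ v := by
  induction u with
  | nil => exact not_lt.1 (List.not_lt_nil _)
  | cons a u ih =>
    rw [List.cons_append]
    refine not_lt.1 fun h => ?_
    rcases List.cons_lt_cons_iff.1 h with h | ⟨-, h⟩
    · exact lt_irrefl _ h
    · exact not_lt.2 ih h

theorem lt_append {u v : Word} (hv : v ≠ []) : u < u ++ v :=
  lt_of_le_of_ne (le_append u v) fun h => hv (by simpa using h)

theorem append_lt_append_left_iff (w : Word) {u v : Word} : w ++ u < w ++ v ↔ u < v :=
  ⟨fun h => by
    by_contra hn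
    rcases (not_lt.1 hn).eq_or_lt with rfl | h'
    · exact lt_irrefl _ h
    · exact lt_asymm h (List.append_left_lt h'), List.append_left_lt⟩

/-- A strict inequality which is not a prefix relation is stable under right extensions. -/
theorem append_lt_append_of_not_prefix {u v : Word} (h : u < v) (hp : ¬ u <+: v) (x z : Word) :
    u ++ x < v ++ z := by
  induction u generalizing v with
  | nil => exact absurd List.nil_prefix hp
  | cons a u ih =>
    cases v with
    | nil => exact absurd h (List.not_lt_nil _)
    | cons b v =>
      rw [List.cons_append, List.cons_append]
      rcases List.cons_lt_cons_iff.1 h with h | ⟨rfl, h'⟩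
      · exact List.cons_lt_cons_iff.2 (Or.inl h)
      · exact List.cons_lt_cons_iff.2
          (Or.inr ⟨rfl, ih h' fun hp' => hp (by simpa using hp')⟩)

theorem append_lt_append_of_length_le {u v : Word} (h : u < v) (hl : v.length ≤ u.length)
    (x z : Word) : u ++ x < v ++ z :=
  append_lt_append_of_not_prefix h
    (fun hp => h.ne (hp.eq_of_length (le_antisymm hp.length_le hl))) x z

theorem isLyndon_singleton (a : Letter) : IsLyndon [a] := by
  refine ⟨by simp, fun u v hu hv h => ?_⟩
  have := congrArg List.length h
  have h1 := List.length_pos_iff.2 hu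
  have h2 := List.length_pos_iff.2 hv
  simp at this
  omega

theorem IsLyndon.le_suffix {w u v : Word} (hw : IsLyndon w) (hv : v ≠ []) (h : w = u ++ v) :
    w ≤ v := by
  by_cases hu : u = []
  · subst hu; simp [h]
  · exact (hw.2 u v hu hv h).le

theorem IsLyndon.append_lt {l m : Word} (hm : IsLyndon m) (hl : l ≠ []) (h : l < m) :
    l ++ m < m := by
  by_cases hp : l <+: m
  · obtain ⟨t, rfl⟩ := hp
    have ht : t ≠ [] := by rintro rfl; simp at h
    exact List.append_left_lt (hm.2 l t hl ht rfl)
  · simpa using append_lt_append_of_not_prefix h hp m []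

/-- A right factor of `l ++ m` either lies inside `m`, where `l ++ m < m` suffices, or is `c ++ m`
with `c` a right factor of `l`. In the latter case with `c` proper, `l < c` and `c` is not longer
than `l`, so the inequality survives right extension. -/
theorem IsLyndon.append {l m : Word} (hl : IsLyndon l) (hm : IsLyndon m) (h : l < m) :
    IsLyndon (l ++ m) := by
  refine ⟨by simp [hl.1], fun u v hu hv huv => ?_⟩
  have hlm := hm.append_lt hl.1 h
  rcases List.append_eq_append_iff.1 huv with ⟨a, -, ha⟩ | ⟨c, hc, rfl⟩
  · exact hlm.trans_le (hm.le_suffix hv ha)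
  · by_cases hc0 : c = []
    · simpa [hc0] using hlm
    · refine append_lt_append_of_length_le (hl.2 u c hu hc0 hc) ?_ _ _
      rw [hc]; simp

/-- While the head is smaller than the next factor, the two merge into a longer Lyndon word. The
process stops at a nonincreasing list. -/
theorem exists_lyndonFactorization_append {h : Word} (hh : IsLyndon h) {w : Word} {L : List Word}
    (hL : IsLyndonFactorization w L) : ∃ L', IsLyndonFactorization (h ++ w) L' := by
  induction L generalizing h w with
  | nil =>
    obtain ⟨-, -, rfl⟩ := hL
    exact ⟨[h], by simpa, by simp, by simp⟩
  | cons m L ih =>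
    obtain ⟨h1, h2, rfl⟩ := hL
    rw [List.pairwise_cons] at h2
    by_cases hm : h < m
    · obtain ⟨L', hL'⟩ := ih (hh.append (h1 m (by simp)) hm)
        ⟨fun l hl => h1 l (by simp [hl]), h2.2, rfl⟩
      exact ⟨L', by simpa using hL'⟩
    · refine ⟨h :: m :: L, ?_, ?_, by simp⟩
      · simpa [hh] using h1
      · rw [List.pairwise_cons, List.pairwise_cons]
        refine ⟨fun b hb => ?_, h2⟩
        rcases List.mem_cons.1 hb with rfl | hb
        · exact not_lt.1 hm
        · exact (h2.1 b hb).trans (not_lt.1 hm)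

theorem exists_lyndonFactorization (w : Word) : ∃ L, IsLyndonFactorization w L := by
  induction w with
  | nil => exact ⟨[], by simp, by simp, by simp⟩
  | cons a w ih =>
    obtain ⟨L, hL⟩ := ih
    exact exists_lyndonFactorization_append (isLyndon_singleton a) hL

/-- The last factor of a Lyndon factorization is the least nonempty right factor. -/
theorem IsLyndonFactorization.last_le {w l : Word} {A : List Word}
    (h : IsLyndonFactorization w (A ++ [l])) {u v : Word} (hv : v ≠ []) (hw : w = u ++ v) :
    l ≤ v := by
  induction A generalizing w u v with
  | nil =>
    obtain ⟨h1, -, rfl⟩ := h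
    exact (h1 l (by simp)).le_suffix hv (by simpa using hw)
  | cons a A ih =>
    obtain ⟨h1, h2, rfl⟩ := h
    rw [List.cons_append, List.pairwise_cons] at h2
    have ha : IsLyndon a := h1 a (by simp)
    have hrest : IsLyndonFactorization (A ++ [l]).flatten (A ++ [l]) :=
      ⟨fun x hx => h1 x (List.mem_cons_of_mem _ hx), h2.2, rfl⟩
    rw [List.cons_append, List.flatten_cons] at hw
    rcases List.append_eq_append_iff.1 hw with ⟨a', -, ha'⟩ | ⟨c, hc, rfl⟩
    · exact ih hrest hv ha'
    · by_cases hc0 : c = []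
      · subst hc0
        exact ih hrest (u := []) hv (by simp)
      · exact ((h2.1 l (by simp)).trans (ha.le_suffix hc0 hc)).trans (le_append _ _)

/-- The last factor is determined by the word, as its least nonempty right factor; cancel it and
induct. -/
theorem IsLyndonFactorization.unique {w : Word} {L M : List Word}
    (hL : IsLyndonFactorization w L) (hM : IsLyndonFactorization w M) : L = M := by
  induction L using List.reverseRecOn generalizing w M with
  | nil =>
    obtain ⟨-, -, rfl⟩ := hL
    cases M with
    | nil => rfl
    | cons m M => exact absurd hM.2.2 (by simp [(hM.1 m (by simp)).1])
  | append_singleton A l ih =>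
    have hl0 : l ≠ [] := (hL.1 l (by simp)).1
    rcases List.eq_nil_or_concat M with rfl | ⟨B, m, rfl⟩
    · have := hL.2.2.trans hM.2.2.symm
      simp [hl0] at this
    · rw [List.concat_eq_append] at hM ⊢
      have hm0 : m ≠ [] := (hM.1 m (by simp)).1
      have e1 : w = A.flatten ++ l := by simp [← hL.2.2]
      have e2 : w = B.flatten ++ m := by simp [← hM.2.2]
      obtain rfl : l = m := le_antisymm (hL.last_le hm0 e2) (hM.last_le hl0 e1)
      rw [ih (w := A.flatten) (M := B)
        ⟨fun x hx => hL.1 x (by simp [hx]), (List.pairwise_append.1 hL.2.1).1, rfl⟩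
        ⟨fun x hx => hM.1 x (by simp [hx]), (List.pairwise_append.1 hM.2.1).1,
          (List.append_cancel_right (e1.symm.trans e2)).symm⟩]

theorem lyndonFactorization_spec (w : Word) : IsLyndonFactorization w (lyndonFactorization w) :=
  Classical.epsilon_spec (exists_lyndonFactorization w)

theorem IsLyndonFactorization.eq {w : Word} {L : List Word} (h : IsLyndonFactorization w L) :
    lyndonFactorization w = L :=
  (lyndonFactorization_spec w).unique h

/-- The Lyndon words of a multiset, in nonincreasing order. -/
def sorted (μ : Multiset LyndonWord) : List LyndonWord := μ.sort fun a b => b ≤ a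

theorem coe_sorted (μ : Multiset LyndonWord) : (sorted μ : Multiset LyndonWord) = μ :=
  Multiset.sort_eq _ _

theorem pairwise_sorted (μ : Multiset LyndonWord) : (sorted μ).Pairwise fun a b => b ≤ a :=
  Multiset.pairwise_sort _ _

theorem sorted_coe {L : List LyndonWord} (h : L.Pairwise fun a b => b ≤ a) : sorted ↑L = L :=
  List.Perm.eq_of_pairwise' (pairwise_sorted _) h
    (Multiset.coe_eq_coe.1 (coe_sorted _))

/-- The word with prescribed multiset of Lyndon factors. -/
def ofMultiset (μ : Multiset LyndonWord) : Word := ((sorted μ).map Subtype.val).flatten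

theorem lyndonFactorization_ofMultiset (μ : Multiset LyndonWord) :
    lyndonFactorization (ofMultiset μ) = (sorted μ).map Subtype.val := by
  refine IsLyndonFactorization.eq ⟨?_, ?_, rfl⟩
  · intro l hl
    obtain ⟨x, -, rfl⟩ := List.mem_map.1 hl
    exact x.2
  · rw [List.pairwise_map]
    exact pairwise_sorted μ

theorem ofMultiset_bijective : Function.Bijective ofMultiset := by
  constructor
  · intro μ ν h
    have := congrArg lyndonFactorization h
    rw [lyndonFactorization_ofMultiset, lyndonFactorization_ofMultiset] at this
    rw [← coe_sorted μ, ← coe_sorted ν, Subtype.val_injective.list_map this]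
  · intro w
    obtain ⟨h1, h2, h3⟩ := lyndonFactorization_spec w
    generalize lyndonFactorization w = L at h1 h2 h3
    lift L to List LyndonWord using h1
    refine ⟨L, ?_⟩
    rw [List.pairwise_map] at h2
    rw [ofMultiset, sorted_coe h2, h3]

/-- Words correspond to multisets of Lyndon words. -/
def wordEquiv : Multiset LyndonWord ≃ Word := Equiv.ofBijective ofMultiset ofMultiset_bijective

theorem wordEquiv_apply (μ : Multiset LyndonWord) : wordEquiv μ = ofMultiset μ := rfl

theorem sorted_singleton (l : LyndonWord) : sorted {l} = [l] := by
  simp [sorted]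

theorem sorted_zero : sorted 0 = [] := by
  simp [sorted]

theorem ofMultiset_singleton (l : LyndonWord) : ofMultiset {l} = l.1 := by
  simp [ofMultiset, sorted_singleton]

theorem ofMultiset_zero : ofMultiset 0 = [] := by
  simp [ofMultiset, sorted_zero]

theorem sorted_cons {l : LyndonWord} {μ : Multiset LyndonWord} (h : ∀ m ∈ μ, m ≤ l) :
    sorted (l ::ₘ μ) = l :: sorted μ := by
  rw [← coe_sorted μ] at h
  conv_lhs => rw [← coe_sorted μ, Multiset.cons_coe]
  exact sorted_coe (List.pairwise_cons.2 ⟨fun b hb => h b hb, pairwise_sorted μ⟩)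

/-! ### Standard factorization -/

theorem exists_isLyndonCut {w : Word} (h : 2 ≤ w.length) : ∃ i, IsLyndonCut w i := by
  refine ⟨w.length - 1, by omega, by omega, ?_⟩
  have : (w.drop (w.length - 1)).length = 1 := by rw [List.length_drop]; omega
  obtain ⟨a, ha⟩ := List.length_eq_one_iff.1 this
  rw [ha]
  exact isLyndon_singleton a

theorem not_exists_isLyndonCut_singleton (a : Letter) : ¬ ∃ i, IsLyndonCut [a] i := by
  rintro ⟨i, h1, h2, -⟩
  simp at h2
  omega

theorem IsLyndon.exists_cut_or {w : Word} (hw : IsLyndon w) :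
    (∃ a, w = [a]) ∨ ∃ i, IsLyndonCut w i := by
  rcases Nat.lt_or_ge w.length 2 with h | h
  · left
    have := List.length_pos_iff.2 hw.1
    exact List.length_eq_one_iff.1 (by omega)
  · exact Or.inr (exists_isLyndonCut h)

open Classical in
/-- The right factor in the standard factorization is the least proper right factor. -/
theorem drop_find_le {w : Word} (h : ∃ i, IsLyndonCut w i) {j : ℕ} (h0 : 0 < j)
    (hj : j < w.length) : w.drop (Nat.find h) ≤ w.drop j := by
  obtain ⟨m, hm, hmin⟩ := Finset.exists_min_image (Finset.Ioo 0 w.length) (fun i => w.drop i)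
    ⟨j, by simp [h0, hj]⟩
  rw [Finset.mem_Ioo] at hm
  refine le_trans ?_ (hmin j (by simp [h0, hj]))
  have hne : w.drop m ≠ [] := by simp; omega
  -- The least proper right factor is Lyndon, since its own right factors are also right factors of
  -- `w`. The first Lyndon cut is therefore not later, and its Lyndon right factor is at most its
  -- right factor at `m`.
  have hm' : IsLyndonCut w m := by
    refine ⟨hm.1, hm.2, hne, fun u v hu hv e => ?_⟩
    have hl : v.length + u.length = w.length - m := by
      have := congrArg List.length e
      simp at this; omega
    have hv' : v = w.drop (m + u.length) := by
      rw [← List.drop_drop, e, List.drop_left]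
    have h1 := List.length_pos_iff.2 hu
    have h2 := List.length_pos_iff.2 hv
    refine lt_of_le_of_ne ?_ fun e' => hu (by simpa using e'.symm.trans e)
    rw [hv']
    exact hmin _ (by simp; omega)
  rcases (Nat.find_min' h hm').eq_or_lt with e | e
  · rw [e]
  · refine (Nat.find_spec h).2.2.le_suffix hne (u := (w.drop (Nat.find h)).take (m - Nat.find h)) ?_
    have : w.drop m = (w.drop (Nat.find h)).drop (m - Nat.find h) := by
      rw [List.drop_drop]; congr 1; omega
    rw [this, List.take_append_drop]

open Classical in
-- Suppose a proper right factor `v` of `s` is smaller than `s`; since `w = s ++ r` is Lyndon, `w <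
-- v ++ r`. If `v` is not a prefix of `s`, then `v < s` extends to `v ++ r < w`, a contradiction. If
-- `s = v ++ t`, cancelling `v` gives `t ++ r < r`, against the minimality of `r`.
theorem isLyndon_take_find {w : Word} (hw : IsLyndon w) (h : ∃ i, IsLyndonCut w i) :
    IsLyndon (w.take (Nat.find h)) := by
  set i := Nat.find h with hi
  have hspec := Nat.find_spec h
  rw [← hi] at hspec
  set s := w.take i with hs
  set r := w.drop i with hr
  have hsr : w = s ++ r := (List.take_append_drop i w).symm
  have hsl : s.length = i := by rw [hs, List.length_take]; have := hspec.2.1; omega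
  have hmin : ∀ u v : Word, u ≠ [] → v ≠ [] → w = u ++ v → r ≤ v := by
    intro u v hu hv e
    have h1 := List.length_pos_iff.2 hu
    have h2 := List.length_pos_iff.2 hv
    have e' : v = w.drop u.length := by rw [e, List.drop_left]
    rw [e', hr, hi]
    exact drop_find_le h h1 (by rw [e]; simp; omega)
  refine ⟨fun e => ?_, fun u v hu hv e => ?_⟩
  · rw [e] at hsl; exact hspec.1.ne hsl
  · by_contra hn
    have hlt : v < s := by
      refine lt_of_le_of_ne (not_lt.1 hn) fun e' => hu ?_
      simpa using e'.trans e
    have hsv : w < v ++ r := hw.2 u (v ++ r) hu (by simp [hv]) (by rw [hsr, e]; simp)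
    by_cases hp : v <+: s
    · obtain ⟨t, ht⟩ := hp
      have ht0 : t ≠ [] := by rintro rfl; simp at ht; exact hlt.ne ht
      have h1 : w = v ++ (t ++ r) := by rw [hsr, ← ht]; simp
      rw [h1, append_lt_append_left_iff] at hsv
      exact absurd (hmin v (t ++ r) hv (by simp [ht0]) h1) (not_le.2 hsv)
    · have := append_lt_append_of_not_prefix hlt hp r r
      rw [← hsr] at this
      exact lt_asymm this hsv

/-- The least proper right factor of a Lyndon word (`l` itself for letters) is at least `m`. -/
def RightFactorsGE (l m : Word) : Prop := ∀ u v : Word, u ≠ [] → v ≠ [] → l = u ++ v → m ≤ v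

open Classical in
-- An earlier Lyndon cut would produce a Lyndon word `c ++ m`, with `c` a proper right factor of
-- `l`. It would be smaller than its right factor `m`, although `m ≤ c`.
theorem find_append {l m : Word} (hl : IsLyndon l) (hm : IsLyndon m) (hlm : RightFactorsGE l m)
    (h : ∃ i, IsLyndonCut (l ++ m) i) : Nat.find h = l.length := by
  have hl0 := List.length_pos_iff.2 hl.1
  have hm0 := List.length_pos_iff.2 hm.1
  rw [Nat.find_eq_iff]
  refine ⟨⟨hl0, by simp; omega, by simpa using hm⟩, fun n hn hcut => ?_⟩
  have hdrop : (l ++ m).drop n = l.drop n ++ m := by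
    rw [List.drop_append_of_le_length hn.le]
  have hv : l.drop n ≠ [] := by simp; omega
  have hu : l.take n ≠ [] := by
    have := hcut.1
    simp [hl.1]; omega
  have h1 := hlm _ _ hu hv (List.take_append_drop n l).symm
  have h2 := hcut.2.2
  rw [hdrop] at h2
  exact absurd (h2.2 _ _ hv hm.1 rfl) (not_lt.2 (h1.trans (le_append _ _)))

/-- This is the invariant of the sorting procedure: after `l` absorbs `m`, the new head again forms
a standard factorization with any later smaller or equal factor whenever they must be merged. -/
theorem rightFactorsGE_append {l m m' : Word} (hm : IsLyndon m)
    (hlm : RightFactorsGE l m) (h : m' ≤ m) : RightFactorsGE (l ++ m) m' := by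
  intro u v hu hv e
  refine h.trans ?_
  rcases List.append_eq_append_iff.1 e with ⟨a, -, ha⟩ | ⟨c, hc, rfl⟩
  · exact hm.le_suffix hv ha
  · by_cases hc0 : c = []
    · simp [hc0]
    · exact (hlm u c hu hc0 hc).trans (le_append _ _)

theorem rightFactorsGE_singleton (a : Letter) (m : Word) : RightFactorsGE [a] m := by
  intro u v hu hv e
  have := congrArg List.length e
  have h1 := List.length_pos_iff.2 hu
  have h2 := List.length_pos_iff.2 hv
  simp at this
  omega

/-! ### Homogeneous bases, triangular families and dual bases -/

section LinearAlgebra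

variable {k ι M N : Type*} [CommRing k] [AddCommGroup M] [Module k M] [AddCommGroup N] [Module k N]

/-- A family which is homogeneous and unitriangular with respect to a basis whose homogeneous
components are finite is a basis. -/
theorem exists_basis_of_triangular {α : Type*} [LinearOrder α] (wt : ι → ℕ)
    (hfin : ∀ n, {i | wt i = n}.Finite) (ρ : ι → α) (b : Module.Basis ι k M) (T : ι → M)
    (h1 : ∀ i, b.repr (T i) i = 1)
    (h2 : ∀ i j, b.repr (T i) j ≠ 0 → j = i ∨ (wt j = wt i ∧ ρ i < ρ j)) :
    ∃ B : Module.Basis ι k M, (∀ i, B i = T i) ∧ ∀ i j, B.repr (b i) j ≠ 0 → wt j = wt i := by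
  classical
  -- Back substitution: induct on the number of indices of the same weight and larger rank, which is
  -- finite by `hfin`.
  have hspan : ∀ i, b i ∈ Submodule.span k (T '' {j | wt j = wt i}) := by
    intro i
    induction hn : {j | wt j = wt i ∧ ρ i < ρ j}.ncard using Nat.strong_induction_on
      generalizing i with
    | _ n ih =>
      have e : b i = T i - ((b.repr (T i)).erase i).sum fun j c => c • b j := by
        have h := b.linearCombination_repr (T i)
        rw [Finsupp.linearCombination_apply,
          ← Finsupp.single_add_erase i (b.repr (T i)),
          Finsupp.sum_add_index' (by simp) (by intros; rw [add_smul]),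
          Finsupp.sum_single_index (by simp), h1, one_smul] at h
        exact eq_sub_of_add_eq h
      rw [e]
      refine sub_mem (Submodule.subset_span ⟨i, rfl, rfl⟩) (sum_mem fun j hj => ?_)
      rw [Finsupp.support_erase, Finset.mem_erase, Finsupp.mem_support_iff] at hj
      obtain ⟨hwt, hρ⟩ := (h2 i j hj.2).resolve_left hj.1
      refine Submodule.smul_mem _ _ ?_
      have := ih _ ?_ j rfl
      · rwa [hwt] at this
      · rw [← hn]
        refine Set.ncard_lt_ncard ⟨fun x hx => ⟨hx.1.trans hwt, hρ.trans hx.2⟩, fun hs => ?_⟩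
          ((hfin (wt i)).subset fun x hx => hx.1)
        exact lt_irrefl _ (hs (show j ∈ {j | wt j = wt i ∧ ρ i < ρ j} from ⟨hwt, hρ⟩)).2
  -- At an index `i` of least rank in the support of a relation, no other term contributes to
  -- coordinate `i`, so that coordinate is the coefficient of `T i`. No cancellation in `k` is
  -- needed.
  have hli : LinearIndependent k T := by
    rw [linearIndependent_iff]
    intro c hc
    by_contra hne
    obtain ⟨i, hi, hmin⟩ := Finset.exists_min_image c.support ρ
      (Finsupp.support_nonempty_iff.2 hne)
    have h := congrArg (fun x => b.repr x i) hc
    simp only [Finsupp.linearCombination_apply, Finsupp.sum, map_sum, map_smul, map_zero,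
      Finsupp.coe_finsetSum, Finset.sum_apply, Finsupp.coe_smul, Pi.smul_apply, smul_eq_mul,
      Finsupp.coe_zero, Pi.zero_apply] at h
    rw [Finset.sum_eq_single i] at h
    · rw [h1, mul_one] at h
      exact (Finsupp.mem_support_iff.1 hi) h
    · intro j hj hji
      by_contra h0
      rcases h2 j i (right_ne_zero_of_mul h0) with e | ⟨-, e⟩
      · exact hji e.symm
      · exact absurd (hmin j hj) (not_le.2 e)
    · intro h; exact absurd hi h
  have htop : ⊤ ≤ Submodule.span k (Set.range T) := by
    rw [← b.span_eq, Submodule.span_le]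
    rintro _ ⟨i, rfl⟩
    exact Submodule.span_mono (Set.image_subset_range _ _) (hspan i)
  let B := Module.Basis.mk hli htop
  have hB : ∀ i, B i = T i := fun i => Module.Basis.mk_apply hli htop i
  refine ⟨B, hB, fun i j hij => ?_⟩
  have h := hspan i
  rw [show T = B from (funext hB).symm, B.mem_span_image] at h
  exact h (Finsupp.mem_support_iff.2 hij)

/-- The dual basis of a homogeneous basis, for a graded duality with finite homogeneous
components. -/
theorem exists_dual_basis [DecidableEq ι] (wt : ι → ℕ) (hfin : ∀ n, {i | wt i = n}.Finite)
    (e : Module.Basis ι k M) (f : Module.Basis ι k N) (p : M →ₗ[k] N →ₗ[k] k)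
    (hp : ∀ i j, p (e i) (f j) = if i = j then 1 else 0) (B : Module.Basis ι k N)
    (h1 : ∀ i j, f.repr (B i) j ≠ 0 → wt j = wt i)
    (h2 : ∀ i j, B.repr (f i) j ≠ 0 → wt j = wt i) :
    ∃ D : Module.Basis ι k M, (∀ i x, p (D i) x = B.repr x i) ∧
      (∀ i j, e.repr (D i) j ≠ 0 → wt j = wt i) ∧
      (∀ i j, D.repr (e i) j ≠ 0 → wt j = wt i) := by
  classical
  have hpf : ∀ m j, p m (f j) = e.repr m j := by
    intro m j
    have : p.flip (f j) = e.coord j := e.ext fun i => by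
      rw [LinearMap.flip_apply, hp, Module.Basis.coord_apply, Module.Basis.repr_self,
        Finsupp.single_apply]
    exact congrArg (fun g => g m) this
  have hpe : ∀ i n, p (e i) n = f.repr n i := by
    intro i n
    have : p (e i) = f.coord i := f.ext fun j => by
      rw [hp, Module.Basis.coord_apply, Module.Basis.repr_self, Finsupp.single_apply]
      simp [eq_comm]
    exact congrArg (fun g => g n) this
  have hnd : ∀ m m', (∀ i, p m (B i) = p m' (B i)) → m = m' := by
    intro m m' h
    have : p m = p m' := B.ext h
    apply e.repr.injective
    ext j
    rw [← hpf, ← hpf, this]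
  -- The transposed matrix of the coordinates in `B`. Homogeneity makes its rows finite, so that the
  -- `i`-th coordinate form is represented by an element of `M`.
  let T : ι → M := fun i => ∑ j ∈ (hfin (wt i)).toFinset, B.repr (f j) i • e j
  have hT : ∀ i x, p (T i) x = B.repr x i := by
    intro i x
    have : p (T i) = B.coord i := f.ext fun j => by
      rw [hpf, Module.Basis.coord_apply]
      simp only [T, map_sum, map_smul, Module.Basis.repr_self, Finsupp.coe_finsetSum,
        Finset.sum_apply, Finsupp.coe_smul, Pi.smul_apply, smul_eq_mul, Finsupp.single_apply,
        mul_ite, mul_one, mul_zero, Finset.sum_ite_eq', Set.Finite.mem_toFinset,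
        Set.mem_ofPred_eq]
      split_ifs with h
      · rfl
      · by_contra h0
        exact h (h2 j i (Ne.symm h0)).symm
    exact congrArg (fun g => g x) this
  have hli : LinearIndependent k T := by
    rw [linearIndependent_iff]
    intro c hc
    ext u
    have h := congrArg (fun x => p x (B u)) hc
    simpa [Finsupp.linearCombination_apply, Finsupp.sum, hT, Finsupp.single_apply] using h
  have htop : ⊤ ≤ Submodule.span k (Set.range T) := by
    rw [← e.span_eq, Submodule.span_le]
    rintro _ ⟨j, rfl⟩
    -- The inverse transposed matrix, again finite by homogeneity; the equality is tested against
    -- `B`.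
    have : e j = ∑ i ∈ (hfin (wt j)).toFinset, f.repr (B i) j • T i := by
      refine hnd _ _ fun u => ?_
      simp only [hpe, map_sum, map_smul, LinearMap.sum_apply, LinearMap.smul_apply, hT,
        Module.Basis.repr_self, Finsupp.single_apply, smul_eq_mul, mul_ite, mul_one, mul_zero,
        Finset.sum_ite_eq, Set.Finite.mem_toFinset, Set.mem_ofPred_eq]
      split_ifs with h
      · rfl
      · by_contra h0
        exact h (h1 u j h0).symm
    rw [SetLike.mem_coe, this]
    exact sum_mem fun i _ => Submodule.smul_mem _ _ (Submodule.subset_span ⟨i, rfl⟩)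
  let D := Module.Basis.mk hli htop
  have hD : ∀ i, D i = T i := fun i => Module.Basis.mk_apply hli htop i
  have hDr : ∀ m i, D.repr m i = p m (B i) := by
    intro m i
    have : D.coord i = p.flip (B i) := D.ext fun j => by
      rw [LinearMap.flip_apply, Module.Basis.coord_apply, Module.Basis.repr_self, hD, hT,
        Module.Basis.repr_self, Finsupp.single_apply, Finsupp.single_apply]
      simp [eq_comm]
    exact congrArg (fun g => g m) this
  refine ⟨D, fun i x => by rw [hD, hT], fun i j h => ?_, fun i j h => ?_⟩
  · rw [hD, ← hpf, hT] at h
    exact (h2 j i h).symm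
  · rw [hDr, hpe] at h
    exact (h1 j i h).symm

end LinearAlgebra

/-! ### Weights -/

theorem weight_nil : weight [] = 0 := rfl

theorem weight_cons (a : Letter) (w : Word) :
    weight (a :: w) = ((OrderDual.ofDual a : ℕ+) : ℕ) + weight w := by
  simp [weight]

theorem weight_append (u v : Word) : weight (u ++ v) = weight u + weight v := by
  simp [weight]

theorem weight_singleton_add (a b : Letter) : weight [a + b] = weight [a] + weight [b] := by
  simp [weight, ofDual_add]

theorem weight_singleton_pos (a : Letter) : 0 < weight [a] := by
  simp [weight]

theorem length_le_weight (w : Word) : w.length ≤ weight w := by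
  induction w with
  | nil => simp
  | cons a w ih =>
    rw [weight_cons, List.length_cons]
    have := (OrderDual.ofDual a : ℕ+).pos
    omega

theorem weight_pos {w : Word} (h : w ≠ []) : 0 < weight w :=
  (List.length_pos_iff.2 h).trans_le (length_le_weight w)

theorem weight_eq_zero {w : Word} : weight w = 0 ↔ w = [] :=
  ⟨fun h => by by_contra h'; exact (weight_pos h').ne' h, fun h => h ▸ rfl⟩

theorem finite_weight_eq (n : ℕ) : {w : Word | weight w = n}.Finite := by
  induction n using Nat.strong_induction_on with
  | _ n ih =>
    have : {w : Word | weight w = n} ⊆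
        {[]} ∪ ⋃ m ∈ Finset.range n, ⋃ s ∈ Set.Iic n, {w | ∃ v, weight v = m ∧
          ∃ a : Letter, ((OrderDual.ofDual a : ℕ+) : ℕ) = s ∧ w = a :: v} := by
      rintro (_ | ⟨a, w⟩) hw
      · simp
      · right
        rw [Set.mem_ofPred_eq, weight_cons] at hw
        have := (OrderDual.ofDual a : ℕ+).pos
        simp only [Set.mem_iUnion]
        exact ⟨weight w, Finset.mem_range.2 (by omega), _, Set.mem_Iic.2 (by omega), w, rfl, a,
          rfl, rfl⟩
    refine Set.Finite.subset ((Set.finite_singleton _).union ?_) this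
    refine Set.Finite.biUnion (Finset.finite_toSet _) fun m hm => ?_
    refine Set.Finite.biUnion (Set.finite_Iic n) fun s _ => ?_
    by_cases hs : ∃ a : Letter, ((OrderDual.ofDual a : ℕ+) : ℕ) = s
    · obtain ⟨a, ha⟩ := hs
      refine ((ih m (Finset.mem_range.1 hm)).image (a :: ·)).subset ?_
      rintro w ⟨v, hv, b, hb, rfl⟩
      refine ⟨v, hv, ?_⟩
      have : a = b := PNat.coe_injective (ha.trans hb.symm)
      rw [this]
    · refine Set.finite_empty.subset ?_
      rintro w ⟨v, hv, b, hb, rfl⟩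
      exact hs ⟨b, hb⟩

/-- The words of weight `n`. -/
def wordsOfWeight (n : ℕ) : Finset Word := (finite_weight_eq n).toFinset

theorem mem_wordsOfWeight {n : ℕ} {w : Word} : w ∈ wordsOfWeight n ↔ weight w = n := by
  simp [wordsOfWeight]

/-! ### Coefficients and the pairing -/

section Pairing

variable {k : Type u} [CommRing k]

/-- The coefficients of a noncommutative polynomial, as a linear equivalence. -/
def ncEquiv (k : Type u) [CommRing k] : NCPoly k ≃ₗ[k] (Word →₀ k) where
  toFun P := P.coeff
  invFun f := MonoidAlgebra.ofCoeff f
  map_add' _ _ := rfl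
  map_smul' _ _ := rfl
  left_inv _ := rfl
  right_inv _ := rfl

/-- The basis of words of `k⟨Y⟩`. -/
def ncBasis (k : Type u) [CommRing k] : Module.Basis Word k (NCPoly k) :=
  Module.Basis.ofRepr (ncEquiv k)

theorem ncBasis_repr (P : NCPoly k) (w : Word) : (ncBasis k).repr P w = ncCoeff P w := rfl

theorem ncBasis_apply (w : Word) : ncBasis k w = ncWord k w := rfl

/-- The basis of words of the `q`-stuffle algebra. -/
def qBasis (q : k) : Module.Basis Word k (QStuffle q) :=
  Module.Basis.ofRepr
    { (QStuffle.coeff : QStuffle q →ₗ[k] (Word →₀ k)) with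
      invFun := fun f => f
      left_inv := fun _ => rfl
      right_inv := fun _ => rfl }

theorem qBasis_repr {q : k} (S : QStuffle q) (w : Word) :
    (qBasis q).repr S w = QStuffle.coeff S w := rfl

theorem qBasis_apply (q : k) (w : Word) : qBasis q w = QStuffle.word q w := rfl

theorem ncCoeff_ncWord (v w : Word) : ncCoeff (ncWord k v) w = if v = w then 1 else 0 := by
  rw [← ncBasis_repr, ← ncBasis_apply, Module.Basis.repr_self, Finsupp.single_apply]

theorem coeff_word_apply (q : k) (v w : Word) :
    QStuffle.coeff (QStuffle.word q v) w = if v = w then 1 else 0 := by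
  rw [← qBasis_repr, ← qBasis_apply, Module.Basis.repr_self, Finsupp.single_apply]

theorem ncCoeff_ext {P R : NCPoly k} (h : ∀ w, ncCoeff P w = ncCoeff R w) : P = R :=
  (ncBasis k).repr.injective (Finsupp.ext h)

theorem coeff_ext {q : k} {S T : QStuffle q}
    (h : ∀ w, QStuffle.coeff S w = QStuffle.coeff T w) : S = T :=
  (qBasis q).repr.injective (Finsupp.ext h)

theorem ncCoeff_add (P R : NCPoly k) (w : Word) :
    ncCoeff (P + R) w = ncCoeff P w + ncCoeff R w := rfl

theorem ncCoeff_sub (P R : NCPoly k) (w : Word) :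
    ncCoeff (P - R) w = ncCoeff P w - ncCoeff R w := rfl

theorem ncCoeff_smul (c : k) (P : NCPoly k) (w : Word) :
    ncCoeff (c • P) w = c * ncCoeff P w := rfl

/-- A coefficient, as a linear form. -/
def ncCoeffₗ (w : Word) : NCPoly k →ₗ[k] k := (ncBasis k).coord w

theorem ncCoeffₗ_apply (w : Word) (P : NCPoly k) : ncCoeffₗ w P = ncCoeff P w := rfl

theorem ncCoeff_sum {ι : Type*} (s : Finset ι) (P : ι → NCPoly k) (w : Word) :
    ncCoeff (∑ i ∈ s, P i) w = ∑ i ∈ s, ncCoeff (P i) w := map_sum (ncCoeffₗ w) P s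

theorem ncWord_append (u v : Word) : ncWord k (u ++ v) = ncWord k u * ncWord k v := by
  rw [ncWord, ncWord, ncWord, MonoidAlgebra.single_mul_single, one_mul]
  rfl

theorem ncWord_nil : ncWord k [] = 1 := rfl

theorem ncWord_cons (a : Letter) (w : Word) :
    ncWord k (a :: w) = ncWord k [a] * ncWord k w := ncWord_append [a] w

/-- The duality between the `q`-stuffle algebra and `k⟨Y⟩`. -/
def pair (q : k) : QStuffle q →ₗ[k] NCPoly k →ₗ[k] k :=
  LinearMap.mk₂ k pairing
    (fun S T P => Finsupp.sum_add_index' (by simp) (by intros; rw [add_mul]))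
    (fun c S P => by
      rw [pairing, pairing, map_smul, Finsupp.sum_smul_index (by simp), smul_eq_mul,
        Finsupp.mul_sum]
      simp only [mul_assoc])
    (fun S P R => by simp only [pairing, ncCoeff_add, mul_add, Finsupp.sum_add])
    (fun c S P => by
      simp only [pairing, ncCoeff_smul, smul_eq_mul, Finsupp.mul_sum]
      exact Finsupp.sum_congr fun _ _ => by ring)

theorem pair_apply {q : k} (S : QStuffle q) (P : NCPoly k) : pair q S P = pairing S P := rfl

theorem pair_word (q : k) (w : Word) (P : NCPoly k) :
    pair q (QStuffle.word q w) P = ncCoeff P w := by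
  rw [pair_apply, pairing, QStuffle.coeff_word, Finsupp.sum_single_index (by simp), one_mul]

theorem pair_ncWord {q : k} (S : QStuffle q) (w : Word) :
    pair q S (ncWord k w) = QStuffle.coeff S w := by
  simp [pair_apply, pairing, ncCoeff_ncWord]

theorem pair_basis (q : k) (v w : Word) :
    pair q (qBasis q v) (ncBasis k w) = if v = w then 1 else 0 := by
  rw [ncBasis_apply, pair_ncWord, qBasis_apply, coeff_word_apply]

theorem isDual_iff {q : k} {S : Word → QStuffle q} {P : Word → NCPoly k} :
    IsDual S P ↔ ∀ u v, pair q (S v) (P u) = if u = v then 1 else 0 := Iff.rfl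

theorem pair_ext_left {q : k} {S T : QStuffle q} (h : pair q S = pair q T) : S = T :=
  coeff_ext fun w => by rw [← pair_ncWord, ← pair_ncWord, h]

theorem pair_ext_right {q : k} {P R : NCPoly k} (h : ∀ S, pair q S P = pair q S R) : P = R :=
  ncCoeff_ext fun w => by rw [← pair_word q, ← pair_word q, h]

end Pairing

/-! ### Duality between the `q`-stuffle product and the coproduct -/

section Duality

variable {k : Type u} [CommRing k]

open QStuffle

/-- The residual of an element of the `q`-stuffle algebra by a letter. -/
def strip {q : k} (a : Letter) : QStuffle q →ₗ[k] QStuffle q where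
  toFun S := Finsupp.comapDomain (a :: ·) (coeff S) (List.cons_injective.injOn)
  map_add' _ _ := coeff_ext fun _ => rfl
  map_smul' _ _ := coeff_ext fun _ => rfl

theorem coeff_strip {q : k} (a : Letter) (S : QStuffle q) (w : Word) :
    coeff (strip a S) w = coeff S (a :: w) := rfl

theorem strip_one (q : k) (a : Letter) : strip a (word q []) = 0 := by
  refine coeff_ext fun w => ?_
  rw [coeff_strip, coeff_word_apply, if_neg (by simp)]
  rfl

theorem strip_word_cons (q : k) (a b : Letter) (w : Word) :
    strip a (word q (b :: w)) = if b = a then word q w else 0 := by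
  refine coeff_ext fun v => ?_
  rw [coeff_strip, coeff_word_apply]
  by_cases h : b = a
  · simp [h, coeff_word_apply]
  · simp [h]

theorem strip_prep (q : k) (a b : Letter) (S : QStuffle q) :
    strip a (prep q b S) = if b = a then S else 0 := by
  have : (strip a).comp (prep q b) = if b = a then LinearMap.id else 0 := by
    refine lin_ext q fun w => ?_
    rw [LinearMap.comp_apply, prep_word, strip_word_cons]
    split_ifs <;> rfl
  have := congrArg (fun g => g S) this
  simp only [LinearMap.comp_apply] at this
  rw [this]
  split_ifs <;> rfl

/-- The pairs of letters with sum `a`. -/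
def letterPairs (a : Letter) : Finset (ℕ+ × ℕ+) :=
  (Finset.Icc 1 (OrderDual.ofDual a) ×ˢ Finset.Icc 1 (OrderDual.ofDual a)).filter
    (fun p : ℕ+ × ℕ+ => p.1 + p.2 = OrderDual.ofDual a)

theorem mem_letterPairs {a : Letter} {p : ℕ+ × ℕ+} :
    p ∈ letterPairs a ↔ y p.1 + y p.2 = a := by
  have : y p.1 + y p.2 = a ↔ p.1 + p.2 = OrderDual.ofDual a := Iff.rfl
  rw [this, letterPairs, Finset.mem_filter, Finset.mem_product, Finset.mem_Icc, Finset.mem_Icc]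
  refine ⟨fun h => h.2, fun h => ⟨⟨⟨one_le, ?_⟩, one_le, ?_⟩, h⟩⟩
  · rw [← h]; exact (PNat.lt_add_right _ _).le
  · rw [← h]; exact (PNat.lt_add_left _ _).le

/-- A word of a stuffle begins with the first letter of the left word, with that of the right word,
or with their sum. Removing this letter is thus a derivation up to a term in `q`, the exact
counterpart of the coproduct of a letter. -/
theorem strip_mul {q : k} (a : Letter) (S T : QStuffle q) :
    strip a (S * T) = strip a S * T + S * strip a T
      + q • ∑ p ∈ letterPairs a, strip (y p.1) S * strip (y p.2) T := by
  have key : (mulLin q).compr₂ (strip a) = (mulLin q).comp (strip a) + (mulLin q).compl₂ (strip a)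
      + q • ∑ p ∈ letterPairs a, (mulLin q).compl₁₂ (strip (y p.1)) (strip (y p.2)) := by
    refine lin_ext q fun u => lin_ext q fun v => ?_
    simp only [LinearMap.compr₂_apply, LinearMap.add_apply, LinearMap.comp_apply,
      LinearMap.compl₂_apply, LinearMap.smul_apply, LinearMap.sum_apply, LinearMap.compl₁₂_apply]
    cases u with
    | nil => simp [mulLin_one_left, strip_one]
    | cons b u =>
      cases v with
      | nil => simp [strip_one, mulLin_comm q _ (word q []), mulLin_one_left]
      | cons c v =>
        -- Words have a single first letter, so only the pair formed by `b` and `c` can contribute.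
        have hsum : ∑ p ∈ letterPairs a,
            mulLin q (strip (y p.1) (word q (b :: u))) (strip (y p.2) (word q (c :: v))) =
            if b + c = a then mulLin q (word q u) (word q v) else 0 := by
          rw [Finset.sum_congr rfl fun p _ => by rw [strip_word_cons, strip_word_cons]]
          have : ∀ p : ℕ+ × ℕ+, mulLin q (if b = y p.1 then word q u else 0)
              (if c = y p.2 then word q v else 0) =
              if p = (OrderDual.ofDual b, OrderDual.ofDual c) then
                mulLin q (word q u) (word q v) else 0 := by
            intro p
            have e : p = (OrderDual.ofDual b, OrderDual.ofDual c) ↔ b = y p.1 ∧ c = y p.2 := by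
              rw [Prod.ext_iff]
              exact and_congr ⟨fun h => by rw [h]; rfl, fun h => by rw [h]; rfl⟩
                ⟨fun h => by rw [h]; rfl, fun h => by rw [h]; rfl⟩
            simp only [e]
            by_cases h1 : b = y p.1 <;> by_cases h2 : c = y p.2 <;> simp [h1, h2]
          simp only [this, Finset.sum_ite_eq', mem_letterPairs]
          rfl
        rw [hsum, strip_word_cons, strip_word_cons, ← prep_word q b u, ← prep_word q c v,
          mulLin_prep]
        simp only [map_add, map_smul, strip_prep]
        congr 1
        · congr 1
          · split_ifs <;> simp
          · split_ifs <;> simp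
  have := congrArg (fun f => f S T) key
  simpa only [mul_def, LinearMap.compr₂_apply, LinearMap.add_apply, LinearMap.comp_apply,
      LinearMap.compl₂_apply, LinearMap.smul_apply, LinearMap.sum_apply,
      LinearMap.compl₁₂_apply] using this

theorem coeff_mul_nil {q : k} (S T : QStuffle q) :
    coeff (S * T) [] = coeff S [] * coeff T [] := by
  have key : (mulLin q).compr₂ ((qBasis q).coord []) =
      (LinearMap.mul k k).compl₁₂ ((qBasis q).coord []) ((qBasis q).coord []) := by
    refine lin_ext q fun u => lin_ext q fun v => ?_
    simp only [LinearMap.compr₂_apply, LinearMap.compl₁₂_apply, Module.Basis.coord_apply,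
      qBasis_repr, LinearMap.mul_apply', mulLin_word, coeff_word_apply]
    cases u with
    | nil => simp [nil_stuffleWord, coeff_word_apply]
    | cons a u =>
      cases v with
      | nil => simp [stuffleWord_nil, coeff_word_apply]
      | cons b v =>
        have : ∀ (c : Letter) (Z : QStuffle q), coeff (prep q c Z) [] = 0 := by
          intro c Z
          have : ((qBasis q).coord []).comp (prep q c) = 0 := by
            refine lin_ext q fun w => ?_
            rw [LinearMap.comp_apply, prep_word, Module.Basis.coord_apply, qBasis_repr,
              coeff_word_apply]
            simp
          exact congrArg (fun g => g Z) this
        rw [stuffleWord]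
        simp [this]
  exact congrArg (fun f => f S T) key

/-- The pairing of the tensor squares. -/
def pair₂ {q : k} (S T : QStuffle q) : NCPoly k ⊗[k] NCPoly k →ₗ[k] k :=
  LinearMap.mul' k k ∘ₗ TensorProduct.map (pair q S) (pair q T)

theorem pair₂_tmul {q : k} (S T : QStuffle q) (P R : NCPoly k) :
    pair₂ S T (P ⊗ₜ[k] R) = pair q S P * pair q T R := by
  simp [pair₂]

theorem pair_ncWord_mul {q : k} (S : QStuffle q) (a : Letter) (P : NCPoly k) :
    pair q S (ncWord k [a] * P) = pair q (strip a S) P := by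
  have : (pair q S).comp (LinearMap.mulLeft k (ncWord k [a])) = pair q (strip a S) :=
    (ncBasis k).ext fun w => by
      rw [LinearMap.comp_apply, LinearMap.mulLeft_apply, ncBasis_apply, ← ncWord_cons,
        pair_ncWord, pair_ncWord, coeff_strip]
  exact congrArg (fun g => g P) this

theorem pair₂_coprodLetter_mul {q : k} (S T : QStuffle q) (a : Letter)
    (X : NCPoly k ⊗[k] NCPoly k) :
    pair₂ S T (coprodLetter q a * X) = pair₂ (strip a S) T X + pair₂ S (strip a T) X
      + q * ∑ p ∈ letterPairs a, pair₂ (strip (y p.1) S) (strip (y p.2) T) X := by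
  induction X using TensorProduct.induction_on with
  | zero => simp
  | add X Z hX hZ =>
    rw [mul_add, map_add, hX, hZ]
    simp only [map_add, Finset.sum_add_distrib]
    ring
  | tmul P R =>
    rw [coprodLetter, ← letterPairs, add_mul, add_mul, smul_mul_assoc, Finset.sum_mul, map_add,
      map_add, map_smul, map_sum, smul_eq_mul]
    simp only [Algebra.TensorProduct.tmul_mul_tmul, one_mul, pair₂_tmul, pair_ncWord_mul]

theorem coprod_ncWord_cons (q : k) (a : Letter) (w : Word) :
    coprod q (ncWord k (a :: w)) = coprodLetter q a * coprod q (ncWord k w) := by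
  rw [ncWord_cons, map_mul]
  congr 1
  rw [coprod, ncWord, MonoidAlgebra.lift_single, one_smul]
  exact FreeMonoid.lift_eval_of _ _

theorem coeff_one_nil (q : k) : coeff (1 : QStuffle q) [] = 1 := by
  rw [one_def, coeff_word_apply, if_pos rfl]

theorem pair_one_right {q : k} (S : QStuffle q) : pair q S 1 = coeff S [] := by
  rw [← ncWord_nil, pair_ncWord]

/-- The `q`-stuffle product is dual to the coproduct. -/
theorem pair_mul {q : k} (S T : QStuffle q) (P : NCPoly k) :
    pair q (S * T) P = pair₂ S T (coprod q P) := by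
  -- By induction on `w`, generalizing `S` and `T`: multiplying by the coproduct of a letter on one
  -- side, and removing that letter on the other, satisfy the same recursion.
  have key : ∀ (w : Word) (S T : QStuffle q),
      coeff (S * T) w = pair₂ S T (coprod q (ncWord k w)) := by
    intro w
    induction w with
    | nil =>
      intro S T
      rw [coeff_mul_nil, ncWord_nil, map_one, Algebra.TensorProduct.one_def, pair₂_tmul,
        pair_one_right, pair_one_right]
    | cons a w ih =>
      intro S T
      rw [← coeff_strip, strip_mul, coprod_ncWord_cons, pair₂_coprodLetter_mul, map_add, map_add,
        map_smul, map_sum]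
      simp only [Finsupp.add_apply, Finsupp.smul_apply, Finsupp.finsetSum_apply, smul_eq_mul, ih]
  have : pair q (S * T) = (pair₂ S T).comp (coprod q).toLinearMap :=
    (ncBasis k).ext fun w => by
      rw [ncBasis_apply, pair_ncWord, LinearMap.comp_apply, AlgHom.toLinearMap_apply, key]
  exact congrArg (fun g => g P) this

theorem pair₂_ext (q : k) {X Z : NCPoly k ⊗[k] NCPoly k}
    (h : ∀ u v, pair₂ (word q u) (word q v) X = pair₂ (word q u) (word q v) Z) : X = Z := by
  let B := (ncBasis k).tensorProduct (ncBasis k)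
  have key : ∀ u v X, B.repr X (u, v) = pair₂ (word q u) (word q v) X := by
    intro u v X
    induction X using TensorProduct.induction_on with
    | zero => simp
    | add X Z hX hZ => rw [map_add, map_add, Finsupp.add_apply, hX, hZ]
    | tmul P R =>
      rw [Module.Basis.tensorProduct_repr_tmul_apply, pair₂_tmul, pair_word, pair_word,
        ncBasis_repr, ncBasis_repr, smul_eq_mul, mul_comm]
  refine B.repr.injective (Finsupp.ext fun p => ?_)
  rw [← Prod.mk.eta (p := p), key, key, h]

theorem mem_primitive {q : k} {P : NCPoly k} :
    P ∈ primitive q ↔ coprod q P = P ⊗ₜ[k] 1 + 1 ⊗ₜ[k] P := Iff.rfl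

/-- The dual form of primitivity: as a linear form on the `q`-stuffle algebra, `P` is a derivation
with respect to the constant term. All later uses of primitive elements go through this form or
through the coproduct itself. -/
theorem mem_primitive_iff {q : k} {P : NCPoly k} :
    P ∈ primitive q ↔ ∀ S T : QStuffle q,
      pair q (S * T) P = pair q S P * coeff T [] + coeff S [] * pair q T P := by
  rw [mem_primitive]
  constructor
  · intro h S T
    rw [pair_mul, h, map_add, pair₂_tmul, pair₂_tmul, pair_one_right, pair_one_right]
  · intro h
    refine pair₂_ext q fun u v => ?_
    rw [← pair_mul, h, map_add, pair₂_tmul, pair₂_tmul, pair_one_right, pair_one_right]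

theorem pair_one_of_mem_primitive {q : k} {P : NCPoly k} (h : P ∈ primitive q) :
    pair q 1 P = 0 := by
  have := mem_primitive_iff.1 h 1 1
  rw [one_mul, coeff_one_nil, mul_one, one_mul] at this
  simpa using this

/-- It suffices to test primitivity on words. -/
theorem mem_primitive_of_words {q : k} {P : NCPoly k} (h0 : ncCoeff P [] = 0)
    (h : ∀ u v : Word, u ≠ [] → v ≠ [] → pair q (word q u * word q v) P = 0) :
    P ∈ primitive q := by
  have h0' : pair q (word q []) P = 0 := by rw [pair_word, h0]
  refine pair₂_ext q fun u v => ?_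
  rw [← pair_mul, map_add, pair₂_tmul, pair₂_tmul, pair_one_right, pair_one_right,
    coeff_word_apply, coeff_word_apply]
  by_cases hu : u = []
  · subst hu
    rw [← one_def, one_mul, one_def, h0']
    simp
  · by_cases hv : v = []
    · subst hv
      rw [← one_def, mul_one, one_def, h0']
      simp
    · rw [h u v hu hv]
      simp [hu, hv]

/-! ### Homogeneity -/

/-- The homogeneous component of weight `n` of the `q`-stuffle algebra. -/
def homog (q : k) (n : ℕ) : Submodule k (QStuffle q) :=
  Submodule.span k (word q '' {w | weight w = n})

theorem mem_homog {q : k} {n : ℕ} {S : QStuffle q} :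
    S ∈ homog q n ↔ ∀ w, coeff S w ≠ 0 → weight w = n := by
  rw [homog, ← funext (qBasis_apply q), (qBasis q).mem_span_image]
  exact ⟨fun h w hw => h (Finsupp.mem_support_iff.2 hw),
    fun h w hw => h w (Finsupp.mem_support_iff.1 hw)⟩

theorem word_mem_homog (q : k) (w : Word) : word q w ∈ homog q (weight w) :=
  Submodule.subset_span ⟨w, rfl, rfl⟩

theorem prep_mem_homog {q : k} {n : ℕ} {S : QStuffle q} (h : S ∈ homog q n) (a : Letter) :
    prep q a S ∈ homog q (weight [a] + n) := by
  have : homog q n ≤ (homog q (weight [a] + n)).comap (prep q a) := by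
    rw [homog, Submodule.span_le]
    rintro _ ⟨w, rfl, rfl⟩
    rw [SetLike.mem_coe, Submodule.mem_comap, prep_word]
    have := word_mem_homog q (a :: w)
    rwa [← List.singleton_append, weight_append] at this
  exact this h

theorem stuffleWord_mem_homog (q : k) (u v : Word) :
    stuffleWord q u v ∈ homog q (weight u + weight v) := by
  induction hn : u.length + v.length using Nat.strong_induction_on generalizing u v with
  | _ n ih =>
    subst hn
    cases u with
    | nil => rw [nil_stuffleWord, weight_nil, zero_add]; exact word_mem_homog q v
    | cons a u =>
      cases v with
      | nil => rw [stuffleWord_nil, weight_nil, add_zero]; exact word_mem_homog q _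
      | cons b v =>
        have e1 : weight (a :: u) = weight [a] + weight u := weight_append [a] u
        have e2 : weight (b :: v) = weight [b] + weight v := weight_append [b] v
        rw [stuffleWord]
        refine add_mem (add_mem ?_ ?_) (Submodule.smul_mem _ _ ?_)
        · rw [e1, add_assoc]
          exact prep_mem_homog (ih _ (by simp) u (b :: v) rfl) a
        · rw [e2, add_left_comm]
          exact prep_mem_homog (ih _ (by simp) (a :: u) v rfl) b
        · have := prep_mem_homog (ih _ (by simp; omega) u v rfl) (a + b)
          rw [weight_singleton_add] at this
          rw [e1, e2]
          convert this using 2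
          ring

theorem mul_mem_homog {q : k} {m n : ℕ} {S T : QStuffle q} (hS : S ∈ homog q m)
    (hT : T ∈ homog q n) : S * T ∈ homog q (m + n) := by
  have : homog q m * homog q n ≤ homog q (m + n) := by
    rw [homog, homog, Submodule.span_mul_span, Submodule.span_le]
    rintro _ ⟨_, ⟨u, rfl, rfl⟩, _, ⟨v, rfl, rfl⟩, rfl⟩
    simp only [word_mul_word]
    exact stuffleWord_mem_homog q u v
  exact this (Submodule.mul_mem_mul hS hT)

theorem one_mem_homog (q : k) : (1 : QStuffle q) ∈ homog q 0 := word_mem_homog q []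

theorem list_prod_mem_homog {q : k} {ι : Type*} (L : List ι) (S : ι → QStuffle q) (d : ι → ℕ)
    (h : ∀ i ∈ L, S i ∈ homog q (d i)) : (L.map S).prod ∈ homog q (L.map d).sum := by
  induction L with
  | nil => exact one_mem_homog q
  | cons i L ih =>
    simp only [List.map_cons, List.prod_cons, List.sum_cons]
    exact mul_mem_homog (h i (by simp)) (ih fun j hj => h j (by simp [hj]))

theorem weight_flatten (L : List Word) : weight L.flatten = (L.map weight).sum := by
  induction L with
  | nil => rfl
  | cons u L ih => rw [List.flatten_cons, weight_append, ih, List.map_cons, List.sum_cons]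

end Duality

/-! ### Positivity -/

section Positivity

variable {k : Type u} [CommRing k] [Algebra ℚ k]

open QStuffle

/-- The semiring of the values at `q` of polynomials with nonnegative rational coefficients. -/
def positives (q : k) : Subsemiring k where
  carrier := {c | IsPositiveRational q c}
  zero_mem' := ⟨0, by simp, by simp⟩
  one_mem' := ⟨1, fun n => by rw [Polynomial.coeff_one]; split_ifs <;> norm_num, by simp⟩
  add_mem' := by
    rintro _ _ ⟨p, hp, rfl⟩ ⟨p', hp', rfl⟩
    exact ⟨p + p', fun n => by rw [Polynomial.coeff_add]; exact add_nonneg (hp n) (hp' n),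
      by simp⟩
  mul_mem' := by
    rintro _ _ ⟨p, hp, rfl⟩ ⟨p', hp', rfl⟩
    exact ⟨p * p', fun n => by
      rw [Polynomial.coeff_mul]
      exact Finset.sum_nonneg fun x _ => mul_nonneg (hp _) (hp' _), by simp⟩

theorem mem_positives {q c : k} : c ∈ positives q ↔ IsPositiveRational q c := Iff.rfl

theorem self_mem_positives (q : k) : q ∈ positives q :=
  ⟨Polynomial.X, fun n => by rw [Polynomial.coeff_X]; split_ifs <;> norm_num, by simp⟩

theorem algebraMap_mem_positives (q : k) {r : ℚ} (hr : 0 ≤ r) : algebraMap ℚ k r ∈ positives q :=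
  ⟨Polynomial.C r, fun n => by rw [Polynomial.coeff_C]; split_ifs <;> simp [hr], by simp⟩

/-- The elements of the `q`-stuffle algebra with positive coefficients. -/
def positiveCone (q : k) : Submodule (positives q) (QStuffle q) where
  carrier := {S | ∀ w, coeff S w ∈ positives q}
  zero_mem' w := by rw [map_zero]; exact zero_mem _
  add_mem' hS hT w := by rw [map_add]; exact add_mem (hS w) (hT w)
  smul_mem' c S hS w := mul_mem c.2 (hS w)

theorem mem_positiveCone {q : k} {S : QStuffle q} :
    S ∈ positiveCone q ↔ ∀ w, coeff S w ∈ positives q := Iff.rfl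

theorem word_mem_positiveCone (q : k) (w : Word) : word q w ∈ positiveCone q := by
  intro v
  rw [coeff_word_apply]
  split_ifs
  exacts [one_mem _, zero_mem _]

theorem positive_smul_mem {q c : k} (hc : c ∈ positives q) {S : QStuffle q}
    (hS : S ∈ positiveCone q) : c • S ∈ positiveCone q := fun w => by
  rw [map_smul]; exact mul_mem hc (hS w)

/-- The recursion `strip_mul` involves only sums, products and the positive scalar `q`. -/
theorem positiveCone_mul {q : k} {S T : QStuffle q} (hS : S ∈ positiveCone q)
    (hT : T ∈ positiveCone q) : S * T ∈ positiveCone q := by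
  intro w
  induction w generalizing S T with
  | nil => rw [coeff_mul_nil]; exact mul_mem (hS _) (hT _)
  | cons a w ih =>
    have hs : ∀ {S : QStuffle q} (b : Letter), S ∈ positiveCone q → strip b S ∈ positiveCone q :=
      fun b h v => h (b :: v)
    rw [← coeff_strip, strip_mul, map_add, map_add, map_smul, map_sum]
    simp only [Finsupp.add_apply, Finsupp.smul_apply, Finsupp.finsetSum_apply, smul_eq_mul]
    exact add_mem (add_mem (ih (hs a hS) hT) (ih hS (hs a hT)))
      (mul_mem (self_mem_positives q) (sum_mem fun p _ => ih (hs _ hS) (hs _ hT)))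

theorem list_prod_mem_positiveCone {q : k} (L : List (QStuffle q))
    (h : ∀ S ∈ L, S ∈ positiveCone q) : L.prod ∈ positiveCone q := by
  induction L with
  | nil => exact word_mem_positiveCone q []
  | cons S L ih =>
    rw [List.prod_cons]
    exact positiveCone_mul (h S (by simp)) (ih fun T hT => h T (by simp [hT]))

end Positivity

/-! ### The elements `π₁(y_s)` -/

section Products

variable {k : Type u} [CommRing k]

open QStuffle

theorem ncCoeff_mul (P R : NCPoly k) (w : Word) :
    ncCoeff (P * R) w =
      ∑ i ∈ Finset.range (w.length + 1), ncCoeff P (w.take i) * ncCoeff R (w.drop i) := by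
  have key : (LinearMap.mul k (NCPoly k)).compr₂ (ncCoeffₗ w) =
      ∑ i ∈ Finset.range (w.length + 1),
        (LinearMap.mul k k).compl₁₂ (ncCoeffₗ (w.take i)) (ncCoeffₗ (w.drop i)) := by
    refine (ncBasis k).ext fun u => (ncBasis k).ext fun v => ?_
    simp only [LinearMap.compr₂_apply, LinearMap.sum_apply, LinearMap.compl₁₂_apply,
      LinearMap.mul_apply', ncBasis_apply, ← ncWord_append, ncCoeffₗ_apply, ncCoeff_ncWord]
    by_cases h : u ++ v = w
    · subst h
      rw [if_pos rfl, Finset.sum_eq_single u.length]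
      · simp
      · intro i hi hne
        rw [if_neg, zero_mul]
        intro h
        apply hne
        have := congrArg List.length h
        rw [List.length_take] at this
        rw [Finset.mem_range] at hi
        omega
      · intro h; exact absurd (Finset.mem_range.2 (by simp)) h
    · rw [if_neg h, Finset.sum_eq_zero]
      intro i _
      by_cases h1 : u = w.take i
      · rw [if_pos h1, if_neg, mul_zero]
        rintro rfl
        exact h (by rw [h1, List.take_append_drop])
      · rw [if_neg h1, zero_mul]
  have := congrArg (fun f => f P R) key
  simpa only [LinearMap.compr₂_apply, LinearMap.sum_apply, LinearMap.compl₁₂_apply,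
      LinearMap.mul_apply', ncCoeffₗ_apply] using this

theorem coeff_mul_singleton {q : k} (S T : QStuffle q) (a : Letter) :
    coeff (S * T) [a] = coeff S [a] * coeff T [] + coeff S [] * coeff T [a]
      + q * ∑ p ∈ letterPairs a, coeff S [y p.1] * coeff T [y p.2] := by
  rw [← coeff_strip, strip_mul, map_add, map_add, map_smul, map_sum]
  simp only [Finsupp.add_apply, Finsupp.smul_apply, Finsupp.finsetSum_apply, smul_eq_mul,
    coeff_mul_nil, coeff_strip]

theorem coeff_list_prod_nil {q : k} {L : List (QStuffle q)} (hL : L ≠ [])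
    (h : ∀ S ∈ L, coeff S [] = 0) : coeff L.prod [] = 0 := by
  cases L with
  | nil => exact absurd rfl hL
  | cons S L => rw [List.prod_cons, coeff_mul_nil, h S (by simp), zero_mul]

theorem coeff_word_nil (q : k) {w : Word} (h : w ≠ []) : coeff (word q w) [] = 0 := by
  rw [coeff_word_apply, if_neg h]

/-- Words in a stuffle of `u` and `v` are at least as long as each of the two, so one letter can
arise from nonempty words only if all of them are letters. This leaves only lists of letters in the
sum defining `π₁(y_s)`. -/
theorem coeff_prod_words_singleton_eq_zero (q : k) {L : List Word} (h0 : ∀ u ∈ L, u ≠ [])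
    (h : ∃ u ∈ L, u.length ≠ 1) (a : Letter) : coeff (L.map (word q)).prod [a] = 0 := by
  induction L generalizing a with
  | nil => simp at h
  | cons u L ih =>
    have hu : coeff (word q u) [] = 0 := coeff_word_nil q (h0 u (by simp))
    rw [List.map_cons, List.prod_cons, coeff_mul_singleton, hu, zero_mul, add_zero]
    by_cases h1 : u.length = 1
    · have hL : ∃ u ∈ L, u.length ≠ 1 := by
        obtain ⟨v, hv, hv'⟩ := h
        rcases List.mem_cons.1 hv with rfl | hv
        · exact absurd h1 hv'
        · exact ⟨v, hv, hv'⟩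
      have hne : L.map (word q) ≠ [] := by
        obtain ⟨v, hv, -⟩ := hL
        simpa using List.ne_nil_of_mem hv
      rw [coeff_list_prod_nil hne, mul_zero, zero_add, Finset.sum_eq_zero, mul_zero]
      · intro p _
        rw [ih (fun v hv => h0 v (by simp [hv])) hL, mul_zero]
      · intro S hS
        obtain ⟨v, hv, rfl⟩ := List.mem_map.1 hS
        exact coeff_word_nil q (h0 v (by simp [hv]))
    · have : ∀ b : Letter, coeff (word q u) [b] = 0 := by
        intro b
        rw [coeff_word_apply, if_neg]
        rintro rfl
        exact h1 rfl
      simp [this]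

/-- A single letter appears by adding all the letters together, which costs one factor `q` for each
of the `w.length - 1` additions and forces the weights to agree. -/
theorem coeff_prod_letters_singleton (q : k) {w : Word} (hw : w ≠ []) (a : Letter) :
    coeff (w.map fun b => word q [b]).prod [a] =
      if weight w = weight [a] then q ^ (w.length - 1) else 0 := by
  induction w generalizing a with
  | nil => exact absurd rfl hw
  | cons b w ih =>
    have wt : ∀ a : Letter, weight [a] = ((OrderDual.ofDual a : ℕ+) : ℕ) := by simp [weight]
    rw [List.map_cons, List.prod_cons]
    by_cases hw' : w = []
    · subst hw'
      rw [List.map_nil, List.prod_nil, mul_one, coeff_word_apply, List.length_singleton]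
      refine if_congr ?_ (by simp) rfl
      rw [wt, wt, PNat.coe_inj, OrderDual.ofDual_inj]
      simp
    · rw [coeff_mul_singleton, coeff_word_nil q (by simp), zero_mul, add_zero,
        coeff_list_prod_nil (by simpa using hw')
          (fun S hS => by
            obtain ⟨v, hv, rfl⟩ := List.mem_map.1 hS
            exact coeff_word_nil q (by simp)), mul_zero, zero_add]
      simp only [ih hw', coeff_word_apply]
      obtain ⟨c, hc⟩ : ∃ c : ℕ+, (c : ℕ) = weight w := ⟨⟨weight w, weight_pos hw'⟩, rfl⟩
      rw [weight_cons, wt a, List.length_cons, Nat.add_sub_cancel]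
      split_ifs with h
      · rw [Finset.sum_eq_single (OrderDual.ofDual b, c)]
        · have h1 := List.length_pos_iff.2 hw'
          have e1 : [b] = [y (OrderDual.ofDual b)] := rfl
          have e2 : weight w = weight [y c] := by rw [wt, ← hc]; rfl
          rw [if_pos e1, if_pos e2, one_mul, ← pow_succ', Nat.sub_add_cancel h1]
        · intro p hp hne
          by_cases h1 : b = y p.1
          · rw [if_neg (c := weight w = _), mul_zero]
            intro h2
            apply hne
            refine Prod.ext (by rw [h1]; rfl) (PNat.coe_injective ?_)
            rw [wt] at h2
            rw [hc]
            exact h2.symm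
          · rw [if_neg (by simpa using h1), zero_mul]
        · intro h'
          refine absurd (mem_letterPairs.2 (OrderDual.ofDual.injective (PNat.coe_injective ?_))) h'
          rw [← h, ← hc]
          rfl
      · rw [Finset.sum_eq_zero, mul_zero]
        intro p hp
        by_cases h1 : b = y p.1
        · rw [if_neg (c := weight w = _), mul_zero]
          intro h2
          apply h
          rw [wt] at h2
          rw [h2, ← mem_letterPairs.1 hp, h1]
          rfl
        · rw [if_neg (by simpa using h1), zero_mul]

/-- The polynomial counting the words of an element by length. -/
def lengthPoly {q : k} : QStuffle q →ₗ[k] Polynomial k :=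
  (qBasis q).constr k fun w => Polynomial.X ^ w.length

theorem lengthPoly_word (q : k) (w : Word) : lengthPoly (word q w) = Polynomial.X ^ w.length :=
  (qBasis q).constr_basis k _ w

theorem lengthPoly_prep {q : k} (a : Letter) (S : QStuffle q) :
    lengthPoly (prep q a S) = Polynomial.X * lengthPoly S := by
  have : lengthPoly.comp (prep q a) =
      (LinearMap.mulLeft k (Polynomial.X : Polynomial k)).comp lengthPoly :=
    lin_ext q fun w => by
      rw [LinearMap.comp_apply, LinearMap.comp_apply, LinearMap.mulLeft_apply, prep_word,
        lengthPoly_word, lengthPoly_word, List.length_cons, pow_succ']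
  exact congrArg (fun g => g S) this

/-- The stuffle recursion never compares letters, so the lengths it produces ignore them. Any word
may therefore be replaced by a power of a fixed letter when only lengths matter. -/
theorem lengthPoly_stuffleWord (q : k) {u v u' v' : Word} (hu : u.length = u'.length)
    (hv : v.length = v'.length) :
    lengthPoly (stuffleWord q u v) = lengthPoly (stuffleWord q u' v') := by
  induction hn : u.length + v.length using Nat.strong_induction_on generalizing u v u' v' with
  | _ n ih =>
    subst hn
    cases u with
    | nil =>
      obtain rfl := List.length_eq_zero_iff.1 hu.symm
      rw [nil_stuffleWord, nil_stuffleWord, lengthPoly_word, lengthPoly_word, hv]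
    | cons a u =>
      cases u' with
      | nil => simp at hu
      | cons a' u' =>
        cases v with
        | nil =>
          obtain rfl := List.length_eq_zero_iff.1 hv.symm
          rw [stuffleWord_nil, stuffleWord_nil, lengthPoly_word, lengthPoly_word, hu]
        | cons b v =>
          cases v' with
          | nil => simp at hv
          | cons b' v' =>
            have hu' : u.length = u'.length := by simpa using hu
            have hv' : v.length = v'.length := by simpa using hv
            rw [stuffleWord, stuffleWord]
            simp only [map_add, map_smul, lengthPoly_prep]
            rw [ih _ (by simp) hu' hv rfl, ih _ (by simp) hu hv' rfl,
              ih _ (by simp; omega) hu' hv' rfl]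

theorem constr_monomials_X_pow (f : ℕ → k) (n : ℕ) :
    (Polynomial.basisMonomials k).constr k f (Polynomial.X ^ n) = f n := by
  have h := (Polynomial.basisMonomials k).constr_basis k f n
  rw [Polynomial.coe_basisMonomials] at h
  beta_reduce at h
  rwa [Polynomial.monomial_one_right_eq_X_pow] at h

/-- The letter can be inserted in `w.length + 1` places, or added to one of the `w.length` letters
at the cost of a factor `q`. -/
theorem lengthPoly_letter_stuffle (q : k) (a : Letter) (w : Word) :
    lengthPoly (stuffleWord q [a] w) =
      ((w.length : k) + 1) • Polynomial.X ^ (w.length + 1)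
        + (q * w.length) • Polynomial.X ^ w.length := by
  induction w with
  | nil => simp [stuffleWord_nil, lengthPoly_word]
  | cons b w ih =>
    rw [stuffleWord]
    simp only [map_add, map_smul, lengthPoly_prep, nil_stuffleWord, lengthPoly_word, ih,
      List.length_cons, Nat.cast_succ, Polynomial.smul_eq_C_mul, map_add, map_mul, map_one]
    ring

end Products

/-! ### The logarithm and the primitivity of `π₁(y_s)` -/

section LogCoeff

variable {k : Type u} [CommRing k] [Algebra ℚ k]

open QStuffle

/-- The coefficient `(-q)^{n-1}/n`, which vanishes for `n = 0`. -/
def logCoeff (q : k) (n : ℕ) : k := algebraMap ℚ k ((-1) ^ (n - 1) / (n : ℚ)) * q ^ (n - 1)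

theorem logCoeff_zero (q : k) : logCoeff q 0 = 0 := by simp [logCoeff]

theorem logCoeff_one (q : k) : logCoeff q 1 = 1 := by simp [logCoeff]

theorem succ_mul_logCoeff (q : k) (n : ℕ) : ((n : k) + 1) * logCoeff q (n + 1) = (-q) ^ n := by
  have h : ((n : k) + 1) = algebraMap ℚ k (n + 1) := by simp
  have h' : (n : ℚ) + 1 ≠ 0 := by positivity
  rw [logCoeff, h, ← mul_assoc, ← map_mul, Nat.add_sub_cancel, Nat.cast_succ,
    mul_div_cancel₀ _ h', neg_pow q n]
  simp

theorem eq_zero_of_succ_mul {n : ℕ} {x : k} (h : ((n : k) + 1) * x = 0) : x = 0 := by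
  have h1 : algebraMap ℚ k ((n + 1 : ℚ)⁻¹) * ((n : k) + 1) = 1 := by
    have h' : (n : ℚ) + 1 ≠ 0 := by positivity
    have : ((n : k) + 1) = algebraMap ℚ k (n + 1) := by simp
    rw [this, ← map_mul, inv_mul_cancel₀ h', map_one]
  rw [← one_mul x, ← h1, mul_assoc, h, mul_zero]

/-- Only lists of one-letter words contribute to the sum, and such lists are the same thing as
words; `e` is this identification. -/
theorem pi1_letter (q : k) (a : Letter) :
    pi1 q [a] = ∑ w ∈ wordsOfWeight (weight [a]), logCoeff q w.length • ncWord k w := by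
  let e : {w // w ∈ wordsOfWeight (weight [a])} ↪ {L : List {u : Word // u ≠ []} // L ≠ []} :=
    ⟨fun w => ⟨w.1.map fun b => ⟨[b], by simp⟩, fun h => by
      have h1 := mem_wordsOfWeight.1 w.2
      rw [List.map_eq_nil_iff] at h
      rw [h, weight_nil] at h1
      exact (weight_singleton_pos a).ne h1⟩, fun v w h => by
        have h1 := congrArg (fun L => L.1.map Subtype.val) h
        simp only [List.map_map] at h1
        exact Subtype.ext (List.map_injective_iff.2 (fun b c h => by simpa using h) h1)⟩
  have he : ∀ w, (e w).1 = w.1.map fun b => ⟨[b], by simp⟩ := fun _ => rfl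
  rw [pi1, finsum_eq_sum_of_support_subset (s := Finset.univ.map e)]
  · rw [Finset.sum_map, ← Finset.sum_coe_sort (wordsOfWeight (weight [a]))]
    refine Finset.sum_congr rfl fun w _ => ?_
    have h1 := mem_wordsOfWeight.1 w.2
    have hw : w.1 ≠ [] := by
      intro h
      rw [h, weight_nil] at h1
      exact (weight_singleton_pos a).ne h1
    have h2 : (e w).1.map (fun u => word q u.1) = w.1.map fun b => word q [b] := by
      rw [he, List.map_map]
      rfl
    have h3 : ((e w).1.map fun u => u.1).flatten = w.1 := by
      rw [he, List.map_map]
      generalize w.1 = v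
      induction v with
      | nil => rfl
      | cons b v ih => rw [List.map_cons, List.flatten_cons, ih]; rfl
    have h4 : (e w).1.length = w.1.length := by rw [he, List.length_map]
    rw [h2, h3, h4, coeff_prod_letters_singleton q hw, if_pos h1, logCoeff]
  · intro L hL
    have hc : coeff (L.1.map fun u => word q u.1).prod [a] ≠ 0 := by
      intro h0
      apply hL
      simp only [h0, mul_zero, zero_smul]
    have hmap : (L.1.map fun u => word q u.1) = (L.1.map Subtype.val).map (word q) := by
      rw [List.map_map]; rfl
    have hlen : ∀ u ∈ L.1.map Subtype.val, u.length = 1 := by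
      by_contra hn
      push Not at hn
      rw [hmap] at hc
      refine hc (coeff_prod_words_singleton_eq_zero q ?_ hn a)
      intro u hu
      obtain ⟨v, -, rfl⟩ := List.mem_map.1 hu
      exact v.2
    have hex : ∀ M : List Word, (∀ u ∈ M, u.length = 1) → ∃ w : Word, M = w.map fun b => [b] := by
      intro M
      induction M with
      | nil => exact fun _ => ⟨[], rfl⟩
      | cons u M ih =>
        intro h
        obtain ⟨w, rfl⟩ := ih fun v hv => h v (by simp [hv])
        obtain ⟨b, rfl⟩ := List.length_eq_one_iff.1 (h u (by simp))
        exact ⟨b :: w, rfl⟩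
    obtain ⟨w, hw⟩ := hex _ hlen
    have hw0 : w ≠ [] := by
      rintro rfl
      exact L.2 (List.map_eq_nil_iff.1 hw)
    have hwt : weight w = weight [a] := by
      rw [hmap, hw, List.map_map] at hc
      have := coeff_prod_letters_singleton q hw0 a
      by_contra h
      rw [if_neg h] at this
      exact hc this
    rw [Finset.mem_coe, Finset.mem_map]
    refine ⟨⟨w, mem_wordsOfWeight.2 hwt⟩, Finset.mem_univ _, Subtype.ext ?_⟩
    refine List.map_injective_iff.2 Subtype.val_injective ?_
    rw [hw]
    change List.map Subtype.val (List.map _ w) = _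
    rw [List.map_map]
    rfl

theorem ncCoeff_pi1_letter (q : k) (a : Letter) (w : Word) :
    ncCoeff (pi1 q [a]) w = if weight w = weight [a] then logCoeff q w.length else 0 := by
  rw [pi1_letter, ncCoeff_sum]
  simp only [ncCoeff_smul, ncCoeff_ncWord, mul_ite, mul_one, mul_zero, Finset.sum_ite_eq',
    mem_wordsOfWeight]

/-- The linear form `w ↦ (-q)^{|w|-1}/|w|`. -/
def logForm {q : k} : QStuffle q →ₗ[k] k :=
  ((Polynomial.basisMonomials k).constr k (logCoeff q)).comp lengthPoly

theorem logForm_word (q : k) (w : Word) : logForm (word q w) = logCoeff q w.length := by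
  rw [logForm, LinearMap.comp_apply, lengthPoly_word, constr_monomials_X_pow]

/-- For a word of length `n ≥ 1` the two kinds of terms contribute `(-q)^n` and `q * (-q)^(n-1)`,
which cancel; only the empty word survives. -/
theorem logForm_letter_mul {q : k} (a : Letter) (S : QStuffle q) :
    logForm (word q [a] * S) = coeff S [] := by
  have : logForm.comp (mulLin q (word q [a])) = (qBasis q).coord [] :=
    lin_ext q fun w => by
      rw [LinearMap.comp_apply, mulLin_word, logForm, LinearMap.comp_apply,
        lengthPoly_letter_stuffle, map_add, map_smul, map_smul, constr_monomials_X_pow,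
        constr_monomials_X_pow, smul_eq_mul, smul_eq_mul, succ_mul_logCoeff,
        Module.Basis.coord_apply, qBasis_repr, coeff_word_apply]
      cases w with
      | nil => simp
      | cons b w =>
        rw [if_neg (by simp), List.length_cons, Nat.cast_succ, mul_assoc, succ_mul_logCoeff]
        ring
  exact congrArg (fun g => g S) this

/-- Only the length of `u` matters, so `u` may be a power of one letter `c`. Multiplying `c^m ⋆ v`
by `c` gives zero by `logForm_letter_mul`, and expanding `c ⋆ c^m` by lengths turns this into a
two-term recurrence in `m`. -/
theorem logForm_mul_words (q : k) {u v : Word} (hu : u ≠ []) (hv : v ≠ []) :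
    logForm (word q u * word q v) = 0 := by
  let c : Letter := y 1
  have hG : ∀ z : QStuffle q, logForm (z * word q v) =
      (Polynomial.basisMonomials k).constr k
        (fun m => logForm (stuffleWord q (List.replicate m c) v)) (lengthPoly z) := by
    intro z
    have : logForm.comp ((mulLin q).flip (word q v)) =
        ((Polynomial.basisMonomials k).constr k
          (fun m => logForm (stuffleWord q (List.replicate m c) v))).comp lengthPoly :=
      lin_ext q fun w => by
        rw [LinearMap.comp_apply, LinearMap.comp_apply, LinearMap.flip_apply, mulLin_word,
          lengthPoly_word, constr_monomials_X_pow, logForm, LinearMap.comp_apply,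
          LinearMap.comp_apply, lengthPoly_stuffleWord q (List.length_replicate).symm rfl]
    exact congrArg (fun g => g z) this
  -- At `m = 0` the second term has the factor `m` and disappears, so the recurrence starts by
  -- itself.
  have hrec : ∀ m : ℕ, ((m : k) + 1) * logForm (stuffleWord q (List.replicate (m + 1) c) v)
      + q * m * logForm (stuffleWord q (List.replicate m c) v) = 0 := by
    intro m
    have h := logForm_letter_mul c (word q (List.replicate m c) * word q v)
    rw [coeff_mul_nil, coeff_word_nil q hv, mul_zero, ← mul_assoc, hG, word_mul_word,
      lengthPoly_letter_stuffle, map_add, map_smul, map_smul, constr_monomials_X_pow,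
      constr_monomials_X_pow, List.length_replicate] at h
    exact h
  have hzero : ∀ m : ℕ, logForm (stuffleWord q (List.replicate (m + 1) c) v) = 0 := by
    intro m
    induction m with
    | zero => simpa using hrec 0
    | succ m ih =>
      have := hrec (m + 1)
      rw [ih, mul_zero, add_zero] at this
      exact eq_zero_of_succ_mul this
  obtain ⟨n, hn⟩ := Nat.exists_eq_succ_of_ne_zero (List.length_pos_iff.2 hu).ne'
  rw [word_mul_word, logForm, LinearMap.comp_apply,
    lengthPoly_stuffleWord q (u' := List.replicate (n + 1) c) (v' := v) (by simp [hn]) rfl]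
  exact hzero n

theorem pair_pi1_of_mem_homog {q : k} {a : Letter} {n : ℕ} {S : QStuffle q}
    (hS : S ∈ homog q n) :
    pair q S (pi1 q [a]) = if n = weight [a] then logForm S else 0 := by
  rw [homog] at hS
  induction hS using Submodule.span_induction with
  | mem x hx =>
    obtain ⟨w, rfl, rfl⟩ := hx
    rw [pair_word, ncCoeff_pi1_letter, logForm_word]
  | zero => simp
  | add x z _ _ hx hz => rw [map_add, LinearMap.add_apply, hx, hz, map_add]; split_ifs <;> simp
  | smul c x _ hx => rw [map_smul, LinearMap.smul_apply, hx, map_smul]; split_ifs <;> simp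

theorem pi1_letter_mem_primitive (q : k) (a : Letter) : pi1 q [a] ∈ primitive q := by
  refine mem_primitive_of_words ?_ fun u v hu hv => ?_
  · rw [ncCoeff_pi1_letter, weight_nil, if_neg (weight_singleton_pos a).ne]
  · rw [pair_pi1_of_mem_homog (mul_mem_homog (word_mem_homog q u) (word_mem_homog q v)),
      logForm_mul_words q hu hv, ite_self]

/-! ### The letters as polynomials in the `π₁(y_s)` -/

/-- The power series `log(1 + q X) / q`. -/
def logSeries (q : k) : PowerSeries k := PowerSeries.mk (logCoeff q)

/-- The differential equation of `log(1 + q X) / q`, in a form that is valid even when `q` is not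
invertible. -/
theorem one_add_mul_deriv_logSeries (q : k) :
    (1 + PowerSeries.C q * PowerSeries.X) * PowerSeries.derivative k (logSeries q) = 1 := by
  ext n
  rw [add_mul, one_mul, mul_assoc, map_add, PowerSeries.coeff_C_mul, PowerSeries.coeff_one]
  cases n with
  | zero => simp [logSeries, PowerSeries.coeff_derivative, logCoeff_one]
  | succ n =>
    rw [PowerSeries.coeff_succ_X_mul, PowerSeries.coeff_derivative, PowerSeries.coeff_derivative,
      logSeries, PowerSeries.coeff_mk, PowerSeries.coeff_mk, mul_comm (logCoeff _ _),
      mul_comm (logCoeff _ _), succ_mul_logCoeff, succ_mul_logCoeff]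
    rw [if_neg (Nat.succ_ne_zero n), pow_succ]
    ring

/-- The coefficients of `∑_{1 ≤ i ≤ s} q^{i-1}/i! Xⁱ`. -/
def expCoeff (q : k) (i : ℕ) : k := algebraMap ℚ k ((i ! : ℚ)⁻¹) * q ^ (i - 1)

/-- Formally `(exp(q L) - 1) / q = X` for `L = log(1 + q X) / q`. The truncated left side `F`
satisfies `(1 + q X) F' = 1 + q F` below degree `s`; with `F(0) = 0` this determines its
coefficients up to degree `s`. -/
theorem coeff_exp_logSeries (q : k) {s n : ℕ} (hn : 0 < n) (hns : n ≤ s) :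
    ∑ i ∈ Finset.range s, expCoeff q (i + 1) * PowerSeries.coeff n (logSeries q ^ (i + 1)) =
      if n = 1 then 1 else 0 := by
  let F : PowerSeries k := ∑ i ∈ Finset.range s, expCoeff q (i + 1) • logSeries q ^ (i + 1)
  have hF : ∀ n, PowerSeries.coeff n F =
      ∑ i ∈ Finset.range s, expCoeff q (i + 1) * PowerSeries.coeff n (logSeries q ^ (i + 1)) := by
    intro n; simp [F]
  have hconst : PowerSeries.constantCoeff (logSeries q) = 0 := by
    rw [← PowerSeries.coeff_zero_eq_constantCoeff_apply, logSeries, PowerSeries.coeff_mk,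
      logCoeff_zero]
  have hexp : ∀ i : ℕ, expCoeff q (i + 1) * ((i : k) + 1) = algebraMap ℚ k ((i ! : ℚ)⁻¹) * q ^ i := by
    intro i
    have h1 : ((i : k) + 1) = algebraMap ℚ k (i + 1) := by simp
    have h2 : (i : ℚ) + 1 ≠ 0 := by positivity
    rw [expCoeff, h1, Nat.add_sub_cancel, mul_right_comm, ← map_mul, Nat.factorial_succ,
      Nat.cast_mul, Nat.cast_succ, mul_inv_rev, mul_assoc _ _ ((i : ℚ) + 1), inv_mul_cancel₀ h2,
      mul_one]
  have hode : ∀ m < s, PowerSeries.coeff m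
      ((1 + PowerSeries.C q * PowerSeries.X) * PowerSeries.derivative k F) =
        PowerSeries.coeff m (1 + PowerSeries.C q * F) := by
    intro m hm
    have h1 : (1 + PowerSeries.C q * PowerSeries.X) * PowerSeries.derivative k F =
        ∑ i ∈ Finset.range s, (algebraMap ℚ k ((i ! : ℚ)⁻¹) * q ^ i) • logSeries q ^ i := by
      simp only [F, map_sum, Finset.mul_sum]
      refine Finset.sum_congr rfl fun i _ => ?_
      rw [← hexp, Derivation.map_smul, PowerSeries.derivative_pow, Nat.add_sub_cancel, mul_smul_comm,
        mul_left_comm, one_add_mul_deriv_logSeries, mul_one, Nat.cast_succ, mul_smul]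
      congr 1
      rw [PowerSeries.smul_eq_C_mul]
      simp
    obtain ⟨s, rfl⟩ : ∃ t, s = t + 1 := ⟨s - 1, by omega⟩
    rw [h1, Finset.sum_range_succ']
    have h2 : (1 : PowerSeries k) + PowerSeries.C q * F =
        ∑ i ∈ Finset.range s, (algebraMap ℚ k (((i + 1) ! : ℚ)⁻¹) * q ^ (i + 1)) •
          logSeries q ^ (i + 1) + (algebraMap ℚ k ((0 ! : ℚ)⁻¹) * q ^ 0) • logSeries q ^ 0
          + (q * expCoeff q (s + 1)) • logSeries q ^ (s + 1) := by
      simp only [F]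
      rw [Finset.sum_range_succ, mul_add, Finset.mul_sum]
      have : ∀ i, PowerSeries.C q * expCoeff q (i + 1) • logSeries q ^ (i + 1) =
          (algebraMap ℚ k (((i + 1) ! : ℚ)⁻¹) * q ^ (i + 1)) • logSeries q ^ (i + 1) := by
        intro i
        rw [← PowerSeries.smul_eq_C_mul, smul_smul, expCoeff, Nat.add_sub_cancel, pow_succ]
        congr 1
        ring
      rw [Finset.sum_congr rfl fun i _ => this i, ← PowerSeries.smul_eq_C_mul, smul_smul]
      simp
      ring
    -- The last summand, missing from `F'` by the index shift, has order at least `s + 1 > m`.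
    have h3 : PowerSeries.coeff m (logSeries q ^ (s + 1)) = 0 := by
      refine PowerSeries.coeff_of_lt_order _ ?_
      refine lt_of_lt_of_le ?_ (PowerSeries.le_order_pow_of_constantCoeff_eq_zero _ hconst)
      exact_mod_cast hm
    rw [h2, map_add _ _ ((q * expCoeff q (s + 1)) • _), map_smul, h3, smul_zero, add_zero]
  have hrec : ∀ m < s, ((m : k) + 1) * PowerSeries.coeff (m + 1) F
      + q * m * PowerSeries.coeff m F = (if m = 0 then 1 else 0) + q * PowerSeries.coeff m F := by
    intro m hm
    have h := hode m hm
    rw [add_mul, one_mul, mul_assoc, map_add, map_add, PowerSeries.coeff_C_mul,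
      PowerSeries.coeff_C_mul, PowerSeries.coeff_one, PowerSeries.coeff_derivative] at h
    rw [← h, mul_comm]
    congr 1
    cases m with
    | zero => simp
    | succ m =>
      rw [PowerSeries.coeff_succ_X_mul, PowerSeries.coeff_derivative]
      push_cast
      ring
  have hF0 : PowerSeries.coeff 0 F = 0 := by
    rw [hF]
    refine Finset.sum_eq_zero fun i _ => ?_
    rw [PowerSeries.coeff_zero_eq_constantCoeff_apply, map_pow, hconst, zero_pow (by simp),
      mul_zero]
  rw [← hF]
  have hall : ∀ n, n < s → PowerSeries.coeff (n + 1) F = if n = 0 then 1 else 0 := by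
    intro n
    induction n with
    | zero =>
      intro h
      have := hrec 0 h
      simpa [hF0] using this
    | succ n ih =>
      intro h
      have h1 := hrec (n + 1) h
      rw [ih (by omega)] at h1
      rw [if_neg (by omega)]
      refine eq_zero_of_succ_mul (n := n + 1) ?_
      by_cases h0 : n = 0
      · subst h0
        simpa using h1
      · simpa [h0] using h1
  obtain ⟨n, rfl⟩ : ∃ t, n = t + 1 := ⟨n - 1, by omega⟩
  rw [hall n hns]
  simp

theorem weight_letter (s : ℕ+) : weight [y s] = s := by
  rw [weight_cons, weight_nil, add_zero]
  rfl

/-- The generating series of the `π₁(y_s)`. -/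
def piSeries (q : k) : PowerSeries (NCPoly k) :=
  PowerSeries.mk fun s => if h : 0 < s then pi1 q [y ⟨s, h⟩] else 0

theorem ncCoeff_coeff_piSeries (q : k) (s : ℕ) (w : Word) :
    ncCoeff (PowerSeries.coeff s (piSeries q)) w =
      if weight w = s then PowerSeries.coeff w.length (logSeries q) else 0 := by
  rw [piSeries, PowerSeries.coeff_mk, logSeries, PowerSeries.coeff_mk]
  by_cases h : 0 < s
  · rw [dif_pos h, ncCoeff_pi1_letter]
    have : weight [y ⟨s, h⟩] = s := weight_letter _
    rw [this]
  · obtain rfl : s = 0 := by omega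
    rw [dif_neg h]
    split_ifs with h0
    · rw [weight_eq_zero.1 h0, List.length_nil, logCoeff_zero]; rfl
    · rfl

/-- Cutting `w` into two factors splits weight and length simultaneously, so multiplying these
noncommutative series reproduces the Cauchy product of the commutative series in the length. -/
theorem ncCoeff_coeff_piSeries_pow (q : k) (i s : ℕ) (w : Word) :
    ncCoeff (PowerSeries.coeff s (piSeries q ^ i)) w =
      if weight w = s then PowerSeries.coeff w.length (logSeries q ^ i) else 0 := by
  induction i generalizing s w with
  | zero =>
    rw [pow_zero, pow_zero, PowerSeries.coeff_one, PowerSeries.coeff_one]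
    by_cases hw : w = []
    · subst hw
      rw [weight_nil]
      by_cases hs : s = 0
      · simp [hs, ← ncWord_nil, ncCoeff_ncWord]
      · rw [if_neg hs, if_neg (Ne.symm hs)]; rfl
    · rw [if_neg (c := w.length = 0) (by simpa using hw), ite_self]
      split_ifs
      · rw [← ncWord_nil, ncCoeff_ncWord, if_neg (Ne.symm hw)]
      · rfl
  | succ i ih =>
    rw [pow_succ', pow_succ', PowerSeries.coeff_mul, PowerSeries.coeff_mul, ncCoeff_sum,
      Finset.Nat.sum_antidiagonal_eq_sum_range_succ_mk]
    simp only [ncCoeff_mul, ncCoeff_coeff_piSeries, ih]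
    have hw : ∀ j, weight (w.take j) + weight (w.drop j) = weight w := fun j => by
      rw [← weight_append, List.take_append_drop]
    rw [Finset.sum_comm, Finset.Nat.sum_antidiagonal_eq_sum_range_succ_mk]
    split_ifs with h
    · refine Finset.sum_congr rfl fun j hj => ?_
      have hj' : j ≤ w.length := by rw [Finset.mem_range] at hj; omega
      rw [Finset.sum_eq_single (weight (w.take j))]
      · rw [if_pos rfl, if_pos (by have := hw j; omega), List.length_take, List.length_drop,
          min_eq_left hj']
      · intro b _ hb
        rw [if_neg (Ne.symm hb), zero_mul]
      · intro hb
        exact absurd (Finset.mem_range.2 (by have := hw j; omega)) hb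
    · refine Finset.sum_eq_zero fun j _ => Finset.sum_eq_zero fun b hb => ?_
      by_cases h1 : weight (w.take j) = b
      · rw [if_neg (c := weight (w.drop j) = _), mul_zero]
        intro h2
        rw [Finset.mem_range] at hb
        exact h (by have := hw j; omega)
      · rw [if_neg h1, zero_mul]

/-- Exponentiating undoes the logarithm: the coefficient of a word of weight `s` is that of `X` in
degree `w.length`, so only the word of one letter remains. The scalars are positive, unlike those of
the logarithm. -/
theorem ncWord_letter_eq_sum (q : k) (s : ℕ+) :
    ncWord k [y s] = ∑ i ∈ Finset.range s, expCoeff q (i + 1) •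
      PowerSeries.coeff (s : ℕ) (piSeries q ^ (i + 1)) := by
  refine ncCoeff_ext fun w => ?_
  have hs := weight_letter s
  rw [ncCoeff_sum, ncCoeff_ncWord]
  simp only [ncCoeff_smul, ncCoeff_coeff_piSeries_pow]
  by_cases h : weight w = s
  · have hw : w ≠ [] := by
      rintro rfl
      exact s.pos.ne h
    simp only [if_pos h]
    rw [coeff_exp_logSeries q (List.length_pos_iff.2 hw) (h ▸ length_le_weight w)]
    congr 1
    rw [eq_iff_iff]
    constructor
    · rintro rfl; rfl
    · intro h1
      obtain ⟨a, rfl⟩ := List.length_eq_one_iff.1 h1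
      have : weight [a] = ((OrderDual.ofDual a : ℕ+) : ℕ) := by simp [weight]
      rw [this, PNat.coe_inj] at h
      rw [← h]; rfl
  · rw [if_neg]
    · simp [h]
    · rintro rfl; exact h hs

/-- Every word is a positive combination of products of elements `π₁(y_s)`. -/
theorem ncWord_mem_adjoin (q : k) (w : Word) :
    ncWord k w ∈ Algebra.adjoin (positives q) (Set.range fun a => pi1 q [a]) := by
  set A := Algebra.adjoin (positives q) (Set.range fun a => pi1 q [a]) with hA
  have hsm : ∀ {c : k} {P : NCPoly k}, c ∈ positives q → P ∈ A → c • P ∈ A := fun hc hP =>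
    A.smul_mem hP (⟨_, hc⟩ : positives q)
  -- These coefficients are sums of products of the generators, without scalars.
  have hpow : ∀ i s, PowerSeries.coeff s (piSeries q ^ i) ∈ A := by
    intro i
    induction i with
    | zero =>
      intro s
      rw [pow_zero, PowerSeries.coeff_one]
      split_ifs
      exacts [one_mem _, zero_mem _]
    | succ i ih =>
      intro s
      rw [pow_succ', PowerSeries.coeff_mul]
      refine sum_mem fun p _ => mul_mem ?_ (ih _)
      rw [piSeries, PowerSeries.coeff_mk]
      split_ifs
      exacts [Algebra.subset_adjoin ⟨_, rfl⟩, zero_mem _]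
  induction w with
  | nil => exact one_mem _
  | cons a w ih =>
    rw [ncWord_cons]
    refine mul_mem ?_ ih
    rw [show a = y (OrderDual.ofDual a) from rfl, ncWord_letter_eq_sum q]
    refine sum_mem fun i _ => hsm ?_ (hpow _ _)
    exact mul_mem (algebraMap_mem_positives q (by positivity))
      (pow_mem (self_mem_positives q) _)

end LogCoeff

/-! ### Triangularity of the family `Π` -/

section Leading

variable {k : Type u} [CommRing k]

/-- The rank of a word for the order by length, then lexicographic. -/
def rank (w : Word) : ℕ ×ₗ Word := toLex (w.length, w)

theorem rank_lt_iff {u v : Word} :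
    rank u < rank v ↔ u.length < v.length ∨ u.length = v.length ∧ u < v := by
  rw [rank, rank, Prod.Lex.toLex_lt_toLex]

/-- Comparing lengths first is what makes concatenation monotone: lexicographic comparisons then
occur only between words of equal length, where no word is a proper prefix of the other. -/
theorem rank_append {s r u v : Word} (h1 : u = s ∨ rank s < rank u) (h2 : v = r ∨ rank r < rank v) :
    (u = s ∧ v = r) ∨ rank (s ++ r) < rank (u ++ v) := by
  rw [rank_lt_iff] at h1 h2 ⊢
  rw [List.length_append, List.length_append]
  rcases h1 with rfl | h1 | h1 <;> rcases h2 with rfl | h2 | h2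
  · exact Or.inl ⟨rfl, rfl⟩
  · right; left; omega
  · right; right; exact ⟨by omega, List.append_left_lt h2.2⟩
  · right; left; omega
  · right; left; omega
  · right; left; omega
  · right; right; exact ⟨by omega, append_lt_append_of_length_le h1.2 h1.1.ge _ _⟩
  · right; left; omega
  · right; right; exact ⟨by omega, append_lt_append_of_length_le h1.2 h1.1.ge _ _⟩

/-- The polynomial `P` is homogeneous with least word `w`, which has coefficient `1`. -/
def IsLeading (P : NCPoly k) (w : Word) : Prop :=
  ncCoeff P w = 1 ∧ ∀ u, ncCoeff P u ≠ 0 → u = w ∨ (weight u = weight w ∧ rank w < rank u)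

theorem IsLeading.weight_eq {P : NCPoly k} {w u : Word} (h : IsLeading P w)
    (hu : ncCoeff P u ≠ 0) : weight u = weight w := by
  rcases h.2 u hu with rfl | h
  exacts [rfl, h.1]

theorem IsLeading.mul {P R : NCPoly k} {s r : Word} (hP : IsLeading P s) (hR : IsLeading R r) :
    IsLeading (P * R) (s ++ r) := by
  have key : ∀ u v : Word, ncCoeff P u * ncCoeff R v ≠ 0 →
      (u = s ∧ v = r) ∨ (weight (u ++ v) = weight (s ++ r) ∧ rank (s ++ r) < rank (u ++ v)) := by
    intro u v h
    have hu := left_ne_zero_of_mul h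
    have hv := right_ne_zero_of_mul h
    refine (rank_append ((hP.2 u hu).imp_right And.right)
      ((hR.2 v hv).imp_right And.right)).imp_right fun h' => ⟨?_, h'⟩
    rw [weight_append, weight_append, hP.weight_eq hu, hR.weight_eq hv]
  constructor
  · rw [ncCoeff_mul, Finset.sum_eq_single s.length]
    · rw [List.take_left, List.drop_left, hP.1, hR.1, one_mul]
    · intro i hi hne
      by_contra h
      rcases key _ _ h with ⟨h1, -⟩ | ⟨-, h2⟩
      · apply hne
        have := congrArg List.length h1
        rw [List.length_take] at this
        rw [Finset.mem_range] at hi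
        omega
      · rw [List.take_append_drop] at h2
        exact lt_irrefl _ h2
    · intro h; exact absurd (Finset.mem_range.2 (by simp)) h
  · intro w hw
    rw [ncCoeff_mul] at hw
    obtain ⟨i, -, hi⟩ := Finset.exists_ne_zero_of_sum_ne_zero hw
    rcases key _ _ hi with ⟨h1, h2⟩ | h
    · left
      rw [← h1, ← h2, List.take_append_drop]
    · right
      rwa [List.take_append_drop] at h

theorem isLeading_one : IsLeading (1 : NCPoly k) [] := by
  rw [← ncWord_nil]
  refine ⟨by rw [ncCoeff_ncWord, if_pos rfl], fun u hu => ?_⟩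
  left
  by_contra h
  rw [ncCoeff_ncWord, if_neg (Ne.symm h)] at hu
  exact hu rfl

theorem IsLeading.list_prod {L : List Word} {P : Word → NCPoly k}
    (h : ∀ l ∈ L, IsLeading (P l) l) : IsLeading (L.map P).prod L.flatten := by
  induction L with
  | nil => exact isLeading_one
  | cons l L ih =>
    rw [List.map_cons, List.prod_cons, List.flatten_cons]
    exact (h l (by simp)).mul (ih fun m hm => h m (by simp [hm]))

/-- The subtracted product `R * P` has least word `r ++ s`, strictly above `s ++ r`, and cannot
disturb the leading term. -/
theorem IsLeading.lie {P R : NCPoly k} {s r : Word} (hP : IsLeading P s) (hR : IsLeading R r)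
    (h : s ++ r < r ++ s) : IsLeading ⁅P, R⁆ (s ++ r) := by
  have h1 := hP.mul hR
  have h2 := hR.mul hP
  have hrank : rank (s ++ r) < rank (r ++ s) := by
    rw [rank_lt_iff]
    exact Or.inr ⟨by simp [add_comm], h⟩
  rw [LieRing.of_associative_ring_bracket]
  constructor
  · have : ncCoeff (R * P) (s ++ r) = 0 := by
      by_contra h0
      rcases h2.2 _ h0 with e | ⟨-, e⟩
      · exact h.ne e
      · exact lt_asymm e hrank
    rw [ncCoeff_sub, h1.1, this, sub_zero]
  · intro u hu
    by_cases h0 : ncCoeff (P * R) u = 0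
    · have h3 : ncCoeff (R * P) u ≠ 0 := by
        intro h3
        rw [ncCoeff_sub, h0, h3, sub_zero] at hu
        exact hu rfl
      right
      rcases h2.2 u h3 with rfl | ⟨e1, e2⟩
      · exact ⟨by rw [weight_append, weight_append, add_comm], hrank⟩
      · exact ⟨by rw [e1, weight_append, weight_append, add_comm], hrank.trans e2⟩
    · exact h1.2 u h0

end Leading

section LyndonPi

variable {k : Type u} [CommRing k] [Algebra ℚ k]

theorem lyndonPi_letter (q : k) (a : Letter) : lyndonPi q [a] = pi1 q [a] := by
  rw [lyndonPi, dif_neg (not_exists_isLyndonCut_singleton a)]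

open Classical in
theorem lyndonPi_of_cut (q : k) {l : Word} (h : ∃ i, IsLyndonCut l i) :
    lyndonPi q l = ⁅lyndonPi q (l.take (Nat.find h)), lyndonPi q (l.drop (Nat.find h))⁆ := by
  rw [lyndonPi, dif_pos h]

/-- The hypothesis on right factors is what makes `(l, m)` the standard factorization of the
concatenation, so that the recursive definition applies to it. -/
theorem lyndonPi_append (q : k) {l m : Word} (hl : IsLyndon l) (hm : IsLyndon m)
    (hlm : RightFactorsGE l m) : lyndonPi q (l ++ m) = ⁅lyndonPi q l, lyndonPi q m⁆ := by
  classical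
  have h : ∃ i, IsLyndonCut (l ++ m) i := by
    refine ⟨l.length, List.length_pos_iff.2 hl.1, ?_, by simpa using hm⟩
    have := List.length_pos_iff.2 hm.1
    simp; omega
  rw [lyndonPi_of_cut q h, find_append hl hm hlm h, List.take_left, List.drop_left]

/-- Induction along standard factorizations. -/
theorem lyndonPi_induction (q : k) {motive : Word → Prop} (letter : ∀ a, motive [a])
    (bracket : ∀ s r, IsLyndon s → IsLyndon r → IsLyndon (s ++ r) →
      lyndonPi q (s ++ r) = ⁅lyndonPi q s, lyndonPi q r⁆ → motive s → motive r → motive (s ++ r))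
    (l : Word) (hl : IsLyndon l) : motive l := by
  classical
  induction hn : l.length using Nat.strong_induction_on generalizing l with
  | _ n ih =>
    subst hn
    rcases hl.exists_cut_or with ⟨a, rfl⟩ | h
    · exact letter a
    · have hspec := Nat.find_spec h
      have h1 := isLyndon_take_find hl h
      have h2 := hspec.2.2
      have e := lyndonPi_of_cut q h
      have h0 := hspec.1
      have h3 := hspec.2.1
      rw [← List.take_append_drop (Nat.find h) l]
      refine bracket _ _ h1 h2 ?_ ?_ (ih _ ?_ _ h1 rfl) (ih _ ?_ _ h2 rfl)
      · rwa [List.take_append_drop]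
      · rwa [List.take_append_drop]
      · rw [List.length_take]; omega
      · rw [List.length_drop]; omega

theorem isLeading_pi1_letter (q : k) (a : Letter) : IsLeading (pi1 q [a]) [a] := by
  refine ⟨by rw [ncCoeff_pi1_letter, if_pos rfl]; exact logCoeff_one q, fun u hu => ?_⟩
  rw [ncCoeff_pi1_letter] at hu
  by_cases hw : weight u = weight [a]
  · by_cases h1 : u.length = 1
    · left
      obtain ⟨b, rfl⟩ := List.length_eq_one_iff.1 h1
      rw [show b = y (OrderDual.ofDual b) from rfl, show a = y (OrderDual.ofDual a) from rfl,
        weight_letter, weight_letter, PNat.coe_inj] at hw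
      rw [OrderDual.ofDual.injective hw]
    · right
      refine ⟨hw, rank_lt_iff.2 (Or.inl ?_)⟩
      have : u.length ≠ 0 := by
        intro h0
        rw [List.length_eq_zero_iff.1 h0, weight_nil] at hw
        exact (weight_singleton_pos a).ne hw
      simp only [List.length_singleton]
      omega
  · rw [if_neg hw] at hu
    exact absurd rfl hu

theorem isLeading_lyndonPi (q : k) {l : Word} (hl : IsLyndon l) : IsLeading (lyndonPi q l) l := by
  refine lyndonPi_induction q (motive := fun l => IsLeading (lyndonPi q l) l) ?_ ?_ l hl
  · intro a
    rw [lyndonPi_letter]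
    exact isLeading_pi1_letter q a
  · intro s r hs hr hsr e h1 h2
    rw [e]
    exact h1.lie h2 ((hsr.2 s r hs.1 hr.1 rfl).trans (lt_append hs.1))

theorem lyndonPi_mem_lieSubalgebra (q : k) {K : LieSubalgebra k (NCPoly k)}
    (hK : ∀ a, pi1 q [a] ∈ K) {l : Word} (hl : IsLyndon l) : lyndonPi q l ∈ K := by
  refine lyndonPi_induction q (motive := fun l => lyndonPi q l ∈ K) ?_ ?_ l hl
  · intro a
    rw [lyndonPi_letter]
    exact hK a
  · intro s r _ _ _ e h1 h2
    rw [e]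
    exact K.lie_mem h1 h2

theorem lyndonPi_mem_primitive (q : k) {l : Word} (hl : IsLyndon l) :
    lyndonPi q l ∈ primitive q :=
  lyndonPi_mem_lieSubalgebra q (pi1_letter_mem_primitive q) hl

theorem isLeading_wordPi (q : k) (w : Word) : IsLeading (wordPi q w) w := by
  have h := lyndonFactorization_spec w
  have := IsLeading.list_prod (P := lyndonPi q) fun l hl => isLeading_lyndonPi q (h.1 l hl)
  rwa [h.2.2] at this

theorem exists_piBasis (q : k) : ∃ B : Module.Basis Word k (NCPoly k), (∀ w, B w = wordPi q w) ∧
    ∀ v w, B.repr (ncWord k v) w ≠ 0 → weight w = weight v :=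
  exists_basis_of_triangular weight finite_weight_eq rank (ncBasis k) (wordPi q)
    (fun w => (isLeading_wordPi q w).1) (fun w u => (isLeading_wordPi q w).2 u)

/-! ### Positivity of the words in terms of the family `Π` -/

theorem wordPi_flatten (q : k) {L : List Word} (h1 : ∀ l ∈ L, IsLyndon l)
    (h2 : L.Pairwise fun a b => b ≤ a) : wordPi q L.flatten = (L.map (lyndonPi q)).prod := by
  rw [wordPi, IsLyndonFactorization.eq ⟨h1, h2, rfl⟩]

/-- The positive combinations of the decreasing products of `Π_l`, with `l` satisfying `p`. -/
def sortedCone (q : k) (p : Word → Prop) : Submodule (positives q) (NCPoly k) :=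
  Submodule.span (positives q) {P | ∃ L : List Word, (∀ l ∈ L, IsLyndon l ∧ p l) ∧
    L.Pairwise (fun a b => b ≤ a) ∧ P = (L.map (lyndonPi q)).prod}

theorem mul_mem_sortedCone (q : k) {p : Word → Prop} {m : Word} (hm : IsLyndon m) (hp : p m)
    (hle : ∀ x, x ≤ m → p x) {P : NCPoly k} (hP : P ∈ sortedCone q (· ≤ m)) :
    lyndonPi q m * P ∈ sortedCone q p := by
  rw [sortedCone] at hP
  induction hP using Submodule.span_induction with
  | mem P hP =>
    obtain ⟨L, h1, h2, rfl⟩ := hP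
    refine Submodule.subset_span ⟨m :: L, fun l hl => ?_,
      List.pairwise_cons.2 ⟨fun l hl => (h1 l hl).2, h2⟩, by simp⟩
    rcases List.mem_cons.1 hl with rfl | hl
    · exact ⟨hm, hp⟩
    · exact ⟨(h1 l hl).1, hle l (h1 l hl).2⟩
  | zero => rw [mul_zero]; exact zero_mem _
  | add x z _ _ hx hz => rw [mul_add]; exact add_mem hx hz
  | smul c x _ hx => rw [mul_smul_comm]; exact Submodule.smul_mem _ _ hx

/-- Rewriting of a product with at most one rise. -/
theorem lyndonPi_mul_prod_mem (q : k) (ms : List Word) (h : Word) (p : Word → Prop)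
    (hh : IsLyndon h) (hms : ∀ m ∈ ms, IsLyndon m) (hsort : ms.Pairwise fun a b => b ≤ a)
    (hstd : ∀ m ∈ ms, RightFactorsGE h m) (hp : ∀ x z, x ≤ z → p z → p x) (hph : p h)
    (hpm : ∀ m ∈ ms, p m) :
    lyndonPi q h * (ms.map (lyndonPi q)).prod ∈ sortedCone q p := by
  induction ms generalizing h p with
  | nil => exact Submodule.subset_span ⟨[h], by simpa using ⟨hh, hph⟩, by simp, by simp⟩
  | cons m ms ih =>
    have hm : IsLyndon m := hms m (by simp)
    rw [List.pairwise_cons] at hsort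
    by_cases hmh : m ≤ h
    · refine Submodule.subset_span ⟨h :: m :: ms, ?_, ?_, by simp⟩
      · intro l hl
        rcases List.mem_cons.1 hl with rfl | hl
        · exact ⟨hh, hph⟩
        · exact ⟨hms l hl, hpm l hl⟩
      · rw [List.pairwise_cons, List.pairwise_cons]
        refine ⟨fun b hb => ?_, hsort⟩
        rcases List.mem_cons.1 hb with rfl | hb
        · exact hmh
        · exact (hsort.1 b hb).trans hmh
    · have hlt := not_le.1 hmh
      have hpm' : p m := hpm m (by simp)
      have hstd' : RightFactorsGE h m := hstd m (by simp)
      -- A rise `h < m` is removed by `Π_h Π_m = Π_{hm} + Π_m Π_h`. Both terms have sign `+`, and in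
      -- each the head then meets a shorter list.
      have e : lyndonPi q h * (((m :: ms).map (lyndonPi q)).prod) =
          lyndonPi q (h ++ m) * (ms.map (lyndonPi q)).prod
            + lyndonPi q m * (lyndonPi q h * (ms.map (lyndonPi q)).prod) := by
        rw [lyndonPi_append q hh hm hstd', LieRing.of_associative_ring_bracket, List.map_cons,
          List.prod_cons, sub_mul, mul_assoc, mul_assoc, sub_add_cancel]
      rw [e]
      refine add_mem ?_ ?_
      · exact ih (h ++ m) p (hh.append hm hlt) (fun x hx => hms x (by simp [hx])) hsort.2
          (fun x hx => rightFactorsGE_append hm hstd' (hsort.1 x hx)) hp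
          (hp _ m (hm.append_lt hh.1 hlt).le hpm') (fun x hx => hpm x (by simp [hx]))
      -- Tracking the bound `· ≤ m` on all factors ensures that `Π_m` can stand in front of the
      -- sorted products. The bound persists because a merged word is smaller than its right part.
      · exact mul_mem_sortedCone q hm hpm' (fun x hx => hp x m hx hpm')
          (ih h (· ≤ m) hh (fun x hx => hms x (by simp [hx])) hsort.2
            (fun x hx => hstd x (by simp [hx])) (fun x z h1 h2 => h1.trans h2) hlt.le hsort.1)

/-- A letter has no proper right factors, so it forms a standard factorization with any larger
Lyndon word, and the sorting procedure may start. -/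
theorem pi1_letter_mul_mem_span (q : k) (a : Letter) {P : NCPoly k}
    (hP : P ∈ Submodule.span (positives q) (Set.range (wordPi q))) :
    pi1 q [a] * P ∈ Submodule.span (positives q) (Set.range (wordPi q)) := by
  induction hP using Submodule.span_induction with
  | mem P hP =>
    obtain ⟨w, rfl⟩ := hP
    have hspec := lyndonFactorization_spec w
    have h := lyndonPi_mul_prod_mem q (lyndonFactorization w) [a] (fun _ => True)
      (isLyndon_singleton a) hspec.1 hspec.2.1 (fun m _ => rightFactorsGE_singleton a m)
      (fun _ _ _ _ => trivial) trivial (fun _ _ => trivial)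
    rw [lyndonPi_letter, ← wordPi] at h
    refine Submodule.span_mono ?_ h
    rintro _ ⟨L, h1, h2, rfl⟩
    exact ⟨L.flatten, wordPi_flatten q (fun l hl => (h1 l hl).1) h2⟩
  | zero => rw [mul_zero]; exact zero_mem _
  | add x z _ _ hx hz => rw [mul_add]; exact add_mem hx hz
  | smul c x _ hx => rw [mul_smul_comm]; exact Submodule.smul_mem _ _ hx

/-- Words are positive combinations of the `Π_w`. -/
theorem ncWord_mem_span_wordPi (q : k) (w : Word) :
    ncWord k w ∈ Submodule.span (positives q) (Set.range (wordPi q)) := by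
  have h := ncWord_mem_adjoin q w
  rw [← Subalgebra.mem_toSubmodule, Algebra.adjoin_eq_span] at h
  refine Submodule.span_le.2 ?_ h
  intro P hP
  induction hP using Submonoid.closure_induction_left with
  | one =>
    refine Submodule.subset_span ⟨[], ?_⟩
    exact wordPi_flatten q (L := []) (by simp) (by simp)
  | mul_left x hx z _ hz =>
    obtain ⟨a, rfl⟩ := hx
    exact pi1_letter_mul_mem_span q a hz

end LyndonPi

/-! ### Products of dual elements -/

section Multisets

theorem count_zero_antidiagonal {α : Type*} [DecidableEq α] (s : Multiset α) :
    s.antidiagonal.count (0, s) = 1 := by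
  induction s using Multiset.induction_on with
  | empty => simp
  | cons a s ih =>
    have hinj : Function.Injective (Prod.map id (Multiset.cons a) : _ → Multiset α × Multiset α) :=
      Function.injective_id.prodMap (fun _ _ => (Multiset.cons_inj_right a).1)
    have h1 : ((0 : Multiset α), a ::ₘ s) = Prod.map id (Multiset.cons a) (0, s) := rfl
    rw [Multiset.antidiagonal_cons, Multiset.count_add, h1, Multiset.count_map_eq_count' _ _ hinj,
      ih, Nat.add_eq_left, Multiset.count_eq_zero, Multiset.mem_map]
    rintro ⟨p, -, hp⟩
    exact Multiset.cons_ne_zero (congrArg Prod.fst hp)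

/-- Any of the equal copies of `a` may be the one split off. These multiplicities are the source of
the factorials in `Σ_w` and `χ_w`. -/
theorem count_singleton_antidiagonal {α : Type*} [DecidableEq α] (a : α) (s : Multiset α) :
    (a ::ₘ s).antidiagonal.count ({a}, s) = s.count a + 1 := by
  induction hn : s.card generalizing s with
  | zero =>
    obtain rfl := Multiset.card_eq_zero.1 hn
    rw [← Multiset.cons_zero, Multiset.antidiagonal_cons]
    simp
  | succ n ih =>
    have hinj : Function.Injective (Prod.map id (Multiset.cons a) : _ → Multiset α × Multiset α) :=
      Function.injective_id.prodMap (fun _ _ => (Multiset.cons_inj_right a).1)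
    have hinj' : Function.Injective (Prod.map (Multiset.cons a) id : _ → Multiset α × Multiset α) :=
      Function.Injective.prodMap (fun _ _ => (Multiset.cons_inj_right a).1) Function.injective_id
    have h2 : (({a} : Multiset α), s) = Prod.map (Multiset.cons a) id (0, s) := rfl
    rw [Multiset.antidiagonal_cons, Multiset.count_add]
    conv_lhs => rw [h2, Multiset.count_map_eq_count' _ _ hinj', count_zero_antidiagonal, ← h2]
    congr 1
    by_cases ha : a ∈ s
    · obtain ⟨t, rfl⟩ := Multiset.exists_cons_of_mem ha
      have h1 : (({a} : Multiset α), a ::ₘ t) = Prod.map id (Multiset.cons a) ({a}, t) := rfl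
      rw [h1, Multiset.count_map_eq_count' _ _ hinj, ih t (by simpa using hn),
        Multiset.count_cons_self]
    · rw [Multiset.count_eq_zero_of_notMem ha, Multiset.count_eq_zero, Multiset.mem_map]
      rintro ⟨p, -, hp⟩
      apply ha
      have := congrArg Prod.snd hp
      simp only [Prod.map_snd] at this
      rw [← this]
      exact Multiset.mem_cons_self _ _

/-- The product of the factorials of the multiplicities. -/
def factorials (μ : Multiset LyndonWord) : ℕ := ∏ l ∈ μ.toFinset, (μ.count l)!

theorem factorials_zero : factorials 0 = 1 := rfl

theorem factorials_cons (l : LyndonWord) (μ : Multiset LyndonWord) :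
    factorials (l ::ₘ μ) = (μ.count l + 1) * factorials μ := by
  have h : factorials μ = ∏ x ∈ (l ::ₘ μ).toFinset, (μ.count x)! := by
    refine Finset.prod_subset (fun x hx => ?_) fun x _ hx => ?_
    · rw [Multiset.mem_toFinset] at hx ⊢
      exact Multiset.mem_cons_of_mem hx
    · rw [Multiset.mem_toFinset] at hx
      rw [Multiset.count_eq_zero_of_notMem hx]
      rfl
  rw [h, factorials]
  have h2 : ∀ x ∈ (l ::ₘ μ).toFinset, ((l ::ₘ μ).count x)! =
      (if x = l then μ.count l + 1 else 1) * (μ.count x)! := by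
    intro x _
    by_cases hx : x = l
    · rw [hx, Multiset.count_cons_self, if_pos rfl, Nat.factorial_succ]
    · rw [Multiset.count_cons_of_ne hx, if_neg hx, one_mul]
  rw [Finset.prod_congr rfl h2, Finset.prod_mul_distrib, Finset.prod_ite_eq', if_pos]
  simp

theorem factorials_ne_zero (μ : Multiset LyndonWord) : (factorials μ : ℚ) ≠ 0 := by
  rw [Nat.cast_ne_zero]
  exact Finset.prod_ne_zero_iff.2 fun l _ => Nat.factorial_ne_zero _

theorem multFactorial_ofMultiset (μ : Multiset LyndonWord) :
    multFactorial (ofMultiset μ) = factorials μ := by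
  have hinj : Function.Injective (Subtype.val : LyndonWord → Word) := Subtype.val_injective
  rw [multFactorial, lyndonFactorization_ofMultiset, factorials]
  conv_rhs => rw [← coe_sorted μ]
  generalize sorted μ = L
  have h : (L.map Subtype.val).toFinset = (L : Multiset LyndonWord).toFinset.map ⟨_, hinj⟩ := by
    ext w
    simp
  rw [h, Finset.prod_map]
  refine Finset.prod_congr rfl fun l _ => ?_
  rw [Function.Embedding.coeFn_mk, List.count_map_of_injective _ _ hinj, Multiset.coe_count]
  congr!

theorem weight_ofMultiset (μ : Multiset LyndonWord) :
    weight (ofMultiset μ) = (μ.map fun l => weight l.1).sum := by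
  rw [ofMultiset, weight_flatten, List.map_map]
  conv_rhs => rw [← coe_sorted μ]
  rfl

end Multisets

section Primitive

variable {k : Type u} [CommRing k]

open QStuffle

/-! ### Primitive elements and dual bases -/

theorem coeff_multiset_prod_nil {q : k} {b : LyndonWord → QStuffle q}
    (hb : ∀ l, coeff (b l) [] = 0) {μ : Multiset LyndonWord} (hμ : μ ≠ 0) :
    coeff (μ.map b).prod [] = 0 := by
  obtain ⟨l, hl⟩ := Multiset.exists_mem_of_ne_zero hμ
  obtain ⟨ν, rfl⟩ := Multiset.exists_cons_of_mem hl
  rw [Multiset.map_cons, Multiset.prod_cons, coeff_mul_nil, hb, zero_mul]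

/-- The coordinate at a word with two or more Lyndon factors is the pairing with a multiple of a
product of proper elements, which a primitive element kills; at the empty word it is a multiple of
the pairing with `1`. Arbitrary dual pairs are allowed so as to cover both `(Σ, Π)` and `(χ, ξ)`. -/
theorem isLyndon_of_mem_primitive {q : k} {B : Module.Basis Word k (QStuffle q)}
    {X : Module.Basis Word k (NCPoly k)} (hdual : ∀ w P, pair q (B w) P = X.repr P w)
    {b : LyndonWord → QStuffle q} (hb : ∀ l, coeff (b l) [] = 0) {c : Multiset LyndonWord → k}
    (hB : ∀ μ, B (ofMultiset μ) = c μ • (μ.map b).prod) {P : NCPoly k} (hP : P ∈ primitive q)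
    {w : Word} (hw : X.repr P w ≠ 0) : IsLyndon w := by
  obtain ⟨μ, rfl⟩ := ofMultiset_bijective.2 w
  rw [← hdual, hB, map_smul, LinearMap.smul_apply, smul_eq_mul] at hw
  replace hw := right_ne_zero_of_mul hw
  by_cases h0 : μ = 0
  · subst h0
    rw [Multiset.map_zero, Multiset.prod_zero, pair_one_of_mem_primitive hP] at hw
    exact absurd rfl hw
  · obtain ⟨l, hl⟩ := Multiset.exists_mem_of_ne_zero h0
    obtain ⟨ν, rfl⟩ := Multiset.exists_cons_of_mem hl
    by_cases hν : ν = 0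
    · subst hν
      rw [Multiset.cons_zero, ofMultiset_singleton]
      exact l.2
    · rw [Multiset.map_cons, Multiset.prod_cons, mem_primitive_iff.1 hP,
        coeff_multiset_prod_nil hb hν, hb, mul_zero, zero_mul, add_zero] at hw
      exact absurd rfl hw

/-- The product of two basis elements at nonempty words is a multiple of the basis element whose
multiset has at least two Lyndon factors, hence is orthogonal to the dual element at a single Lyndon
word. -/
theorem mem_primitive_of_isLyndon {q : k} {B : Module.Basis Word k (QStuffle q)}
    {X : Module.Basis Word k (NCPoly k)} (hdual : ∀ w P, pair q (B w) P = X.repr P w)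
    {b : LyndonWord → QStuffle q} (hb : ∀ l, coeff (b l) [] = 0) {c c' : Multiset LyndonWord → k}
    (hB : ∀ μ, B (ofMultiset μ) = c μ • (μ.map b).prod)
    (hB' : ∀ μ, (μ.map b).prod = c' μ • B (ofMultiset μ)) (l : LyndonWord) :
    X l.1 ∈ primitive q := by
  have hXl : ∀ μ, pair q (B (ofMultiset μ)) (X l.1) = if μ = {l} then 1 else 0 := by
    intro μ
    rw [hdual, Module.Basis.repr_self, Finsupp.single_apply, ← ofMultiset_singleton]
    refine if_congr ?_ rfl rfl
    rw [ofMultiset_bijective.1.eq_iff, eq_comm]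
  have hnil : ∀ μ, μ ≠ 0 → coeff (B (ofMultiset μ)) [] = 0 := by
    intro μ hμ
    rw [hB, map_smul, Finsupp.smul_apply, coeff_multiset_prod_nil hb hμ, smul_zero]
  have h0 : B (ofMultiset 0) = c 0 • 1 := by rw [hB, Multiset.map_zero, Multiset.prod_zero]
  have h1 : pair q (B (ofMultiset 0)) (X l.1) = 0 := by
    rw [hXl, if_neg]
    exact (Multiset.singleton_ne_zero l).symm
  rw [mem_primitive_iff]
  have key : ∀ μ ν : Multiset LyndonWord,
      pair q (B (ofMultiset μ) * B (ofMultiset ν)) (X l.1) =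
        pair q (B (ofMultiset μ)) (X l.1) * coeff (B (ofMultiset ν)) []
          + coeff (B (ofMultiset μ)) [] * pair q (B (ofMultiset ν)) (X l.1) := by
    intro μ ν
    by_cases hμ : μ = 0
    · subst hμ
      rw [h1, zero_mul, zero_add, h0, smul_mul_assoc, one_mul, map_smul, map_smul,
        LinearMap.smul_apply, Finsupp.smul_apply, coeff_one_nil]
      simp
    · by_cases hν : ν = 0
      · subst hν
        rw [h1, mul_zero, add_zero, h0, mul_smul_comm, mul_one, map_smul, map_smul,
          LinearMap.smul_apply, Finsupp.smul_apply, coeff_one_nil]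
        simp [mul_comm]
      · rw [hnil μ hμ, hnil ν hν, mul_zero, zero_mul, add_zero, hB, hB, smul_mul_smul_comm,
          ← Multiset.prod_add, ← Multiset.map_add, hB', map_smul, map_smul, LinearMap.smul_apply,
          LinearMap.smul_apply, hXl, if_neg, smul_zero, smul_zero]
        intro h
        have := congrArg Multiset.card h
        have e1 := Multiset.card_pos.2 hμ
        have e2 := Multiset.card_pos.2 hν
        rw [Multiset.card_add, Multiset.card_singleton] at this
        omega
  intro S T
  have h2 : (mulLin q).compr₂ ((pair q).flip (X l.1)) =
      (LinearMap.mul k k).compl₁₂ ((pair q).flip (X l.1)) ((qBasis q).coord [])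
        + (LinearMap.mul k k).compl₁₂ ((qBasis q).coord []) ((pair q).flip (X l.1)) := by
    refine B.ext fun u => B.ext fun v => ?_
    obtain ⟨μ, rfl⟩ := ofMultiset_bijective.2 u
    obtain ⟨ν, rfl⟩ := ofMultiset_bijective.2 v
    exact key μ ν
  exact congrArg (fun g => g S T) h2

/-- The members of a dual basis indexed by Lyndon words form a basis of the primitive elements. -/
theorem exists_primitive_basis {q : k} {X : Module.Basis Word k (NCPoly k)}
    (h1 : ∀ l : LyndonWord, X l.1 ∈ primitive q)
    (h2 : ∀ P ∈ primitive q, ∀ w, X.repr P w ≠ 0 → IsLyndon w) :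
    ∃ b : Module.Basis LyndonWord k (primitive q), ∀ l, (b l : NCPoly k) = X l.1 := by
  let v : LyndonWord → primitive q := fun l => ⟨X l.1, h1 l⟩
  let i : primitive q →ₗ[k] NCPoly k := (primitive q).incl
  have hi : Function.Injective i := Subtype.val_injective
  have hiv : i ∘ v = X ∘ Subtype.val := rfl
  have hli : LinearIndependent k v := by
    refine LinearIndependent.of_comp i ?_
    rw [hiv]
    exact X.linearIndependent.comp _ Subtype.val_injective
  have htop : ⊤ ≤ Submodule.span k (Set.range v) := by
    intro P _
    have hP : i P ∈ Submodule.span k (X '' {w | IsLyndon w}) :=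
      X.mem_span_image.2 fun w hw => h2 P.1 P.2 w (Finsupp.mem_support_iff.1 hw)
    have e : X '' {w | IsLyndon w} = i '' Set.range v := by
      rw [← Set.range_comp, hiv, Set.range_comp, Subtype.range_coe_subtype]
    rw [e, ← Submodule.map_span] at hP
    obtain ⟨P', hP', h⟩ := hP
    rwa [← hi h]
  exact ⟨Module.Basis.mk hli htop, fun l => by rw [Module.Basis.mk_apply]⟩

theorem pair_ne_zero_weight {q : k} {n : ℕ} {S : QStuffle q} (hS : S ∈ homog q n) {P : NCPoly k}
    {w : Word} (hP : IsLeading P w) (h : pair q S P ≠ 0) : weight w = n := by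
  rw [pair_apply, pairing] at h
  obtain ⟨v, -, hv⟩ := Finset.exists_ne_zero_of_sum_ne_zero h
  rw [← mem_homog.1 hS v (left_ne_zero_of_mul hv), hP.weight_eq (right_ne_zero_of_mul hv)]

theorem isDual_unique_left {q : k} {B : Module.Basis Word k (NCPoly k)} {S T : Word → QStuffle q}
    (hS : IsDual S B) (hT : IsDual T B) : S = T :=
  funext fun v => pair_ext_left (B.ext fun u => by
    rw [isDual_iff.1 hS, isDual_iff.1 hT])

theorem isDual_unique_right {q : k} {B : Module.Basis Word k (QStuffle q)} {P R : Word → NCPoly k}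
    (hP : IsDual B P) (hR : IsDual B R) : P = R :=
  funext fun u => pair_ext_right (q := q) fun S => by
    have : (pair q).flip (P u) = (pair q).flip (R u) := B.ext fun v => by
      rw [LinearMap.flip_apply, LinearMap.flip_apply, isDual_iff.1 hP, isDual_iff.1 hR]
    exact congrArg (fun g => g S) this

theorem isDual_of_basis {q : k} {B : Module.Basis Word k (NCPoly k)}
    {D : Module.Basis Word k (QStuffle q)} (h : ∀ w P, pair q (D w) P = B.repr P w) :
    IsDual D B := by
  rw [isDual_iff]
  intro u v
  rw [h, Module.Basis.repr_self, Finsupp.single_apply]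

end Primitive

/-! ### The coproduct of decreasing products of the `Π_l` -/

section PairPi

variable {k : Type u} [CommRing k] [Algebra ℚ k]

open QStuffle

/-- The decreasing product of the `Π_l` over a multiset of Lyndon words. -/
def multisetPi (q : k) (μ : Multiset LyndonWord) : NCPoly k :=
  ((sorted μ).map fun l => lyndonPi q l.1).prod

theorem wordPi_ofMultiset (q : k) (μ : Multiset LyndonWord) :
    wordPi q (ofMultiset μ) = multisetPi q μ := by
  rw [wordPi, lyndonFactorization_ofMultiset, List.map_map]
  rfl

theorem multisetPi_zero (q : k) : multisetPi q 0 = 1 := by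
  rw [multisetPi, sorted_zero, List.map_nil, List.prod_nil]

theorem multisetPi_cons (q : k) {l : LyndonWord} {μ : Multiset LyndonWord} (h : ∀ m ∈ μ, m ≤ l) :
    multisetPi q (l ::ₘ μ) = lyndonPi q l.1 * multisetPi q μ := by
  rw [multisetPi, sorted_cons h, List.map_cons, List.prod_cons, multisetPi]

theorem multisetPi_singleton (q : k) (l : LyndonWord) : multisetPi q {l} = lyndonPi q l.1 := by
  rw [multisetPi, sorted_singleton, List.map_singleton, List.prod_singleton]

theorem wordPi_lyndon (q : k) (l : LyndonWord) : wordPi q l.1 = lyndonPi q l.1 := by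
  rw [← ofMultiset_singleton, wordPi_ofMultiset, multisetPi_singleton, ofMultiset_singleton]

/-- Each primitive factor goes to the left or to the right. Peeling off the largest factor keeps
both resulting products in decreasing order. -/
theorem coprod_multisetPi (q : k) (μ : Multiset LyndonWord) :
    coprod q (multisetPi q μ) =
      (μ.antidiagonal.map fun p => multisetPi q p.1 ⊗ₜ[k] multisetPi q p.2).sum := by
  have key : ∀ L : List LyndonWord, L.Pairwise (fun a b => b ≤ a) →
      coprod q (multisetPi q L) = ((L : Multiset LyndonWord).antidiagonal.map
        fun p => multisetPi q p.1 ⊗ₜ[k] multisetPi q p.2).sum := by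
    intro L
    induction L with
    | nil =>
      intro _
      rw [Multiset.coe_nil, multisetPi_zero, map_one, Multiset.antidiagonal_zero,
        Multiset.map_singleton, Multiset.sum_singleton, multisetPi_zero]
      rfl
    | cons l L ih =>
      intro h
      rw [List.pairwise_cons] at h
      have hle : ∀ m ∈ (L : Multiset LyndonWord), m ≤ l := fun m hm => h.1 m hm
      have hprim : coprod q (lyndonPi q l.1) = _ := lyndonPi_mem_primitive q l.2
      rw [← Multiset.cons_coe, multisetPi_cons q hle, map_mul, ih h.2, hprim, add_mul,
        Multiset.antidiagonal_cons, Multiset.map_add, Multiset.sum_add, Multiset.map_map,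
        Multiset.map_map, add_comm, ← Multiset.sum_map_mul_left, ← Multiset.sum_map_mul_left]
      congr 2
      · refine Multiset.map_congr rfl fun p hp => ?_
        have hp' : p.2 ≤ L := by
          rw [← Multiset.mem_antidiagonal.1 hp]; exact Multiset.le_add_left _ _
        rw [Algebra.TensorProduct.tmul_mul_tmul, one_mul, Function.comp_apply, Prod.map_fst,
          Prod.map_snd, id, multisetPi_cons q fun m hm => hle m (Multiset.mem_of_le hp' hm)]
      · refine Multiset.map_congr rfl fun p hp => ?_
        have hp' : p.1 ≤ L := by
          rw [← Multiset.mem_antidiagonal.1 hp]; exact Multiset.le_add_right _ _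
        rw [Algebra.TensorProduct.tmul_mul_tmul, one_mul, Function.comp_apply, Prod.map_fst,
          Prod.map_snd, id, multisetPi_cons q fun m hm => hle m (Multiset.mem_of_le hp' hm)]
  rw [← coe_sorted μ]
  exact key _ (pairwise_sorted μ)

theorem pair_mul_multisetPi {q : k} (S T : QStuffle q) (μ : Multiset LyndonWord) :
    pair q (S * T) (multisetPi q μ) = (μ.antidiagonal.map fun p =>
      pair q S (multisetPi q p.1) * pair q T (multisetPi q p.2)).sum := by
  rw [pair_mul, coprod_multisetPi, map_multiset_sum, Multiset.map_map]
  simp only [Function.comp_def, pair₂_tmul]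

/-- Products of elements which are triangular with respect to the `Π_l`. -/
theorem pair_prod_multisetPi {q : k} (r : Multiset LyndonWord → Multiset LyndonWord → Prop)
    (hirr : ∀ μ, ¬ r μ μ)
    (hadd : ∀ α β α' β', (α' = α ∨ r α α') → (β' = β ∨ r β β') →
      (α' = α ∧ β' = β) ∨ r (α + β) (α' + β'))
    (b : LyndonWord → QStuffle q) (h1 : ∀ l, pair q (b l) (multisetPi q {l}) = 1)
    (h2 : ∀ l α, pair q (b l) (multisetPi q α) ≠ 0 → α = {l} ∨ r {l} α)
    (μ : Multiset LyndonWord) :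
    pair q (μ.map b).prod (multisetPi q μ) = factorials μ ∧
      ∀ ν, pair q (μ.map b).prod (multisetPi q ν) ≠ 0 → ν = μ ∨ r μ ν := by
  classical
  induction μ using Multiset.induction_on with
  | empty =>
    rw [Multiset.map_zero, Multiset.prod_zero]
    refine ⟨by rw [multisetPi_zero, pair_one_right, coeff_one_nil, factorials_zero,
      Nat.cast_one], fun ν hν => ?_⟩
    left
    by_contra h
    obtain ⟨l, hl⟩ := Multiset.exists_mem_of_ne_zero h
    apply hν
    have : ncCoeff (wordPi q (ofMultiset ν)) [] = 0 := by
      by_contra h0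
      have := (isLeading_wordPi q (ofMultiset ν)).weight_eq h0
      rw [weight_nil, eq_comm, weight_eq_zero, ← ofMultiset_zero] at this
      exact h (ofMultiset_bijective.1 this)
    rwa [one_def, pair_word, ← wordPi_ofMultiset]
  | cons l μ ih =>
    rw [Multiset.map_cons, Multiset.prod_cons]
    have key : ∀ α β, pair q (b l) (multisetPi q α) *
        pair q (μ.map b).prod (multisetPi q β) ≠ 0 →
          (α = {l} ∧ β = μ) ∨ r (l ::ₘ μ) (α + β) := fun α β h =>
      hadd {l} μ α β (h2 l α (left_ne_zero_of_mul h)) (ih.2 β (right_ne_zero_of_mul h))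
    constructor
    -- Any other splitting with a nonzero contribution would be strictly related to itself by `r`.
    -- The remaining one occurs `count l + 1` times.
    · rw [pair_mul_multisetPi, Multiset.sum_map_eq_nsmul_single ({l}, μ),
        count_singleton_antidiagonal, h1, ih.1, factorials_cons, one_mul, nsmul_eq_mul,
        Nat.cast_mul]
      rintro ⟨α, β⟩ hne hmem
      by_contra h
      rcases key α β h with ⟨rfl, rfl⟩ | h'
      · exact hne rfl
      · rw [Multiset.mem_antidiagonal.1 hmem] at h'
        exact hirr _ h'
    · intro ν hν
      rw [pair_mul_multisetPi] at hν
      have : ∃ p ∈ ν.antidiagonal, pair q (b l) (multisetPi q p.1) *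
          pair q (μ.map b).prod (multisetPi q p.2) ≠ 0 := by
        by_contra hn
        push Not at hn
        refine hν (Multiset.sum_eq_zero fun x hx => ?_)
        obtain ⟨p, hp, rfl⟩ := Multiset.mem_map.1 hx
        exact hn p hp
      obtain ⟨⟨α, β⟩, hmem, hne⟩ := this
      have hs := Multiset.mem_antidiagonal.1 hmem
      rcases key α β hne with ⟨rfl, rfl⟩ | h'
      · left; exact hs.symm
      · right; rwa [← hs]

/-! ### The families `Σ` and `χ` -/

/-- The basis `Π` and its dual basis `Σ`. -/
theorem exists_sigmaBasis (q : k) : ∃ (B : Module.Basis Word k (NCPoly k))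
    (D : Module.Basis Word k (QStuffle q)), (∀ w, B w = wordPi q w) ∧
      (∀ v w, B.repr (ncWord k v) w ≠ 0 → weight w = weight v) ∧
      (∀ w P, pair q (D w) P = B.repr P w) ∧ (∀ S w, D.repr S w = pair q S (wordPi q w)) ∧
      (∀ w, D w ∈ homog q (weight w)) ∧
      (∀ v w, D.repr (word q v) w ≠ 0 → weight w = weight v) := by
  obtain ⟨B, hB, hB2⟩ := exists_piBasis q
  obtain ⟨D, h1, h2, h3⟩ := exists_dual_basis weight finite_weight_eq (qBasis q) (ncBasis k)
    (pair q) (pair_basis q) B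
    (fun w v h => by rw [hB] at h; exact (isLeading_wordPi q w).weight_eq h) hB2
  refine ⟨B, D, hB, hB2, h1, fun S w => ?_, fun w => mem_homog.2 (h2 w), h3⟩
  have : D.coord w = (pair q).flip (wordPi q w) := D.ext fun v => by
    rw [LinearMap.flip_apply, h1, ← hB, Module.Basis.coord_apply, Module.Basis.repr_self,
      Module.Basis.repr_self, Finsupp.single_apply, Finsupp.single_apply]
    simp [eq_comm]
  exact congrArg (fun g => g S) this

theorem algebraMap_inv_factorials_mul (k : Type u) [CommRing k] [Algebra ℚ k]
    (μ : Multiset LyndonWord) :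
    algebraMap ℚ k ((factorials μ : ℚ)⁻¹) * (factorials μ : k) = 1 := by
  rw [show (factorials μ : k) = algebraMap ℚ k (factorials μ) by simp, ← map_mul,
    inv_mul_cancel₀ (factorials_ne_zero μ), map_one]

/-- The family `Σ` is multiplicative. -/
theorem isDual_wordPi_multiplicative {q : k} {S : Word → QStuffle q} (hS : IsDual S (wordPi q))
    (μ : Multiset LyndonWord) :
    S (ofMultiset μ) =
      algebraMap ℚ k ((factorials μ : ℚ)⁻¹) • (μ.map fun l => S l.1).prod := by
  obtain ⟨B, D, hB, -⟩ := exists_sigmaBasis q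
  have hpair : ∀ (l : LyndonWord) (α : Multiset LyndonWord),
      pair q (S l.1) (multisetPi q α) = if α = {l} then 1 else 0 := by
    intro l α
    rw [← wordPi_ofMultiset, isDual_iff.1 hS, ← ofMultiset_singleton]
    exact if_congr ofMultiset_bijective.1.eq_iff rfl rfl
  -- The `Σ_l` are exactly dual to the `Π_l`, so triangularity holds with the empty relation.
  obtain ⟨h1, h2⟩ := pair_prod_multisetPi (q := q) (fun _ _ => False) (fun _ => id)
    (fun α β α' β' h h' => Or.inl ⟨by simpa using h, by simpa using h'⟩) (fun l => S l.1)
    (fun l => by rw [hpair, if_pos rfl])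
    (fun l α h => by
      left
      by_contra h'
      rw [hpair, if_neg h'] at h
      exact h rfl) μ
  refine pair_ext_left (B.ext fun u => ?_)
  obtain ⟨ν, rfl⟩ := ofMultiset_bijective.2 u
  rw [hB, isDual_iff.1 hS, map_smul, LinearMap.smul_apply, smul_eq_mul, wordPi_ofMultiset]
  by_cases h : ν = μ
  · subst h
    rw [if_pos rfl, h1, algebraMap_inv_factorials_mul]
  · rw [if_neg fun e => h (ofMultiset_bijective.1 e)]
    have : pair q (μ.map fun l => S l.1).prod (multisetPi q ν) = 0 := by
      by_contra h0
      simpa [h] using h2 ν h0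
    rw [this, mul_zero]

theorem chi_ofMultiset (q : k) (μ : Multiset LyndonWord) :
    chi q (ofMultiset μ) =
      algebraMap ℚ k ((factorials μ : ℚ)⁻¹) • (μ.map fun l => word q l.1).prod := by
  rw [chi, multFactorial_ofMultiset, lyndonFactorization_ofMultiset, List.map_map]
  conv_rhs => rw [← coe_sorted μ, Multiset.map_coe, Multiset.prod_coe, coe_sorted]
  rfl

theorem prod_words_eq_chi (q : k) (μ : Multiset LyndonWord) :
    (μ.map fun l => word q l.1).prod = (factorials μ : k) • chi q (ofMultiset μ) := by
  rw [chi_ofMultiset, smul_smul, mul_comm, algebraMap_inv_factorials_mul, one_smul]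

theorem chi_mem_homog (q : k) (w : Word) : chi q w ∈ homog q (weight w) := by
  refine Submodule.smul_mem _ _ ?_
  have h := list_prod_mem_homog (lyndonFactorization w) (word q) weight
    (fun l _ => word_mem_homog q l)
  rwa [← weight_flatten, (lyndonFactorization_spec w).2.2] at h

/-- The number of smaller words of the same weight. -/
def rankInWeight (w : Word) : ℕ := ((wordsOfWeight (weight w)).filter fun u => rank u < rank w).card

theorem rankInWeight_lt {v w : Word} (hwt : weight v = weight w) (h : rank v < rank w) :
    rankInWeight v < rankInWeight w := by
  refine Finset.card_lt_card ⟨fun u hu => ?_, fun hs => ?_⟩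
  · rw [Finset.mem_filter] at hu ⊢
    exact ⟨hwt ▸ hu.1, hu.2.trans h⟩
  · have := hs (Finset.mem_filter.2 ⟨mem_wordsOfWeight.2 hwt, h⟩)
    exact lt_irrefl _ (Finset.mem_filter.1 this).2

/-- The rank of a multiset of Lyndon words for which the words `χ` are triangular. -/
def multisetRank (μ : Multiset LyndonWord) : ℕ ×ₗ ℕᵒᵈ :=
  toLex (μ.card, OrderDual.toDual (μ.map fun l => rankInWeight l.1).sum)

theorem multisetRank_lt_iff {μ ν : Multiset LyndonWord} :
    multisetRank μ < multisetRank ν ↔ μ.card < ν.card ∨ μ.card = ν.card ∧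
      (ν.map fun l => rankInWeight l.1).sum < (μ.map fun l => rankInWeight l.1).sum := by
  rw [multisetRank, multisetRank, Prod.Lex.toLex_lt_toLex]
  rfl

/-- A Lyndon word `l` occurs in `Π_α`, for `α ≠ {l}`, only if `α` has several factors or is a single
smaller Lyndon word of the same weight. The rank therefore compares the number of factors, then the
numerical positions in reverse; both are additive, so the comparison passes to products. -/
theorem pair_prod_words (q : k) (μ : Multiset LyndonWord) :
    pair q (μ.map fun l => word q l.1).prod (multisetPi q μ) = factorials μ ∧
      ∀ ν, pair q (μ.map fun l => word q l.1).prod (multisetPi q ν) ≠ 0 →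
        ν = μ ∨ multisetRank μ < multisetRank ν := by
  refine pair_prod_multisetPi (fun μ ν => multisetRank μ < multisetRank ν)
    (fun μ => lt_irrefl _) ?_ _ ?_ ?_ μ
  · intro α β α' β' h h'
    simp only [multisetRank_lt_iff, Multiset.card_add, Multiset.map_add, Multiset.sum_add]
      at h h' ⊢
    rcases h with rfl | h
    · rcases h' with rfl | h'
      · exact Or.inl ⟨rfl, rfl⟩
      · right; omega
    · rcases h' with rfl | h'
      · right; omega
      · right; omega
  · intro l
    rw [multisetPi_singleton, pair_word]
    exact (isLeading_lyndonPi q l.2).1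
  · intro l α h
    rw [pair_word, ← wordPi_ofMultiset] at h
    rcases (isLeading_wordPi q _).2 _ h with e | ⟨hwt, hr⟩
    · left
      rw [← ofMultiset_singleton] at e
      exact (ofMultiset_bijective.1 e).symm
    · right
      rw [multisetRank_lt_iff, Multiset.card_singleton]
      rcases Nat.lt_trichotomy α.card 1 with h1 | h1 | h1
      · rw [Multiset.card_eq_zero.1 (by omega : α.card = 0), ofMultiset_zero, weight_nil] at hwt
        exact absurd hwt (weight_pos l.2.1).ne'
      · obtain ⟨m, rfl⟩ := Multiset.card_eq_one.1 h1
        rw [ofMultiset_singleton] at hwt hr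
        right
        refine ⟨h1.symm, ?_⟩
        simpa using rankInWeight_lt hwt.symm hr
      · exact Or.inl h1

/-- The coordinates of `χ_w` in the basis `Σ` are its pairings with the `Π_v`, and these are
unitriangular by `pair_prod_words`. The second basis is `ξ`, obtained by duality with the roles of
the two algebras exchanged. -/
theorem exists_chiBasis (q : k) : ∃ (C : Module.Basis Word k (QStuffle q))
    (X : Module.Basis Word k (NCPoly k)), (∀ w, C w = chi q w) ∧
      (∀ w P, pair q (C w) P = X.repr P w) ∧ (∀ w S, pair q S (X w) = C.repr S w) := by
  obtain ⟨B, D, -, -, -, hD, -, hD2⟩ := exists_sigmaBasis q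
  have hinv : ∀ μ, wordEquiv.symm (ofMultiset μ) = μ := fun μ => wordEquiv.symm_apply_apply μ
  obtain ⟨C, hC, hC2⟩ := exists_basis_of_triangular weight finite_weight_eq
    (fun w => multisetRank (wordEquiv.symm w)) D (chi q)
    (fun w => by
      obtain ⟨μ, rfl⟩ := ofMultiset_bijective.2 w
      rw [hD, chi_ofMultiset, map_smul, LinearMap.smul_apply, wordPi_ofMultiset,
        (pair_prod_words q μ).1, smul_eq_mul, algebraMap_inv_factorials_mul])
    (fun w v h => by
      rw [hD] at h
      have hwt := pair_ne_zero_weight (chi_mem_homog q w) (isLeading_wordPi q v) h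
      obtain ⟨μ, rfl⟩ := ofMultiset_bijective.2 w
      obtain ⟨ν, rfl⟩ := ofMultiset_bijective.2 v
      rw [chi_ofMultiset, map_smul, LinearMap.smul_apply, wordPi_ofMultiset, smul_eq_mul] at h
      rw [hinv, hinv]
      rcases (pair_prod_words q μ).2 ν (right_ne_zero_of_mul h) with rfl | h'
      · exact Or.inl rfl
      · exact Or.inr ⟨hwt, h'⟩)
  have hC3 : ∀ v w, C.repr (qBasis q v) w ≠ 0 → weight w = weight v := by
    intro v w h
    rw [qBasis_apply, ← D.linearCombination_repr (word q v), Finsupp.linearCombination_apply,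
      Finsupp.sum, map_sum, Finsupp.finsetSum_apply] at h
    obtain ⟨i, -, hi⟩ := Finset.exists_ne_zero_of_sum_ne_zero h
    rw [map_smul, Finsupp.smul_apply, smul_eq_mul] at hi
    rw [hC2 i w (right_ne_zero_of_mul hi), hD2 v i (left_ne_zero_of_mul hi)]
  obtain ⟨X, h1, -, -⟩ := exists_dual_basis weight finite_weight_eq (ncBasis k) (qBasis q)
    (pair q).flip (fun i j => by rw [LinearMap.flip_apply, pair_basis]; simp [eq_comm]) C
    (fun w v h => by rw [hC] at h; exact mem_homog.1 (chi_mem_homog q w) v h) hC3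
  refine ⟨C, X, hC, fun w P => ?_, h1⟩
  have : X.coord w = pair q (C w) := X.ext fun v => by
    have := h1 v (C w)
    rw [LinearMap.flip_apply] at this
    rw [this, Module.Basis.coord_apply, Module.Basis.repr_self, Module.Basis.repr_self,
      Finsupp.single_apply, Finsupp.single_apply]
    simp [eq_comm]
  exact (congrArg (fun g => g P) this).symm

theorem chi_mem_positiveCone (q : k) (w : Word) : chi q w ∈ positiveCone q := by
  refine positive_smul_mem (algebraMap_mem_positives q (by positivity)) ?_
  refine list_prod_mem_positiveCone _ fun S hS => ?_
  obtain ⟨l, -, rfl⟩ := List.mem_map.1 hS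
  exact word_mem_positiveCone q l

/-- Evaluation at the Lyndon words identifies the `q`-stuffle algebra with a polynomial algebra. -/
theorem aeval_lyndonWords_bijective (q : k) :
    Function.Bijective (MvPolynomial.aeval (R := k) fun l : LyndonWord => word q l.1) := by
  obtain ⟨C, -, hC, -⟩ := exists_chiBasis q
  have hunit : ∀ μ : Multiset LyndonWord, IsUnit (factorials μ : k) := fun μ =>
    IsUnit.of_mul_eq_one_right _ (algebraMap_inv_factorials_mul k μ)
  -- Rescaling `χ` by the factorials, units over `ℚ`, gives the monomials in the Lyndon words.
  let C' : Module.Basis (Multiset LyndonWord) k (QStuffle q) :=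
    (C.reindex wordEquiv.symm).isUnitSMul hunit
  have hC' : ∀ μ, C' μ = (μ.map fun l => word q l.1).prod := by
    intro μ
    rw [Module.Basis.isUnitSMul_apply, Module.Basis.reindex_apply, Equiv.symm_symm,
      wordEquiv_apply, hC, prod_words_eq_chi]
  let E : MvPolynomial LyndonWord k ≃ₗ[k] QStuffle q :=
    (MvPolynomial.basisMonomials LyndonWord k).equiv C' Multiset.toFinsupp.toEquiv.symm
  have hE : (MvPolynomial.aeval (R := k) fun l : LyndonWord => word q l.1).toLinearMap =
      E.toLinearMap := by
    refine (MvPolynomial.basisMonomials LyndonWord k).ext fun m => ?_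
    rw [LinearEquiv.coe_coe, Module.Basis.equiv_apply, hC', MvPolynomial.coe_basisMonomials,
      AlgHom.toLinearMap_apply, MvPolynomial.aeval_monomial, map_one, one_mul]
    change _ = (Multiset.map _ (Finsupp.toMultiset m)).prod
    rw [Finsupp.toMultiset_map, Finsupp.prod_toMultiset, Finsupp.prod_mapDomain_index]
    · simp
    · intros; rw [pow_add]
  have : ⇑(MvPolynomial.aeval (R := k) fun l : LyndonWord => word q l.1) = E :=
    funext fun p => congrArg (fun g => g p) hE
  rw [this]
  exact E.bijective

theorem lyndonWords_isTranscendenceBasis (q : k) :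
    IsTranscendenceBasis k (fun l : LyndonWord => word q l.1) := by
  have : Nonempty LyndonWord := ⟨⟨[y 1], isLyndon_singleton _⟩⟩
  have h := IsTranscendenceBasis.mvPolynomial' LyndonWord k
  have h2 := (AlgEquiv.ofBijective _ (aeval_lyndonWords_bijective q)).isTranscendenceBasis h
  refine (congrArg (IsTranscendenceBasis k) (funext fun l => ?_)).mp h2
  exact MvPolynomial.aeval_X _ l

theorem adjoin_lyndonWords (q : k) :
    Algebra.adjoin k (Set.range fun l : LyndonWord => word q l.1) = ⊤ := by
  rw [Algebra.adjoin_range_eq_range_aeval, AlgHom.range_eq_top]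
  exact (aeval_lyndonWords_bijective q).2

end PairPi

/-! ### Double series -/

section Series

variable {A : Type u} [CommRing A]

theorem NCSeries.tendsto_iff {A : Type u} {ι : Type*} {f : ι → NCSeries A} {l : Filter ι} {g : NCSeries A} :
    Filter.Tendsto f l (𝓝 g) ↔ ∀ v, ∀ᶠ i in l, f i v = g v := by
  let : TopologicalSpace A := ⊥
  have : DiscreteTopology A := ⟨rfl⟩
  refine (tendsto_pi_nhds (A := fun _ : Word => A)).trans (forall_congr' fun v => ?_)
  rw [nhds_discrete, Filter.tendsto_pure]

theorem NCSeries.t2Space {A : Type u} : T2Space (NCSeries A) := by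
  let : TopologicalSpace A := ⊥
  have : DiscreteTopology A := ⟨rfl⟩
  exact inferInstanceAs (T2Space (Word → A))

theorem NCSeries.sum_apply {ι : Type*} (s : Finset ι) (f : ι → NCSeries A) (v : Word) :
    (∑ i ∈ s, f i) v = ∑ i ∈ s, f i v := by
  classical
  induction s using Finset.induction_on with
  | empty => rfl
  | insert i s hi ih => rw [Finset.sum_insert hi, Finset.sum_insert hi, NCSeries.add_apply, ih]

/-- Coefficients are discrete, so a sum converges as soon as each coefficient is stationary beyond a
finite index set. -/
theorem NCSeries.hasSum_of_eventually {ι : Type*} {f : ι → NCSeries A} {g : NCSeries A}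
    (s : Word → Finset ι) (h : ∀ v t, s v ⊆ t → ∑ i ∈ t, f i v = g v) : HasSum f g := by
  rw [HasSum, NCSeries.tendsto_iff]
  intro v
  rw [SummationFilter.unconditional_filter]
  filter_upwards [Filter.eventually_ge_atTop (s v)] with t ht
  rw [NCSeries.sum_apply, h v t ht]

end Series

/-! ### Pure tensors as double series -/

section Tensors

variable {k : Type u} [CommRing k] {q : k}

open QStuffle

theorem tens_apply (S : QStuffle q) (P : NCPoly k) (v : Word) :
    tens S P v = ncCoeff P v • S := rfl

theorem tens_mul_tens (S T : QStuffle q) (P R : NCPoly k) :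
    tens S P * tens T R = tens (S * T) (P * R) := by
  ext v
  rw [NCSeries.mul_apply, tens_apply, ncCoeff_mul, Finset.sum_smul]
  refine Finset.sum_congr rfl fun i _ => ?_
  rw [tens_apply, tens_apply, smul_mul_smul_comm]

theorem tens_one_one : tens (1 : QStuffle q) 1 = 1 := by
  ext v
  rw [tens_apply, NCSeries.one_apply, ← ncWord_nil, ncCoeff_ncWord]
  by_cases h : v = []
  · simp [h]
  · simp [h, Ne.symm h]

theorem tens_pow (S : QStuffle q) (P : NCPoly k) (n : ℕ) : tens S P ^ n = tens (S ^ n) (P ^ n) := by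
  induction n with
  | zero => rw [pow_zero, pow_zero, pow_zero, tens_one_one]
  | succ n ih => rw [pow_succ, ih, tens_mul_tens, pow_succ, pow_succ]

theorem smul_tens (c : k) (S : QStuffle q) (P : NCPoly k) : c • tens S P = tens (c • S) P := by
  ext v
  change c • (ncCoeff P v • S) = ncCoeff P v • (c • S)
  rw [smul_comm]

theorem IsLeading.pow {P : NCPoly k} {l : Word} (h : IsLeading P l) (n : ℕ) :
    IsLeading (P ^ n) (List.replicate n l).flatten := by
  induction n with
  | zero => exact isLeading_one
  | succ n ih =>
    rw [pow_succ', List.replicate_succ, List.flatten_cons]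
    exact h.mul ih

/-- The power is homogeneous of weight `n * weight l`, which is at least `n`. Hence each coefficient
of an exponential is a finite sum. -/
theorem ncCoeff_pow_eq_zero {P : NCPoly k} {l : Word} (h : IsLeading P l) (hl : l ≠ []) {n : ℕ}
    {v : Word} (hn : weight v < n) : ncCoeff (P ^ n) v = 0 := by
  by_contra h0
  have := (h.pow n).weight_eq h0
  rw [weight_flatten, List.map_replicate, List.sum_replicate, smul_eq_mul] at this
  have h1 := weight_pos hl
  nlinarith

end Tensors

/-! ### The diagonal series and the product of exponentials -/

section Exponentials

variable {k : Type u} [CommRing k] [Algebra ℚ k] {q : k}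

open QStuffle

theorem hasSum_exp (S : QStuffle q) {P : NCPoly k} {l : Word} (h : IsLeading P l) (hl : l ≠ []) :
    HasSum (fun n : ℕ => algebraMap ℚ k ((n ! : ℚ)⁻¹) • tens S P ^ n)
      (fun v => ∑ n ∈ Finset.range (weight v + 1),
        (algebraMap ℚ k ((n ! : ℚ)⁻¹) • tens S P ^ n : NCSeries (QStuffle q)) v) := by
  refine NCSeries.hasSum_of_eventually (fun v => Finset.range (weight v + 1)) fun v t ht => ?_
  refine (Finset.sum_subset ht fun n _ hn => ?_).symm
  rw [tens_pow, smul_tens, tens_apply, ncCoeff_pow_eq_zero h hl, zero_smul]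
  rw [Finset.mem_range] at hn
  omega

theorem exp_tens_apply (S : QStuffle q) {P : NCPoly k} {l : Word} (h : IsLeading P l)
    (hl : l ≠ []) {v : Word} {N : ℕ} (hv : weight v ≤ N) :
    NCSeries.exp k (tens S P) v = ∑ n ∈ Finset.range (N + 1),
      ncCoeff (P ^ n) v • (algebraMap ℚ k ((n ! : ℚ)⁻¹) • S ^ n) := by
  have : T2Space (NCSeries (QStuffle q)) := NCSeries.t2Space
  rw [NCSeries.exp, (hasSum_exp S h hl).tsum_eq]
  refine (Finset.sum_congr rfl fun n _ => ?_).trans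
    (Finset.sum_subset (s₁ := Finset.range (weight v + 1)) ?_ ?_)
  · rw [tens_pow, smul_tens, tens_apply]
  · exact Finset.range_mono (by omega)
  · intro n _ hn
    rw [ncCoeff_pow_eq_zero h hl, zero_smul]
    rw [Finset.mem_range] at hn
    omega

/-- The coefficients of `∑_w Σ_w ⊗ Π_w`. -/
theorem sum_ncCoeff_smul {S : Word → QStuffle q} (hS : IsDual S (wordPi q)) {v : Word}
    {t : Finset Word} (ht : wordsOfWeight (weight v) ⊆ t) :
    ∑ w ∈ t, ncCoeff (wordPi q w) v • S w = word q v := by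
  obtain ⟨B, -, hB, -⟩ := exists_sigmaBasis q
  refine pair_ext_left (B.ext fun u => ?_)
  rw [hB, pair_word, map_sum, LinearMap.sum_apply]
  simp only [map_smul, LinearMap.smul_apply, isDual_iff.1 hS, smul_eq_mul, mul_ite, mul_one,
    mul_zero, Finset.sum_ite_eq]
  split_ifs with h
  · rfl
  · by_contra h0
    exact h (ht (mem_wordsOfWeight.2 ((isLeading_wordPi q u).weight_eq (Ne.symm h0)).symm))

theorem hasSum_diagonalSeries {S : Word → QStuffle q} (hS : IsDual S (wordPi q)) :
    HasSum (fun w => tens (S w) (wordPi q w)) (diagonalSeries q) :=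
  NCSeries.hasSum_of_eventually (fun v => wordsOfWeight (weight v))
    fun _ _ ht => sum_ncCoeff_smul hS ht

theorem multisetPi_replicate_add {l : LyndonWord} {μ : Multiset LyndonWord} (h : ∀ m ∈ μ, m ≤ l)
    (n : ℕ) : multisetPi q (Multiset.replicate n l + μ) = lyndonPi q l.1 ^ n * multisetPi q μ := by
  induction n with
  | zero => rw [Multiset.replicate_zero, zero_add, pow_zero, one_mul]
  | succ n ih =>
    rw [Multiset.replicate_succ, Multiset.cons_add, multisetPi_cons, ih, pow_succ', mul_assoc]
    intro m hm
    rcases Multiset.mem_add.1 hm with hm | hm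
    · rw [Multiset.eq_of_mem_replicate hm]
    · exact h m hm

theorem factorials_replicate_add {l : LyndonWord} {μ : Multiset LyndonWord} (h : l ∉ μ) (n : ℕ) :
    factorials (Multiset.replicate n l + μ) = n ! * factorials μ := by
  induction n with
  | zero => rw [Multiset.replicate_zero, zero_add, Nat.factorial_zero, one_mul]
  | succ n ih =>
    rw [Multiset.replicate_succ, Multiset.cons_add, factorials_cons, ih, Multiset.count_add,
      Multiset.count_replicate_self, Multiset.count_eq_zero_of_notMem h, Nat.factorial_succ,
      add_zero, mul_assoc]

theorem isDual_wordPi_replicate_add {S : Word → QStuffle q} (hS : IsDual S (wordPi q))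
    {l : LyndonWord} {μ : Multiset LyndonWord} (h : l ∉ μ) (n : ℕ) :
    S (ofMultiset (Multiset.replicate n l + μ)) =
      (algebraMap ℚ k ((n ! : ℚ)⁻¹) • S l.1 ^ n) * S (ofMultiset μ) := by
  rw [isDual_wordPi_multiplicative hS, isDual_wordPi_multiplicative hS,
    factorials_replicate_add h, Multiset.map_add, Multiset.prod_add, Multiset.map_replicate,
    Multiset.prod_replicate, smul_mul_smul_comm, ← map_mul, Nat.cast_mul, mul_inv]

open Classical in
/-- The multisets with elements in a list and multiplicities at most `N`. -/
def boundedMultisets (N : ℕ) : List LyndonWord → Finset (Multiset LyndonWord)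
  | [] => {0}
  | l :: L => (Finset.range (N + 1) ×ˢ boundedMultisets N L).image
      fun p => Multiset.replicate p.1 l + p.2

theorem mem_of_mem_boundedMultisets {N : ℕ} {L : List LyndonWord} {μ : Multiset LyndonWord}
    (h : μ ∈ boundedMultisets N L) {m : LyndonWord} (hm : m ∈ μ) : m ∈ L := by
  induction L generalizing μ with
  | nil =>
    rw [boundedMultisets, Finset.mem_singleton] at h
    subst h
    exact absurd hm (Multiset.notMem_zero m)
  | cons l L ih =>
    rw [boundedMultisets, Finset.mem_image] at h
    obtain ⟨p, hp, rfl⟩ := h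
    rcases Multiset.mem_add.1 hm with hm | hm
    · rw [Multiset.eq_of_mem_replicate hm]
      exact List.mem_cons_self
    · exact List.mem_cons_of_mem _ (ih (Finset.mem_product.1 hp).2 hm)

theorem mem_boundedMultisets {N : ℕ} {L : List LyndonWord} {μ : Multiset LyndonWord}
    (h : ∀ m ∈ μ, m ∈ L) (hN : μ.card ≤ N) : μ ∈ boundedMultisets N L := by
  classical
  induction L generalizing μ with
  | nil =>
    rw [boundedMultisets, Finset.mem_singleton]
    exact Multiset.eq_zero_of_forall_notMem fun m hm => List.not_mem_nil (h m hm)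
  | cons l L ih =>
    rw [boundedMultisets, Finset.mem_image]
    refine ⟨(μ.count l, μ.filter (· ≠ l)), Finset.mem_product.2 ⟨Finset.mem_range.2 ?_, ?_⟩, ?_⟩
    · exact Nat.lt_succ_of_le ((Multiset.count_le_card l μ).trans hN)
    · refine ih (fun m hm => ?_) ((Multiset.card_le_card (Multiset.filter_le _ _)).trans hN)
      rw [Multiset.mem_filter] at hm
      exact (List.mem_cons.1 (h m hm.1)).resolve_left hm.2
    · rw [← Multiset.filter_eq', Multiset.filter_add_not]

/-- Choosing one term in each exponential amounts to choosing a multiplicity for each Lyndon word of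
`L`. The decreasing order of `L` makes the right factors assemble into `multisetPi`, and the
factorials make the left ones assemble into `S`. -/
theorem prod_exp_apply {S : Word → QStuffle q} (hS : IsDual S (wordPi q)) {L : List LyndonWord}
    (hL : L.Pairwise fun a b => b < a) {v : Word} {N : ℕ} (hv : weight v ≤ N) :
    (L.map fun l => NCSeries.exp k (tens (S l.1) (lyndonPi q l.1))).prod v =
      ∑ μ ∈ boundedMultisets N L, ncCoeff (multisetPi q μ) v • S (ofMultiset μ) := by
  induction L generalizing v with
  | nil =>
    have h0 := isDual_wordPi_multiplicative hS 0
    rw [factorials_zero, Multiset.map_zero, Multiset.prod_zero] at h0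
    rw [List.map_nil, List.prod_nil, boundedMultisets, Finset.sum_singleton, multisetPi_zero, h0]
    simp only [Nat.cast_one, inv_one, map_one, one_smul]
    rw [← tens_apply, tens_one_one]
  | cons l L ih =>
    rw [List.pairwise_cons] at hL
    have hlt : ∀ ν ∈ boundedMultisets N L, ∀ m ∈ ν, m < l := fun ν hν m hm =>
      hL.1 m (mem_of_mem_boundedMultisets hν hm)
    have hnot : ∀ ν ∈ boundedMultisets N L, l ∉ ν := fun ν hν hl => lt_irrefl _ (hlt ν hν l hl)
    rw [List.map_cons, List.prod_cons, NCSeries.mul_apply, boundedMultisets, Finset.sum_image,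
      Finset.sum_product]
    · have hw : ∀ i, weight (v.take i) ≤ N ∧ weight (v.drop i) ≤ N := fun i => by
        have : weight (v.take i) + weight (v.drop i) = weight v := by
          rw [← weight_append, List.take_append_drop]
        omega
      have h1 : ∀ i ∈ Finset.range (v.length + 1),
          NCSeries.exp k (tens (S l.1) (lyndonPi q l.1)) (v.take i) *
            (L.map fun l => NCSeries.exp k (tens (S l.1) (lyndonPi q l.1))).prod (v.drop i) =
          ∑ n ∈ Finset.range (N + 1), ∑ ν ∈ boundedMultisets N L,
            (ncCoeff (lyndonPi q l.1 ^ n) (v.take i) * ncCoeff (multisetPi q ν) (v.drop i)) •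
              ((algebraMap ℚ k ((n ! : ℚ)⁻¹) • S l.1 ^ n) * S (ofMultiset ν)) := by
        intro i _
        rw [exp_tens_apply (S l.1) (isLeading_lyndonPi q l.2) l.2.1 (hw i).1, ih hL.2 (hw i).2,
          Finset.sum_mul_sum]
        refine Finset.sum_congr rfl fun n _ => Finset.sum_congr rfl fun ν _ => ?_
        rw [smul_mul_smul_comm]
      rw [Finset.sum_congr rfl h1, Finset.sum_comm]
      refine Finset.sum_congr rfl fun n _ => ?_
      rw [Finset.sum_comm]
      refine Finset.sum_congr rfl fun ν hν => ?_
      rw [← Finset.sum_smul, ← ncCoeff_mul,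
        multisetPi_replicate_add fun m hm => (hlt ν hν m hm).le,
        isDual_wordPi_replicate_add hS (hnot ν hν)]
    · rintro ⟨n, ν⟩ h ⟨n', ν'⟩ h' e
      have hν := hnot ν (Finset.mem_product.1 h).2
      have hν' := hnot ν' (Finset.mem_product.1 h').2
      have hc := congrArg (Multiset.count l) e
      simp only [Multiset.count_add, Multiset.count_replicate_self,
        Multiset.count_eq_zero_of_notMem hν, Multiset.count_eq_zero_of_notMem hν', add_zero] at hc
      subst hc
      rw [Prod.mk.injEq]
      exact ⟨rfl, add_left_cancel e⟩

theorem card_le_weight_ofMultiset (μ : Multiset LyndonWord) : μ.card ≤ weight (ofMultiset μ) := by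
  rw [weight_ofMultiset]
  induction μ using Multiset.induction_on with
  | empty => simp
  | cons l μ ih =>
    rw [Multiset.card_cons, Multiset.map_cons, Multiset.sum_cons]
    have := weight_pos l.2.1
    omega

/-- By homogeneity the coefficient at `v` only sees words of the weight of `v`. Once `F` contains
all Lyndon factors of these finitely many words, the expansion contains all the terms needed. -/
theorem tendsto_expProd {S : Word → QStuffle q} (hS : IsDual S (wordPi q)) :
    Filter.Tendsto (expProd q S) Filter.atTop (𝓝 (diagonalSeries q)) := by
  classical
  rw [NCSeries.tendsto_iff]
  intro v
  filter_upwards [Filter.eventually_ge_atTop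
    ((wordsOfWeight (weight v)).biUnion fun w => (wordEquiv.symm w).toFinset)] with F hF
  have hL : (F.sort fun a b => b ≤ a).Pairwise fun a b => b < a :=
    ((Finset.pairwise_sort F _).and (Finset.sort_nodup F _)).imp
      fun h => lt_of_le_of_ne h.1 (Ne.symm h.2)
  rw [expProd, prod_exp_apply hS hL le_rfl]
  have h := sum_ncCoeff_smul hS (v := v) (t := (boundedMultisets (weight v)
    (F.sort fun a b => b ≤ a)).map ⟨ofMultiset, ofMultiset_bijective.1⟩) ?_
  · rw [Finset.sum_map] at h
    rw [diagonalSeries, ← h]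
    exact Finset.sum_congr rfl fun μ _ => by rw [Function.Embedding.coeFn_mk, wordPi_ofMultiset]
  · intro w hw
    rw [Finset.mem_map]
    have e : ofMultiset (wordEquiv.symm w) = w := wordEquiv.apply_symm_apply w
    refine ⟨wordEquiv.symm w, mem_boundedMultisets (fun m hm => ?_) ?_, e⟩
    · rw [Finset.mem_sort]
      exact hF (Finset.mem_biUnion.2 ⟨w, hw, Multiset.mem_toFinset.2 hm⟩)
    · refine (card_le_weight_ofMultiset _).trans ?_
      rw [e, mem_wordsOfWeight.1 hw]

end Exponentials

/-! ### The free Lie algebra -/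

section FreeLie

variable {k : Type u} [CommRing k]

/-- By the universal property the identity factors through `K`; this is the induction principle used
below. -/
theorem mem_of_generators_mem {X : Type*} {K : LieSubalgebra k (FreeLieAlgebra k X)}
    (h : ∀ a, FreeLieAlgebra.of k a ∈ K) (x : FreeLieAlgebra k X) : x ∈ K := by
  have key : K.incl.comp (FreeLieAlgebra.lift k fun a => (⟨_, h a⟩ : K)) = LieHom.id := by
    refine FreeLieAlgebra.hom_ext fun a => ?_
    rw [LieHom.comp_apply, FreeLieAlgebra.lift_of_apply]
    rfl
  have hx := congrArg (fun f => f x) key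
  simp only [LieHom.comp_apply, LieHom.id_apply] at hx
  rw [← hx]
  exact Subtype.property _

/-- The Lie algebra morphism from the free Lie algebra to noncommutative polynomials. -/
def freeLieToPoly (k : Type u) [CommRing k] : FreeLieAlgebra k Letter →ₗ⁅k⁆ NCPoly k :=
  FreeLieAlgebra.lift k fun a => ncWord k [a]

theorem freeLieToPoly_of (a : Letter) :
    freeLieToPoly k (FreeLieAlgebra.of k a) = ncWord k [a] :=
  FreeLieAlgebra.lift_of_apply ..

theorem ncCoeff_mul_nil (P R : NCPoly k) : ncCoeff (P * R) [] = ncCoeff P [] * ncCoeff R [] := by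
  rw [ncCoeff_mul]
  simp

theorem ncCoeff_freeLieToPoly_nil (x : FreeLieAlgebra k Letter) :
    ncCoeff (freeLieToPoly k x) [] = 0 := by
  let K : LieSubalgebra k (FreeLieAlgebra k Letter) :=
    { LinearMap.ker ((ncCoeffₗ []).comp (freeLieToPoly k : FreeLieAlgebra k Letter →ₗ[k] NCPoly k))
      with
      lie_mem' := fun {x z} _ _ => by
        change ncCoeff (freeLieToPoly k ⁅x, z⁆) [] = 0
        rw [LieHom.map_lie, LieRing.of_associative_ring_bracket, ncCoeff_sub, ncCoeff_mul_nil,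
          ncCoeff_mul_nil, mul_comm, sub_self] }
  refine mem_of_generators_mem (K := K) (fun a => ?_) x
  change ncCoeff (freeLieToPoly k (FreeLieAlgebra.of k a)) [] = 0
  rw [freeLieToPoly_of, ncCoeff_ncWord, if_neg (by simp)]

/-- The iterated bracket of a word. -/
def wordBracket (k : Type u) [CommRing k] : Word → FreeLieAlgebra k Letter
  | [] => 0
  | [a] => FreeLieAlgebra.of k a
  | a :: b :: w => ⁅FreeLieAlgebra.of k a, wordBracket k (b :: w)⁆

/-- The linear map sending a word to its iterated bracket. -/
def dynkin (k : Type u) [CommRing k] : NCPoly k →ₗ[k] FreeLieAlgebra k Letter :=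
  (ncBasis k).constr k (wordBracket k)

theorem dynkin_ncWord (w : Word) : dynkin k (ncWord k w) = wordBracket k w :=
  (ncBasis k).constr_basis k _ w

theorem dynkin_letter_mul (a : Letter) (P : NCPoly k) :
    dynkin k (ncWord k [a] * P) =
      ncCoeff P [] • FreeLieAlgebra.of k a + ⁅FreeLieAlgebra.of k a, dynkin k P⁆ := by
  have key : (dynkin k).comp (LinearMap.mulLeft k (ncWord k [a])) =
      (ncCoeffₗ []).smulRight (FreeLieAlgebra.of k a) +
        (LieAlgebra.ad k _ (FreeLieAlgebra.of k a)).comp (dynkin k) := by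
    refine (ncBasis k).ext fun w => ?_
    simp only [LinearMap.comp_apply, LinearMap.add_apply, LinearMap.mulLeft_apply, ncBasis_apply,
      LinearMap.smulRight_apply, ncCoeffₗ_apply, LieAlgebra.ad_apply, ← ncWord_cons,
      dynkin_ncWord, ncCoeff_ncWord]
    cases w with
    | nil => simp [wordBracket]
    | cons b w => simp [wordBracket]
  exact congrArg (fun f => f P) key

/-- The action of noncommutative polynomials on the free Lie algebra extending the adjoint action of
the letters. -/
def adjointAction (k : Type u) [CommRing k] :
    NCPoly k →ₐ[k] Module.End k (FreeLieAlgebra k Letter) :=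
  MonoidAlgebra.lift k _ _ (FreeMonoid.lift fun a => LieAlgebra.ad k _ (FreeLieAlgebra.of k a))

theorem adjointAction_letter (a : Letter) :
    adjointAction k (ncWord k [a]) = LieAlgebra.ad k _ (FreeLieAlgebra.of k a) := by
  rw [adjointAction, ncWord, MonoidAlgebra.lift_single, one_smul]
  exact FreeMonoid.lift_eval_of _ a

theorem adjointAction_freeLieToPoly (x : FreeLieAlgebra k Letter) :
    adjointAction k (freeLieToPoly k x) = LieAlgebra.ad k _ x := by
  have key : (adjointAction k).toLieHom.comp (freeLieToPoly k) = LieAlgebra.ad k _ := by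
    refine FreeLieAlgebra.hom_ext fun a => ?_
    rw [LieHom.comp_apply, freeLieToPoly_of]
    exact adjointAction_letter a
  exact congrArg (fun f => f x) key

/-- Bracketing from the left by successive letters is the adjoint action. The constant term must
vanish because a single letter is sent to itself and not to a bracket with the image `0` of the
empty word. -/
theorem dynkin_mul (R : NCPoly k) {P : NCPoly k} (hP : ncCoeff P [] = 0) :
    dynkin k (R * P) = adjointAction k R (dynkin k P) := by
  have key : (dynkin k).comp (LinearMap.mulRight k P) =
      (adjointAction k).toLinearMap.flip (dynkin k P) := by
    refine (ncBasis k).ext fun w => ?_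
    simp only [LinearMap.comp_apply, LinearMap.mulRight_apply, LinearMap.flip_apply, ncBasis_apply,
      AlgHom.toLinearMap_apply]
    induction w with
    | nil => rw [ncWord_nil, one_mul, map_one, Module.End.one_apply]
    | cons a w ih =>
      rw [ncWord_cons, mul_assoc, dynkin_letter_mul, ih, ncCoeff_mul_nil, hP, mul_zero, zero_smul,
        zero_add, map_mul, adjointAction_letter, Module.End.mul_apply, LieAlgebra.ad_apply]
  exact congrArg (fun f => f R) key

/-- On the free Lie algebra, the iterated bracket is a derivation. -/
theorem dynkin_freeLieToPoly_lie (x z : FreeLieAlgebra k Letter) :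
    dynkin k (freeLieToPoly k ⁅x, z⁆) =
      ⁅x, dynkin k (freeLieToPoly k z)⁆ + ⁅dynkin k (freeLieToPoly k x), z⁆ := by
  rw [LieHom.map_lie, LieRing.of_associative_ring_bracket, map_sub,
    dynkin_mul _ (ncCoeff_freeLieToPoly_nil z), dynkin_mul _ (ncCoeff_freeLieToPoly_nil x),
    adjointAction_freeLieToPoly, adjointAction_freeLieToPoly, LieAlgebra.ad_apply,
    LieAlgebra.ad_apply, ← lie_skew z, sub_neg_eq_add]

/-- The composite is a derivation fixing the generators, so eigenvalues add under brackets: sums of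
eigenvectors with positive integer eigenvalues form a Lie subalgebra containing the generators. -/
theorem mem_iSup_eigenspace (x : FreeLieAlgebra k Letter) :
    x ∈ ⨆ n : ℕ, Module.End.eigenspace
      ((dynkin k).comp (freeLieToPoly k : FreeLieAlgebra k Letter →ₗ[k] NCPoly k))
      ((n + 1 : ℕ) : k) := by
  set E := (dynkin k).comp (freeLieToPoly k : FreeLieAlgebra k Letter →ₗ[k] NCPoly k) with hE
  have hEx : ∀ x, E x = dynkin k (freeLieToPoly k x) := fun _ => rfl
  let K : LieSubalgebra k (FreeLieAlgebra k Letter) :=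
    { (⨆ n : ℕ, Module.End.eigenspace E ((n + 1 : ℕ) : k)) with
      lie_mem' := fun {x z} hx hz => by
        change ⁅x, z⁆ ∈ ⨆ n : ℕ, Module.End.eigenspace E ((n + 1 : ℕ) : k)
        refine Submodule.iSup_induction _ (motive := fun x =>
          ⁅x, z⁆ ∈ ⨆ n : ℕ, Module.End.eigenspace E ((n + 1 : ℕ) : k)) hx (fun m x hx => ?_)
          (by rw [zero_lie]; exact zero_mem _)
          (fun x x' h h' => by rw [add_lie]; exact add_mem h h')
        refine Submodule.iSup_induction _ (motive := fun z =>
          ⁅x, z⁆ ∈ ⨆ n : ℕ, Module.End.eigenspace E ((n + 1 : ℕ) : k)) hz (fun n z hz => ?_)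
          (by rw [lie_zero]; exact zero_mem _)
          (fun x x' h h' => by rw [lie_add]; exact add_mem h h')
        -- The index `n` stands for the eigenvalue `n + 1`, and `(m + 1) + (n + 1) = (m + n + 1) +
        -- 1`.
        refine Submodule.mem_iSup_of_mem (m + n + 1) ?_
        rw [Module.End.mem_eigenspace_iff] at hx hz ⊢
        rw [hEx, dynkin_freeLieToPoly_lie, ← hEx, ← hEx, hx, hz, lie_smul, smul_lie, ← add_smul]
        push_cast
        ring_nf }
  refine mem_of_generators_mem (K := K) (fun a => ?_) x
  refine Submodule.mem_iSup_of_mem 0 ?_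
  rw [Module.End.mem_eigenspace_iff, hEx, freeLieToPoly_of, dynkin_ncWord, wordBracket]
  simp

/-- An element of the kernel is killed by the Dynkin composite `E`, whose eigenvalues on the
summands are invertible integers. A product of factors `1 - X/(n+1)` gives `p` with `p(0) = 1` and
`p(E) x = 0`; since `E x = 0`, this says `x = 0`. No independence of eigenspaces over `k` is needed.
-/
theorem freeLieToPoly_injective [Algebra ℚ k] : Function.Injective (freeLieToPoly k) := by
  refine (injective_iff_map_eq_zero _).2 fun x hx => ?_
  have hE : ((dynkin k).comp (freeLieToPoly k : FreeLieAlgebra k Letter →ₗ[k] NCPoly k)) x = 0 := by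
    rw [LinearMap.comp_apply, LieHom.coe_toLinearMap, hx, map_zero]
  have hmem := mem_iSup_eigenspace x
  generalize (dynkin k).comp (freeLieToPoly k : FreeLieAlgebra k Letter →ₗ[k] NCPoly k) = E
    at hE hmem
  obtain ⟨p, hp0, hp⟩ : ∃ p : Polynomial k, p.coeff 0 = 1 ∧ Polynomial.aeval E p x = 0 := by
    refine Submodule.iSup_induction _ (motive := fun x =>
      ∃ p : Polynomial k, p.coeff 0 = 1 ∧ Polynomial.aeval E p x = 0) hmem (fun n x hx => ?_)
      ⟨1, by simp, map_zero _⟩ ?_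
    · rw [Module.End.mem_eigenspace_iff] at hx
      refine ⟨1 - Polynomial.C (algebraMap ℚ k ((n + 1 : ℕ) : ℚ)⁻¹) * Polynomial.X,
        by rw [Polynomial.coeff_sub, Polynomial.coeff_one_zero, Polynomial.mul_coeff_zero,
          Polynomial.coeff_X_zero, mul_zero, sub_zero], ?_⟩
      have h1 : algebraMap ℚ k ((n + 1 : ℕ) : ℚ)⁻¹ * ((n + 1 : ℕ) : k) = 1 := by
        rw [← map_natCast (algebraMap ℚ k), ← map_mul,
          inv_mul_cancel₀ (Nat.cast_ne_zero.2 n.succ_ne_zero), map_one]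
      rw [map_sub, map_one, map_mul, Polynomial.aeval_C, Polynomial.aeval_X, LinearMap.sub_apply,
        Module.End.mul_apply, hx, Module.algebraMap_end_apply, smul_smul, h1, one_smul,
        Module.End.one_apply, sub_self]
    · rintro x z ⟨p, hp0, hp⟩ ⟨r, hr0, hr⟩
      refine ⟨p * r, by rw [Polynomial.mul_coeff_zero, hp0, hr0, one_mul], ?_⟩
      rw [map_add, map_mul, Module.End.mul_apply (x := z), hr, map_zero,
        add_zero, Commute.eq (Commute.all p r |>.map (Polynomial.aeval E)), Module.End.mul_apply,
        hp, map_zero]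
  rw [← Polynomial.divX_mul_X_add p, map_add, map_mul, Polynomial.aeval_X, Polynomial.aeval_C,
    LinearMap.add_apply, Module.End.mul_apply, hE, map_zero, zero_add, hp0,
    Module.algebraMap_end_apply, one_smul] at hp
  exact hp

end FreeLie

/-! ### Primitive polynomials as a free Lie algebra -/

section PrimitiveFree

variable {k : Type u} [CommRing k] [Algebra ℚ k]

theorem primitive_mem_span_lyndonPi (q : k) {P : NCPoly k} (hP : P ∈ primitive q) :
    P ∈ Submodule.span k (Set.range fun l : LyndonWord => lyndonPi q l.1) := by
  obtain ⟨B, D, hB, -, hBD, -, hD, -⟩ := exists_sigmaBasis q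
  have hS : IsDual D (wordPi q) := by
    rw [← funext hB]
    exact isDual_of_basis hBD
  rw [← B.linearCombination_repr P, Finsupp.linearCombination_apply]
  refine Submodule.sum_mem _ fun w hw => Submodule.smul_mem _ _ ?_
  have hl : IsLyndon w := isLyndon_of_mem_primitive hBD (b := fun l => D l.1)
    (fun l => by
      by_contra h
      exact (weight_pos l.2.1).ne (mem_homog.1 (hD l.1) [] h))
    (isDual_wordPi_multiplicative hS) hP (Finsupp.mem_support_iff.1 hw)
  rw [hB, wordPi_lyndon q ⟨w, hl⟩]
  exact Submodule.subset_span ⟨⟨w, hl⟩, rfl⟩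

/-- The substitution of the elements `π₁(y_s)` for the letters. -/
def substPi (q : k) : NCPoly k →ₐ[k] NCPoly k :=
  MonoidAlgebra.lift k _ _ (FreeMonoid.lift fun a => pi1 q [a])

theorem substPi_ncWord_cons (q : k) (a : Letter) (w : Word) :
    substPi q (ncWord k (a :: w)) = pi1 q [a] * substPi q (ncWord k w) := by
  rw [ncWord_cons, map_mul, substPi, ncWord, MonoidAlgebra.lift_single, one_smul]
  rfl

theorem substPi_letter (q : k) (a : Letter) : substPi q (ncWord k [a]) = pi1 q [a] := by
  rw [substPi_ncWord_cons, ncWord_nil, map_one, mul_one]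

theorem isLeading_substPi (q : k) (w : Word) : IsLeading (substPi q (ncWord k w)) w := by
  induction w with
  | nil => rw [ncWord_nil, map_one]; exact isLeading_one
  | cons a w ih =>
    rw [substPi_ncWord_cons]
    exact (isLeading_pi1_letter q a).mul ih

/-- The image of a word has that word as its leading term, so words go to a basis. -/
theorem substPi_injective (q : k) : Function.Injective (substPi q) := by
  obtain ⟨B, hB, -⟩ := exists_basis_of_triangular weight finite_weight_eq rank (ncBasis k)
    (fun w => substPi q (ncWord k w)) (fun w => (isLeading_substPi q w).1)
    (fun w u => (isLeading_substPi q w).2 u)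
  have : (substPi q).toLinearMap = ((ncBasis k).equiv B (Equiv.refl _)).toLinearMap :=
    (ncBasis k).ext fun w => by
      rw [LinearEquiv.coe_coe, Module.Basis.equiv_apply, Equiv.refl_apply, hB]
      rfl
  intro P R h
  refine ((ncBasis k).equiv B (Equiv.refl _)).injective ?_
  rw [← LinearEquiv.coe_toLinearMap, ← this]
  exact h

/-- Followed by the inclusion, the canonical map is the embedding into polynomials composed with the
injective substitution, hence injective. Its range is a Lie subalgebra containing the `π₁(y_s)`,
hence all `Π_l`, which span the primitive elements. -/
theorem exists_freeLieEquiv (q : k) : ∃ e : FreeLieAlgebra k Letter ≃ₗ⁅k⁆ primitive q,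
    ∀ a : Letter, (e (FreeLieAlgebra.of k a) : NCPoly k) = pi1 q [a] := by
  let f : FreeLieAlgebra k Letter →ₗ⁅k⁆ primitive q :=
    FreeLieAlgebra.lift k fun a => ⟨pi1 q [a], pi1_letter_mem_primitive q a⟩
  have hf : ∀ a, (f (FreeLieAlgebra.of k a) : NCPoly k) = pi1 q [a] := fun a =>
    congrArg Subtype.val (FreeLieAlgebra.lift_of_apply ..)
  have hcomp : (primitive q).incl.comp f = (substPi q).toLieHom.comp (freeLieToPoly k) := by
    refine FreeLieAlgebra.hom_ext fun a => ?_
    rw [LieHom.comp_apply, LieHom.comp_apply, freeLieToPoly_of]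
    exact (hf a).trans (substPi_letter q a).symm
  have hinj : Function.Injective f := by
    refine Function.Injective.of_comp (f := (primitive q).incl) ?_
    rw [← LieHom.coe_comp, hcomp, LieHom.coe_comp]
    exact (substPi_injective q).comp freeLieToPoly_injective
  have hsurj : Function.Surjective f := by
    rintro ⟨P, hP⟩
    have h : P ∈ ((primitive q).incl.comp f).range := by
      have hle : Submodule.span k (Set.range fun l : LyndonWord => lyndonPi q l.1) ≤
          ((primitive q).incl.comp f).range.toSubmodule := by
        rw [Submodule.span_le]
        rintro _ ⟨l, rfl⟩
        exact lyndonPi_mem_lieSubalgebra q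
          (fun a => (LieHom.mem_range _ _).2 ⟨FreeLieAlgebra.of k a, hf a⟩) l.2
      exact hle (primitive_mem_span_lyndonPi q hP)
    obtain ⟨x, hx⟩ := (LieHom.mem_range _ _).1 h
    exact ⟨x, Subtype.ext hx⟩
  exact ⟨LieEquiv.ofBijective f ⟨hinj, hsurj⟩, hf⟩

end PrimitiveFree

/-! ### The families `Σ` and `ξ` -/

section Conclusion

variable {k : Type u} [CommRing k] [Algebra ℚ k]

open QStuffle

theorem coeff_nil_of_mem_homog {k : Type u} [CommRing k] {q : k} {S : QStuffle q} {w : Word} (hw : w ≠ [])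
    (hS : S ∈ homog q (weight w)) : coeff S [] = 0 := by
  by_contra h
  exact (weight_pos hw).ne (mem_homog.1 hS [] h)

theorem existsUnique_isDual_wordPi (q : k) :
    ∃! S : Word → QStuffle q, IsDual S (wordPi q) := by
  obtain ⟨B, D, hB, -, hBD, -⟩ := exists_sigmaBasis q
  rw [← funext hB]
  exact ⟨D, isDual_of_basis hBD, fun S hS => isDual_unique_left hS (isDual_of_basis hBD)⟩

theorem isDual_wordPi_mem_homog {q : k} {S : Word → QStuffle q} (hS : IsDual S (wordPi q))
    (w : Word) : S w ∈ homog q (weight w) := by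
  obtain ⟨B, D, hB, -, hBD, -, hD, -⟩ := exists_sigmaBasis q
  rw [← funext hB] at hS
  rw [isDual_unique_left hS (isDual_of_basis hBD)]
  exact hD w

/-- The coefficient of `v` in `S w` is the coordinate of `v` along `Π_w`, and `v` is a positive
combination of the `Π_u`. -/
theorem isDual_wordPi_mem_positiveCone {q : k} {S : Word → QStuffle q}
    (hS : IsDual S (wordPi q)) (w : Word) : S w ∈ positiveCone q := by
  refine mem_positiveCone.2 fun v => mem_positives.1 ?_
  rw [← pair_ncWord]
  have h := ncWord_mem_span_wordPi q v
  generalize ncWord k v = P at h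
  induction h using Submodule.span_induction with
  | mem P hP =>
    obtain ⟨u, rfl⟩ := hP
    rw [isDual_iff.1 hS]
    split_ifs
    exacts [one_mem _, zero_mem _]
  | zero => rw [map_zero]; exact zero_mem _
  | add P R _ _ hP hR => rw [map_add]; exact add_mem hP hR
  | smul c P _ hP =>
    rw [show c • P = (c : k) • P from rfl, map_smul]
    exact mul_mem c.2 hP

theorem isDual_chi_iff {q : k} {C : Module.Basis Word k (QStuffle q)}
    {X : Module.Basis Word k (NCPoly k)} (hC : ∀ w, C w = chi q w)
    (hCX : ∀ w P, pair q (C w) P = X.repr P w) {Z : Word → NCPoly k} :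
    IsDual (chi q) Z ↔ Z = X := by
  have hX := isDual_of_basis hCX
  rw [← funext hC]
  exact ⟨fun h => isDual_unique_right h hX, fun h => h ▸ hX⟩

theorem exists_primitive_basis_of_isDual_chi {q : k} {X : Word → NCPoly k}
    (hX : IsDual (chi q) X) :
    (∃ b : Module.Basis Word k (NCPoly k), ∀ w, b w = X w) ∧
      ∃ b : Module.Basis LyndonWord k (primitive q), ∀ l, (b l : NCPoly k) = X l.1 := by
  obtain ⟨C, Z, hC, hCZ, -⟩ := exists_chiBasis q
  rw [isDual_chi_iff hC hCZ] at hX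
  subst hX
  have hb : ∀ l : LyndonWord, coeff (word q l.1) [] = 0 := fun l => coeff_word_nil q l.2.1
  have hB : ∀ μ, C (ofMultiset μ) =
      algebraMap ℚ k ((factorials μ : ℚ)⁻¹) • (μ.map fun l => word q l.1).prod := fun μ => by
    rw [hC, chi_ofMultiset]
  have hB' : ∀ μ : Multiset LyndonWord, (μ.map fun l => word q l.1).prod =
      (factorials μ : k) • C (ofMultiset μ) := fun μ => by
    rw [hC, prod_words_eq_chi]
  exact ⟨⟨Z, fun _ => rfl⟩, exists_primitive_basis (mem_primitive_of_isLyndon hCZ hb hB hB')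
    fun P hP w hw => isLyndon_of_mem_primitive hCZ hb hB hP hw⟩

end Conclusion

end QStuffleHopf

end

/-! ### The main theorem -/

theorem mainTheorem3 {k : Type*} [CommRing k] [Algebra ℚ k] (q : k) :
    -- the family `Σ` dual to `Π` exists and is unique
    (∃! S : QStuffleHopf.Word → QStuffleHopf.QStuffle q,
      QStuffleHopf.IsDual S (QStuffleHopf.wordPi q)) ∧
    (∀ S : QStuffleHopf.Word → QStuffleHopf.QStuffle q,
      QStuffleHopf.IsDual S (QStuffleHopf.wordPi q) →
      -- for `w` nonempty, `Σ_w` is proper, homogeneous of weight `(w)`, with positive coefficients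
      (∀ w : QStuffleHopf.Word, w ≠ [] →
        QStuffleHopf.QStuffle.coeff (S w) [] = 0 ∧
        (∀ v, QStuffleHopf.QStuffle.coeff (S w) v ≠ 0 →
          QStuffleHopf.weight v = QStuffleHopf.weight w) ∧
        (∀ v, QStuffleHopf.IsPositiveRational q (QStuffleHopf.QStuffle.coeff (S w) v))) ∧
      -- `𝒟_Y = ∑_w Σ_w ⊗ Π_w`
      HasSum (fun w => QStuffleHopf.tens (S w) (QStuffleHopf.wordPi q w))
        (QStuffleHopf.diagonalSeries q) ∧
      -- the exponential series converge, and `𝒟_Y` is the decreasing product of the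
      -- `exp(Σ_l ⊗ Π_l)` over all Lyndon words `l`
      (∀ l : QStuffleHopf.LyndonWord,
        Summable fun n : ℕ => algebraMap ℚ k ((n.factorial : ℚ)⁻¹) •
          QStuffleHopf.tens (S l.1) (QStuffleHopf.lyndonPi q l.1) ^ n) ∧
      Filter.Tendsto (QStuffleHopf.expProd q S) Filter.atTop
        (𝓝 (QStuffleHopf.diagonalSeries q))) ∧
    -- the Lyndon words freely generate the `q`-stuffle algebra
    (IsTranscendenceBasis k
      (fun l : QStuffleHopf.LyndonWord => QStuffleHopf.QStuffle.word q l.1) ∧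
    Algebra.adjoin k (Set.range
      (fun l : QStuffleHopf.LyndonWord => QStuffleHopf.QStuffle.word q l.1)) = ⊤) ∧
    -- the `χ_w` have positive coefficients, are proper for `w` nonempty, and form a basis
    (∀ w : QStuffleHopf.Word,
      (w ≠ [] → QStuffleHopf.QStuffle.coeff (QStuffleHopf.chi q w) [] = 0) ∧
      (∀ v, QStuffleHopf.IsPositiveRational q
        (QStuffleHopf.QStuffle.coeff (QStuffleHopf.chi q w) v))) ∧
    (∃ b : Module.Basis QStuffleHopf.Word k (QStuffleHopf.QStuffle q),
      ∀ w, b w = QStuffleHopf.chi q w) ∧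
    -- the dual family `ξ` exists, is unique, and is a basis of `k⟨Y⟩`
    (∃! X : QStuffleHopf.Word → QStuffleHopf.NCPoly k,
      QStuffleHopf.IsDual (QStuffleHopf.chi q) X) ∧
    (∀ X : QStuffleHopf.Word → QStuffleHopf.NCPoly k,
      QStuffleHopf.IsDual (QStuffleHopf.chi q) X →
      (∃ b : Module.Basis QStuffleHopf.Word k (QStuffleHopf.NCPoly k), ∀ w, b w = X w) ∧
      -- the `ξ_l`, `l` Lyndon, form a basis of the Lie algebra of primitive polynomials
      (∃ b : Module.Basis QStuffleHopf.LyndonWord k (QStuffleHopf.primitive q),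
        ∀ l, (b l : QStuffleHopf.NCPoly k) = X l.1)) ∧
    -- which is the free Lie algebra on the elements `π₁(y)`, `y ∈ Y`
    (∃ e : FreeLieAlgebra k QStuffleHopf.Letter ≃ₗ⁅k⁆ QStuffleHopf.primitive q,
      ∀ a : QStuffleHopf.Letter,
        (e (FreeLieAlgebra.of k a) : QStuffleHopf.NCPoly k) = QStuffleHopf.pi1 q [a]) := by
  obtain ⟨C, X, hC, hX, -⟩ := QStuffleHopf.exists_chiBasis q
  refine ⟨QStuffleHopf.existsUnique_isDual_wordPi q, fun S hS => ⟨fun w hw => ?_,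
      QStuffleHopf.hasSum_diagonalSeries hS, fun l => ?_, QStuffleHopf.tendsto_expProd hS⟩,
    ⟨QStuffleHopf.lyndonWords_isTranscendenceBasis q, QStuffleHopf.adjoin_lyndonWords q⟩,
    fun w => ⟨fun hw => QStuffleHopf.coeff_nil_of_mem_homog hw (QStuffleHopf.chi_mem_homog q w),
      QStuffleHopf.mem_positiveCone.1 (QStuffleHopf.chi_mem_positiveCone q w)⟩,
    ⟨C, hC⟩,
    ⟨X, (QStuffleHopf.isDual_chi_iff hC hX).2 rfl, fun Z => (QStuffleHopf.isDual_chi_iff hC hX).1⟩,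
    fun Z => QStuffleHopf.exists_primitive_basis_of_isDual_chi, QStuffleHopf.exists_freeLieEquiv q⟩
  · have h := QStuffleHopf.isDual_wordPi_mem_homog hS w
    exact ⟨QStuffleHopf.coeff_nil_of_mem_homog hw h, QStuffleHopf.mem_homog.1 h,
      QStuffleHopf.mem_positiveCone.1 (QStuffleHopf.isDual_wordPi_mem_positiveCone hS w)⟩
  · exact (QStuffleHopf.hasSum_exp _ (QStuffleHopf.isLeading_lyndonPi q l.2) l.2.1).summable
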